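/- **Setting.** Let $W$ be a real random variable with $\mathbb P(W>0)=1$, $\mathbb P(W=1)<1$, $\mathbb E[W]=1$, $\mathbb E[W\log_2 W]<1$ and $\mathbb E[W^p]<\infty$ for all $p\in\mathbb R$. Put $$\tau(p)=p-\log_2\mathbb E[W^p]-1,\qquad p\in\mathbb R .$$ Fix $T>0$ and $\chi>0$. Let $(W^{(m)}_r)$, indexed by $m\in\mathbb N=\{0,1,2,\dots\}$ and by nonempty finite words $r\in\bigcup_{j\ge1}\{0,1\}^j$, be i.i.d. copies of $W$. For a word $r=(r_1,\dots,r_j)$ write $r|i=(r_1,\dots,r_i)$ and $\overline r=2^j\sum_{i=1}^j r_i2^{-i}$, and let $I_{j,k}=[k2^{-j}T,(k+1)2^{-j}T]$. For each $m$ let $\mu^{(m)}_j$ be the measure on $[0,T]$ whose density with respect to Lebesgue measure equals $\prod_{i=1}^jW^{(m)}_{r|i}$ on $I_{j,\overline r}$, $r\in\{0,1\}^j$; almost surely $\mu^{(m)}_j$ converges weakly as $j\to\infty$ to a measure $\mu^{(m)}_\infty$. Define $\tilde\mu$ on $[0,\infty)$ by $$\tilde\mu([t_1,t_2])=\sum_{m=0}^\infty\mu^{(m)}_\infty([t_1-mT,t_2-mT]),\qquad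 0\le t_1\le t_2 .$$ Let $N=N(j)=\lfloor 2^{j\chi}\rfloor\,2^j$, and $$p_\chi^+=\inf\{p\ge1: p\tau'(p)-\tau(p)\le-\chi\}\in(1,\infty],\qquad p_\chi^-=\sup\{p\le0: p\tau'(p)-\tau(p)\le-\chi\}\in[-\infty,0),$$ and, when these are finite, $h_\chi^+=\tau'(p_\chi^+)$ and $h_\chi^-=\tau'(p_\chi^-)$. **Theorem (scaling of the supremum and the infimum of the mass).** If $p_\chi^+<\infty$ and $\tau(p_\chi^+)\ge0$, then almost surely $$\lim_{j\to\infty}\frac{\log_2\sup_{0\le k\le N-1}\tilde\mu(I_{j,k})}{-j}=h_\chi^+ .$$ If $p_\chi^->-\infty$, then almost surely $$\lim_{j\to\infty}\frac{\log_2\inf_{0\le k\le N-1}\tilde\mu(I_{j,k})}{-j}=h_\chi^- .$$ -/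

import Mathlib

open MeasureTheory ProbabilityTheory Filter Topology

namespace MixedCascade

/-- The dyadic interval `I_{j,k} = [k 2^{-j} T, (k+1) 2^{-j} T]`. -/
def dyadicInterval (T : ℝ) (j k : ℕ) : Set ℝ :=
  Set.Icc ((k : ℝ) * (2 : ℝ)⁻¹ ^ j * T) (((k : ℝ) + 1) * (2 : ℝ)⁻¹ ^ j * T)

/-- For a word `r = (r_1, …, r_j)` of `0`s and `1`s (here `r_{i+1}` is `r i`), the integer
`2^j ∑_{i=1}^j r_i 2^{-i}`. -/
def wordIndex {j : ℕ} (r : Fin j → Bool) : ℕ :=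
  ∑ i : Fin j, (r i).toNat * 2 ^ (j - 1 - (i : ℕ))

/-- The product of the weights `w` along the path to `r`, i.e. `∏_{i=1}^j w (r|i)`, where `r|i` is
the restriction of the word `r` to its first `i` letters. -/
def pathProduct {j : ℕ} (w : List Bool → ℝ) (r : Fin j → Bool) : ℝ :=
  ∏ i ∈ Finset.Icc 1 j, w ((List.ofFn r).take i)

/-- Lebesgue measure on the interval `I_{j,k}`. -/
noncomputable def lebesgueOn (T : ℝ) (j k : ℕ) : FiniteMeasure ℝ :=
  ⟨volume.restrict (dyadicInterval T j k), by unfold dyadicInterval; infer_instance⟩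

/-- The measure `μ_j` on `[0,T]` (as a measure on `ℝ` carried by `[0,T]`), whose density with
respect to Lebesgue measure is `∏_{i=1}^j w (r|i)` on the interval of generation `j` coded by `r`.
The weights are nonnegative in all uses. -/
noncomputable def cascadeStep (T : ℝ) (w : List Bool → ℝ) (j : ℕ) : FiniteMeasure ℝ :=
  ∑ r : Fin j → Bool, (pathProduct w r).toNNReal • lebesgueOn T j (wordIndex r)

/-- The cascade measure `μ_∞`: the limit of `μ_j` in the topology of weak convergence of
finite measures. -/
noncomputable def cascadeMeasure (T : ℝ) (w : List Bool → ℝ) : FiniteMeasure ℝ :=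
  limUnder atTop (cascadeStep T w)

/-- The concatenated measure on `[0, ∞)`: the sum over `m` of the `m`-th cascade measure
translated by `m T`. -/
noncomputable def concatMeasure (T : ℝ) (w : ℕ → List Bool → ℝ) : Measure ℝ :=
  Measure.sum fun m : ℕ =>
    (cascadeMeasure T (w m) : Measure ℝ).map fun x : ℝ => x + (m : ℝ) * T

theorem concatMeasure_Icc (T : ℝ) (w : ℕ → List Bool → ℝ) (s t : ℝ) :
    concatMeasure T w (Set.Icc s t) =
      ∑' m : ℕ, (cascadeMeasure T (w m) : Measure ℝ)
        (Set.Icc (s - (m : ℝ) * T) (t - (m : ℝ) * T)) := by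
  unfold concatMeasure
  rw [Measure.sum_apply _ measurableSet_Icc]
  refine tsum_congr fun m => ?_
  rw [Measure.map_apply (by fun_prop) measurableSet_Icc]
  simp

/-- The mass given to `I_{j,k}` by the concatenated measure. -/
noncomputable def cellMass (T : ℝ) (w : ℕ → List Bool → ℝ) (j k : ℕ) : ℝ :=
  (concatMeasure T w).real (dyadicInterval T j k)

/-- The number of observed cells `N = N_T 2^j`, with `N_T = ⌊(2^j)^χ⌋`. -/
noncomputable def sampleSize (χ : ℝ) (j : ℕ) : ℕ :=
  ⌊((2 : ℝ) ^ j) ^ χ⌋₊ * 2 ^ j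

/-- `τ(p) = p - log₂ E[W^p] - 1`, where `ν` is the law of `W`. -/
noncomputable def tau (ν : Measure ℝ) (p : ℝ) : ℝ :=
  p - Real.logb 2 (∫ x, x ^ p ∂ν) - 1

/-- `p_χ^+ = inf {p ≥ 1 | p τ'(p) - τ(p) ≤ -χ}` (equal to `∞` if there is no such `p`). -/
noncomputable def pPlus (ν : Measure ℝ) (χ : ℝ) : EReal :=
  sInf ((fun p : ℝ => (p : EReal)) '' {p : ℝ | 1 ≤ p ∧ p * deriv (tau ν) p - tau ν p ≤ -χ})

/-- `p_χ^- = sup {p ≤ 0 | p τ'(p) - τ(p) ≤ -χ}` (equal to `-∞` if there is no such `p`). -/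
noncomputable def pMinus (ν : Measure ℝ) (χ : ℝ) : EReal :=
  sSup ((fun p : ℝ => (p : EReal)) '' {p : ℝ | p ≤ 0 ∧ p * deriv (tau ν) p - tau ν p ≤ -χ})

/-- `h_χ^+ = τ'(p_χ^+)`, used when `p_χ^+` is finite. -/
noncomputable def hPlus (ν : Measure ℝ) (χ : ℝ) : ℝ :=
  deriv (tau ν) (pPlus ν χ).toReal

/-- `h_χ^- = τ'(p_χ^-)`, used when `p_χ^-` is finite. -/
noncomputable def hMinus (ν : Measure ℝ) (χ : ℝ) : ℝ :=
  deriv (tau ν) (pMinus ν χ).toReal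

end MixedCascade

/-! ### Trees of independent weights and their decomposition at the root. -/

namespace MixedCascade
section
open scoped ENNReal NNReal

/-! Let `S_j(p)` be the sum of the `p`-th powers of the observed cell masses at generation `j`. It
is essentially a sum of about `2^(jχ)` independent partition functions, each of mean `2^(-jτ(p))
E[Z^p]`, where `Z` is the total mass of one tree. The key claim is that almost surely `S_j(p)` grows
like `2^(j(χ-τ(p)))` as long as `pτ'(p)-τ(p) > -χ`, for `1 < p < p_χ^+` and for `p_χ^- < p < 0`.

The upper half of the claim follows from the mean, since expectations with geometric decay are
summable (`ae_eventually_sum_partition_le`). The lower half (`ae_eventually_le_sum_partition`) is a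
Chernoff bound using a moment of order `q` slightly above 1. One partition function has `q`-th
moment at most of order `R^j` for any `R > max(2^(-qτ(p)), 2^(-τ(pq)))`, and `2^(jχ)` independent
copies suffice if `2^(-τ(pq)) < 2^(χ(q-1)-qτ(p))`. Differentiating the exponents at `q = 1` turns
this into the condition on `p`.

The maximum `s_j` is then squeezed (`tendsto_logb_sup_div`). With `f = χ-τ`, the bound `s_j^q ≤
S_j(q)` gives the rate at most `f(q)/q`, while `S_j(q) ≤ s_j^(q-q') S_j(q')` gives at least the
slope of `f` between `q'` and `q`. As `q', q → p_χ^+` from below, these tend to `f(p_χ^+)/p_χ^+` and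
`f'(p_χ^+)`, which agree by the defining property of `p_χ^+`. The infimum is the same statement for
the inverses of the masses, with exponents `-q`.

Two inputs remain. The moments `E[Z^p]` are finite, for `p > 1` because `τ(p) > 0`, and for every `p
< 0` because all negative moments of `W` are finite; both come from `Z = W(Z₀+Z₁)/2`. Finally, the
weak limit exists and gives each cell the product of the weights above it times the mass of its
subtree, because the largest cell mass tends to 0. -/

/-- Weights on the full binary tree, the root included. -/
abbrev Tree := List Bool → ℝ≥0∞

/-- The subtree at the child `b` of the root. -/
def child (b : Bool) (u : Tree) : Tree := fun s => u (b :: s)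

/-- The tree with root weight `x` and subtrees `a`, `b`. -/
def graft (x : ℝ≥0∞) (a b : Tree) : Tree
  | [] => x
  | false :: s => a s
  | true :: s => b s

/-- The law of a tree of i.i.d. weights. -/
noncomputable def treeLaw (ν : Measure ℝ≥0∞) [IsProbabilityMeasure ν] : Measure Tree :=
  Measure.infinitePi fun _ => ν

instance (ν : Measure ℝ≥0∞) [IsProbabilityMeasure ν] : IsProbabilityMeasure (treeLaw ν) := by
  unfold treeLaw; infer_instance

@[fun_prop]
theorem measurable_child (b : Bool) : Measurable (child b) := by
  unfold child; fun_prop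

theorem measurable_graft : Measurable fun z : ℝ≥0∞ × Tree × Tree => graft z.1 z.2.1 z.2.2 := by
  refine measurable_pi_iff.2 fun s => ?_
  match s with
  | [] => exact measurable_fst
  | false :: s => exact (measurable_pi_apply s).comp (measurable_fst.comp measurable_snd)
  | true :: s => exact (measurable_pi_apply s).comp (measurable_snd.comp measurable_snd)

@[simp] theorem graft_nil (x : ℝ≥0∞) (a b : Tree) : graft x a b [] = x := rfl
@[simp] theorem child_false_graft (x : ℝ≥0∞) (a b : Tree) : child false (graft x a b) = a := rfl
@[simp] theorem child_true_graft (x : ℝ≥0∞) (a b : Tree) : child true (graft x a b) = b := rfl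

theorem graft_child (u : Tree) : graft (u []) (child false u) (child true u) = u := by
  funext s
  match s with
  | [] => rfl
  | false :: s => rfl
  | true :: s => rfl

theorem prod_word_split (S : Finset (List Bool)) (f : List Bool → ℝ≥0∞) :
    ∏ s ∈ S, f s = (if [] ∈ S then f [] else 1) *
      ((∏ s ∈ S.preimage (List.cons false) (List.cons_injective.injOn), f (false :: s)) *
       ∏ s ∈ S.preimage (List.cons true) (List.cons_injective.injOn), f (true :: s)) := by
  classical
  rw [Finset.prod_preimage', Finset.prod_preimage', ← Finset.prod_filter_mul_prod_filter_not S (· = [])]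
  congr 1
  · rw [Finset.prod_filter, Finset.prod_ite_eq']
  · rw [← Finset.prod_filter_mul_prod_filter_not (S.filter (¬ · = []))
      (· ∈ Set.range (List.cons false))]
    rw [Finset.filter_filter, Finset.filter_filter]
    congr 1 <;> refine Finset.prod_congr (Finset.filter_congr fun s _ => ?_) fun _ _ => rfl
    · constructor
      · rintro ⟨-, h⟩; exact h
      · rintro ⟨t, rfl⟩; simp
    · match s with
      | [] => simp
      | false :: s => simp
      | true :: s => simp

/-- A cylinder pulled back by `graft` is a product of a condition on the root and a cylinder in each
subtree, and cylinders determine an infinite product measure. Every recursion on generations below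
rests on this self-similarity. -/
theorem map_graft (ν : Measure ℝ≥0∞) [IsProbabilityMeasure ν] :
    (ν.prod ((treeLaw ν).prod (treeLaw ν))).map (fun z => graft z.1 z.2.1 z.2.2) = treeLaw ν := by
  refine Measure.eq_infinitePi _ fun S t ht => ?_
  classical
  rw [Measure.map_apply measurable_graft (.pi S.countable_toSet fun _ _ => ht _)]
  have : (fun z : ℝ≥0∞ × Tree × Tree => graft z.1 z.2.1 z.2.2) ⁻¹' (Set.pi S t) =
      (if [] ∈ S then t [] else Set.univ) ×ˢ
      ((Set.pi (S.preimage (List.cons false) (List.cons_injective.injOn) : Finset _)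
        fun s => t (false :: s)) ×ˢ
       (Set.pi (S.preimage (List.cons true) (List.cons_injective.injOn) : Finset _)
        fun s => t (true :: s))) := by
    ext ⟨x, a, b⟩
    simp only [Set.mem_preimage, Set.mem_pi, Set.mem_prod, Finset.mem_coe, Finset.mem_preimage]
    constructor
    · intro h
      refine ⟨?_, fun s hs => h _ hs, fun s hs => h _ hs⟩
      split_ifs with h0
      · exact h _ h0
      · trivial
    · rintro ⟨h0, h1, h2⟩ s hs
      match s with
      | [] => simpa [hs] using h0
      | false :: s => exact h1 _ hs
      | true :: s => exact h2 _ hs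
  rw [this, Measure.prod_prod, Measure.prod_prod, treeLaw, Measure.infinitePi_pi _ (fun _ _ => ht _),
    Measure.infinitePi_pi _ (fun _ _ => ht _), prod_word_split S fun s => ν (t s)]
  congr 1
  split_ifs <;> simp

theorem lintegral_treeLaw (ν : Measure ℝ≥0∞) [IsProbabilityMeasure ν]
    {f : Tree → ℝ≥0∞} (hf : Measurable f) :
    ∫⁻ u, f u ∂treeLaw ν =
      ∫⁻ x, ∫⁻ a, ∫⁻ b, f (graft x a b) ∂treeLaw ν ∂treeLaw ν ∂ν := by
  have hm : Measurable fun z : ℝ≥0∞ × Tree × Tree => f (graft z.1 z.2.1 z.2.2) :=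
    hf.comp measurable_graft
  conv_lhs => rw [← map_graft ν]
  rw [lintegral_map hf measurable_graft, lintegral_prod _ hm.aemeasurable]
  refine lintegral_congr fun x => ?_
  exact lintegral_prod (fun y => f (graft x y.1 y.2)) (hm.comp measurable_prodMk_left).aemeasurable

theorem measurePreserving_child (ν : Measure ℝ≥0∞) [IsProbabilityMeasure ν] (b : Bool) :
    MeasurePreserving (child b) (treeLaw ν) (treeLaw ν) :=
  ⟨measurable_child b, Measure.map_infinitePi_infinitePi_of_inj
    (P := fun _ : List Bool => ν) (f := List.cons b) List.cons_injective⟩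

theorem measurePreserving_root (ν : Measure ℝ≥0∞) [IsProbabilityMeasure ν] :
    MeasurePreserving (fun u : Tree => u []) (treeLaw ν) ν :=
  measurePreserving_eval_infinitePi _ _

/-- The subtree at the word `s`. -/
def subtree (s : List Bool) (u : Tree) : Tree := fun t => u (s ++ t)

theorem measurePreserving_subtree (ν : Measure ℝ≥0∞) [IsProbabilityMeasure ν] (s : List Bool) :
    MeasurePreserving (subtree s) (treeLaw ν) (treeLaw ν) :=
  ⟨by unfold subtree; fun_prop, Measure.map_infinitePi_infinitePi_of_inj
    (P := fun _ : List Bool => ν) (f := fun t => s ++ t) (List.append_right_injective s)⟩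

end
end MixedCascade

/-! ### The martingale of normalized masses. -/

namespace MixedCascade
section
open scoped ENNReal NNReal

/-- The normalized mass of generation `n`, root weight included. -/
noncomputable def genMass : ℕ → Tree → ℝ≥0∞
  | 0, u => u []
  | n + 1, u => u [] * ((genMass n (child false u) + genMass n (child true u)) / 2)

/-- The limit of the normalized masses `genMass n`. -/
noncomputable def totalMass (u : Tree) : ℝ≥0∞ := liminf (fun n => genMass n u) atTop

/-- Replace the weights of generation larger than `n` by `1`. -/
def trunc (n : ℕ) (u : Tree) : Tree := fun s => if s.length ≤ n then u s else 1

@[fun_prop]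
theorem measurable_genMass (n : ℕ) : Measurable (genMass n) := by
  induction n with
  | zero => exact measurable_pi_apply _
  | succ n ih =>
    exact (measurable_pi_apply []).mul (((ih.comp (measurable_child _)).add
      (ih.comp (measurable_child _))).div_const 2)

@[fun_prop]
theorem measurable_totalMass : Measurable totalMass :=
  Measurable.liminf measurable_genMass

@[fun_prop]
theorem measurable_trunc (n : ℕ) : Measurable (trunc n) := by
  refine measurable_pi_iff.2 fun s => ?_
  unfold trunc
  split_ifs
  · exact measurable_pi_apply s
  · exact measurable_const

theorem trunc_trunc {m n : ℕ} (h : m ≤ n) (u : Tree) : trunc m (trunc n u) = trunc m u := by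
  funext s
  unfold trunc
  split_ifs <;> first | rfl | omega

theorem child_trunc (n : ℕ) (b : Bool) (u : Tree) :
    child b (trunc (n + 1) u) = trunc n (child b u) := by
  funext s
  simp [child, trunc]

theorem genMass_trunc (n : ℕ) (u : Tree) : genMass n (trunc n u) = genMass n u := by
  induction n generalizing u with
  | zero => simp [genMass, trunc]
  | succ n ih => simp [genMass, child_trunc, ih]; simp [trunc]

theorem trunc_succ_graft (n : ℕ) (x : ℝ≥0∞) (a b : Tree) :
    trunc (n + 1) (graft x a b) = graft x (trunc n a) (trunc n b) := by
  rw [← graft_child (trunc (n + 1) (graft x a b)), child_trunc, child_trunc]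
  simp [trunc]

theorem trunc_zero_graft (x : ℝ≥0∞) (a b : Tree) :
    trunc 0 (graft x a b) = graft x (fun _ => 1) fun _ => 1 := by
  funext s
  match s with
  | [] => simp [trunc]
  | false :: s => simp [trunc, graft]
  | true :: s => simp [trunc, graft]

variable (ν : Measure ℝ≥0∞) [IsProbabilityMeasure ν]

/-- This is the martingale property, tested against functions of the first `n` generations. Such a
form survives induction through the root: when one subtree is integrated, the root and the other
subtree are absorbed into the test function. -/
theorem lintegral_trunc_mul_genMass_succ (hmean : ∫⁻ x, x ∂ν = 1) (n : ℕ)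
    {g : Tree → ℝ≥0∞} (hg : Measurable g) :
    ∫⁻ u, g (trunc n u) * genMass (n + 1) u ∂treeLaw ν =
      ∫⁻ u, g (trunc n u) * genMass n u ∂treeLaw ν := by
  have hroot : ∫⁻ a : Tree, a [] ∂treeLaw ν = 1 := by
    rw [← hmean]; exact (measurePreserving_root ν).lintegral_comp measurable_id
  induction n generalizing g with
  | zero =>
    rw [lintegral_treeLaw ν (by fun_prop), lintegral_treeLaw ν (by fun_prop)]
    refine lintegral_congr fun x => ?_
    simp only [trunc_zero_graft, genMass, child_false_graft, child_true_graft, graft_nil]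
    have h1 : ∀ a : Tree, ∫⁻ b : Tree, g (graft x (fun _ => 1) fun _ => 1) *
        (x * ((a [] + b []) / 2)) ∂treeLaw ν =
        g (graft x (fun _ => 1) fun _ => 1) * (x * ((a [] + 1) / 2)) := fun a => by
      rw [lintegral_const_mul _ (by fun_prop), lintegral_const_mul _ (by fun_prop)]
      simp_rw [div_eq_mul_inv]
      rw [lintegral_mul_const _ (by fun_prop), lintegral_add_right _ (by fun_prop), hroot]
      simp
    simp_rw [h1]
    rw [lintegral_const_mul _ (by fun_prop), lintegral_const_mul _ (by fun_prop)]
    simp_rw [div_eq_mul_inv]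
    rw [lintegral_mul_const _ (by fun_prop), lintegral_add_right _ (by fun_prop), hroot]
    simp [one_add_one_eq_two, ENNReal.mul_inv_cancel]
  | succ n ih =>
    -- The mass is linear in the two subtree masses. Each term is integrated innermost over the
    -- subtree whose mass it contains, so that the induction hypothesis applies there.
    have key : ∀ (x : ℝ≥0∞) (k : ℕ),
        ∫⁻ a, ∫⁻ b, g (graft x (trunc n a) (trunc n b)) *
          (x * ((genMass k a + genMass k b) / 2)) ∂treeLaw ν ∂treeLaw ν =
        ∫⁻ b, (∫⁻ a, (g (graft x (trunc n a) (trunc n b)) * (x / 2)) * genMass k a ∂treeLaw ν)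
          ∂treeLaw ν +
        ∫⁻ a, (∫⁻ b, (g (graft x (trunc n a) (trunc n b)) * (x / 2)) * genMass k b ∂treeLaw ν)
          ∂treeLaw ν := by
      intro x k
      have hgr : Measurable fun z : Tree × Tree => g (graft x (trunc n z.1) (trunc n z.2)) :=
        (hg.comp measurable_graft).comp (f := fun z : Tree × Tree => (x, trunc n z.1, trunc n z.2))
          (by fun_prop)
      have hA : Measurable fun z : Tree × Tree =>
          g (graft x (trunc n z.1) (trunc n z.2)) * (x / 2) * genMass k z.1 :=
        (hgr.mul_const _).mul (by fun_prop)
      rw [← lintegral_lintegral_swap (f := fun a b =>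
        g (graft x (trunc n a) (trunc n b)) * (x / 2) * genMass k a) hA.aemeasurable,
        ← lintegral_add_left hA.lintegral_prod_right']
      refine lintegral_congr fun a => ?_
      refine Eq.trans ?_ (lintegral_add_left (hA.comp (measurable_prodMk_left (x := a))) _)
      refine lintegral_congr fun b => ?_
      simp only [div_eq_mul_inv, Function.comp]
      ring
    rw [lintegral_treeLaw ν (by fun_prop), lintegral_treeLaw ν (by fun_prop)]
    refine lintegral_congr fun x => ?_
    simp only [trunc_succ_graft]
    have e1 : ∀ (k : ℕ) (a b : Tree), genMass (k + 1) (graft x a b) =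
      x * ((genMass k a + genMass k b) / 2) := fun k a b => rfl
    simp only [e1]
    rw [key x (n + 1), key x n]
    congr 1
    · refine lintegral_congr fun b => ?_
      refine ih (g := fun a => g (graft x a (trunc n b)) * (x / 2)) ?_
      exact ((hg.comp measurable_graft).comp (f := fun a : Tree => (x, a, trunc n b))
        (by fun_prop)).mul_const _
    · refine lintegral_congr fun a => ?_
      refine ih (g := fun b => g (graft x (trunc n a) b) * (x / 2)) ?_
      exact ((hg.comp measurable_graft).comp (f := fun b : Tree => (x, trunc n a, b))
        (by fun_prop)).mul_const _

theorem lintegral_genMass (hmean : ∫⁻ x, x ∂ν = 1) (n : ℕ) :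
    ∫⁻ u, genMass n u ∂treeLaw ν = 1 := by
  induction n with
  | zero => rw [← hmean]; exact (measurePreserving_root ν).lintegral_comp measurable_id
  | succ n ih =>
    have := lintegral_trunc_mul_genMass_succ ν hmean n (g := fun _ => 1) measurable_const
    simp only [one_mul] at this
    rw [this, ih]

/-- The filtration of the generations. -/
def generations : Filtration ℕ (inferInstance : MeasurableSpace Tree) where
  seq n := MeasurableSpace.comap (trunc n) inferInstance
  mono' m n h := by
    have : trunc m = trunc m ∘ trunc n := funext fun u => (trunc_trunc h u).symm
    change MeasurableSpace.comap (trunc m) _ ≤ _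
    rw [this, ← MeasurableSpace.comap_comp]
    exact MeasurableSpace.comap_mono (measurable_trunc m).comap_le
  le' n := (measurable_trunc n).comap_le

theorem martingale_genMass (hmean : ∫⁻ x, x ∂ν = 1) :
    Martingale (fun n u => (genMass n u).toReal) generations (treeLaw ν) := by
  have hfin : ∀ n, ∫⁻ u, genMass n u ∂treeLaw ν ≠ ⊤ := fun n => by
    simp [lintegral_genMass ν hmean n]
  refine martingale_of_setIntegral_eq_succ (fun n => ?_)
    (fun n => integrable_toReal_of_lintegral_ne_top (by fun_prop) (hfin n)) fun n s hs => ?_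
  · refine Measurable.stronglyMeasurable ?_
    -- Adaptedness: the mass of generation `n` factors through `trunc n`.
    have : (fun u => (genMass n u).toReal) = (fun u => (genMass n u).toReal) ∘ trunc n :=
      funext fun u => by simp [genMass_trunc]
    rw [this]
    exact Measurable.comp (by fun_prop) (comap_measurable (trunc n))
  · obtain ⟨t, ht, rfl⟩ := hs
    have hae : ∀ k, ∀ᵐ u ∂treeLaw ν, genMass k u < ⊤ := fun k =>
      ae_lt_top (by fun_prop) (hfin k)
    rw [integral_toReal (by fun_prop) (ae_restrict_of_ae (hae n)),
      integral_toReal (by fun_prop) (ae_restrict_of_ae (hae _))]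
    congr 1
    have hset : ∀ k, ∫⁻ u in trunc n ⁻¹' t, genMass k u ∂treeLaw ν =
        ∫⁻ u, t.indicator 1 (trunc n u) * genMass k u ∂treeLaw ν := fun k => by
      rw [← lintegral_indicator (measurable_trunc n ht)]
      refine lintegral_congr fun u => ?_
      by_cases hu : trunc n u ∈ t <;> simp [Set.indicator, hu]
    rw [hset, hset, lintegral_trunc_mul_genMass_succ ν hmean n (measurable_one.indicator ht)]

/-- A nonnegative martingale of mean 1 is bounded in `L¹`, hence converges almost surely; the liminf
that defines `totalMass` is then a limit. -/
theorem ae_tendsto_genMass (hmean : ∫⁻ x, x ∂ν = 1) :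
    ∀ᵐ u ∂treeLaw ν, Tendsto (fun n => genMass n u) atTop (𝓝 (totalMass u)) ∧ totalMass u ≠ ⊤ := by
  have hfin : ∀ n, ∫⁻ u, genMass n u ∂treeLaw ν ≠ ⊤ := fun n => by
    simp [lintegral_genMass ν hmean n]
  have hae : ∀ᵐ u ∂treeLaw ν, ∀ k, genMass k u < ⊤ :=
    ae_all_iff.2 fun k => ae_lt_top (by fun_prop) (hfin k)
  have hconv := (martingale_genMass ν hmean).submartingale.exists_ae_tendsto_of_bdd (R := 1)
    fun n => by
      rw [eLpNorm_one_eq_lintegral_enorm, ENNReal.coe_one, ← lintegral_genMass ν hmean n]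
      refine lintegral_mono fun u => ?_
      rw [Real.enorm_of_nonneg ENNReal.toReal_nonneg]
      exact ENNReal.ofReal_toReal_le
  filter_upwards [hae, hconv] with u hu ⟨c, hc⟩
  have h : Tendsto (fun n => genMass n u) atTop (𝓝 (ENNReal.ofReal c)) := by
    refine (ENNReal.tendsto_ofReal hc).congr fun n => ?_
    exact ENNReal.ofReal_toReal (hu n).ne
  have h' : totalMass u = ENNReal.ofReal c := h.liminf_eq
  exact ⟨h' ▸ h, by simp [h']⟩

theorem ae_totalMass_eq (hmean : ∫⁻ x, x ∂ν = 1) (hpos : ∀ᵐ x ∂ν, x ≠ 0 ∧ x ≠ ⊤) :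
    ∀ᵐ u ∂treeLaw ν, totalMass u =
      u [] * ((totalMass (child false u) + totalMass (child true u)) / 2) := by
  have h := ae_tendsto_genMass ν hmean
  filter_upwards [h, (measurePreserving_child ν false).quasiMeasurePreserving.ae h,
    (measurePreserving_child ν true).quasiMeasurePreserving.ae h,
    (measurePreserving_root ν).quasiMeasurePreserving.ae hpos] with u h0 h1 h2 h3
  refine tendsto_nhds_unique ((tendsto_add_atTop_iff_nat 1).2 h0.1) ?_
  refine ENNReal.Tendsto.const_mul ?_ (Or.inr h3.2)
  exact ENNReal.Tendsto.div_const (h1.1.add h2.1) (Or.inr (by simp))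

end
end MixedCascade

/-! ### Positive and negative moments of the total mass. -/

namespace MixedCascade
section
open scoped ENNReal NNReal

/-- Bernoulli's inequality for `(1 - b/(a+b))^q` gives `(a+b)^q ≤ a^q + q b (a+b)^(q-1)`, and then
`a + b ≤ 2a`. -/
theorem add_rpow_le_of_le {q : ℝ} (hq : 1 ≤ q) {a b : ℝ} (ha : 0 ≤ a) (hb : 0 ≤ b) (hba : b ≤ a) :
    (a + b) ^ q ≤ a ^ q + q * 2 ^ (q - 1) * (a ^ (q - 1) * b) := by
  rcases ha.eq_or_lt with rfl | ha'
  · obtain rfl : b = 0 := le_antisymm hba hb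
    simp [Real.zero_rpow (show q ≠ 0 by linarith)]
  have hs : 0 < a + b := by linarith
  have h1 := one_add_mul_self_le_rpow_one_add (s := -(b / (a + b)))
    (by rw [neg_le_neg_iff, div_le_one hs]; linarith) hq
  have h2 : 1 + -(b / (a + b)) = a / (a + b) := by field_simp; ring
  rw [h2, Real.div_rpow ha hs.le, le_div_iff₀ (by positivity)] at h1
  have h3 : (a + b) ^ q = (a + b) ^ (q - 1) * (a + b) := by
    rw [← Real.rpow_add_one hs.ne']; ring_nf
  have h4 : (a + b) ^ (q - 1) ≤ 2 ^ (q - 1) * a ^ (q - 1) := by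
    rw [← Real.mul_rpow (by norm_num) ha]
    exact Real.rpow_le_rpow hs.le (by linarith) (by linarith)
  have h5 : (1 + q * -(b / (a + b))) * (a + b) ^ q = (a + b) ^ q - q * b * (a + b) ^ (q - 1) := by
    rw [h3]; field_simp; ring
  rw [h5] at h1
  have h6 : q * b * (a + b) ^ (q - 1) ≤ q * b * (2 ^ (q - 1) * a ^ (q - 1)) := by gcongr
  nlinarith

theorem ennreal_rpow_le_rpow_of_nonpos {a b : ℝ≥0∞} {s : ℝ} (hs : s ≤ 0) (h : a ≤ b) :
    b ^ s ≤ a ^ s := by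
  have e : ∀ x : ℝ≥0∞, x ^ s = (x ^ (-s))⁻¹ := fun x => by rw [← ENNReal.rpow_neg, neg_neg]
  rw [e, e]
  exact ENNReal.inv_le_inv.2 (ENNReal.rpow_le_rpow h (neg_nonneg.2 hs))

/-- The constant in the almost additivity of `x ↦ x ^ q`. -/
noncomputable def crossConst (q : ℝ) : ℝ := q * 2 ^ (q - 1)

/-- The diagonal terms have coefficient 1, so no growth rate is lost in a recursion. For independent
variables the cross terms factor into moments of the lower orders `q-1` and 1. -/
theorem ennreal_add_rpow_le {q : ℝ} (hq : 1 < q) (a b : ℝ≥0∞) :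
    (a + b) ^ q ≤ a ^ q + b ^ q +
      ENNReal.ofReal (crossConst q) * (a ^ (q - 1) * b + b ^ (q - 1) * a) := by
  wlog hba : b ≤ a generalizing a b
  · have := this b a (le_of_not_ge hba)
    rwa [add_comm b a, add_comm (b ^ q), add_comm (b ^ (q - 1) * a)] at this
  by_cases ha : a = ⊤
  · subst ha; simp [ENNReal.top_rpow_of_pos (show 0 < q by linarith)]
  have hb : b ≠ ⊤ := ne_top_of_le_ne_top ha hba
  lift a to ℝ≥0 using ha
  lift b to ℝ≥0 using hb
  have h := add_rpow_le_of_le hq.le a.2 b.2 (by exact_mod_cast hba)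
  have h' : ((a : ℝ≥0∞) + b) ^ q ≤
      (a : ℝ≥0∞) ^ q + ENNReal.ofReal (crossConst q) * ((a : ℝ≥0∞) ^ (q - 1) * b) := by
    have e : ∀ (x : ℝ≥0) (r : ℝ), 0 ≤ r → (x : ℝ≥0∞) ^ r = ENNReal.ofReal ((x : ℝ) ^ r) :=
      fun x r hr => by
        have := ENNReal.ofReal_rpow_of_nonneg x.coe_nonneg hr
        rwa [ENNReal.ofReal_coe_nnreal] at this
    rw [← ENNReal.coe_add, e _ _ (by linarith), e _ _ (by linarith), e _ _ (by linarith),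
      ← ENNReal.ofReal_coe_nnreal (p := b), ← ENNReal.ofReal_mul (by positivity),
      ← ENNReal.ofReal_mul (by unfold crossConst; positivity),
      ← ENNReal.ofReal_add (by positivity) (by unfold crossConst; positivity)]
    exact ENNReal.ofReal_le_ofReal (by simpa [crossConst] using h)
  refine h'.trans ?_
  rw [mul_add, add_assoc]
  gcongr
  exact le_add_left le_self_add

/-- The moments of the weights. -/
noncomputable def mom (ν : Measure ℝ≥0∞) (p : ℝ) : ℝ≥0∞ := ∫⁻ x, x ^ p ∂ν

/-- The factor by which the partition function of exponent `p` grows at each generation. -/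
noncomputable def rate (ν : Measure ℝ≥0∞) (p : ℝ) : ℝ≥0∞ := 2 * (2 ^ (-p) * mom ν p)

variable (ν : Measure ℝ≥0∞) [IsProbabilityMeasure ν]

theorem lintegral_root_mul {f : ℝ≥0∞ → ℝ≥0∞} (hf : Measurable f) {k : Tree × Tree → ℝ≥0∞}
    (hk : Measurable k) :
    ∫⁻ u, f (u []) * k (child false u, child true u) ∂treeLaw ν =
      (∫⁻ x, f x ∂ν) * ∫⁻ a, ∫⁻ b, k (a, b) ∂treeLaw ν ∂treeLaw ν := by
  rw [lintegral_treeLaw ν (f := fun u => f (u []) * k (child false u, child true u))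
    ((hf.comp (measurable_pi_apply _)).mul
      (hk.comp ((measurable_child _).prodMk (measurable_child _))))]
  simp only [graft_nil, child_false_graft, child_true_graft]
  rw [← lintegral_mul_const _ hf]
  refine lintegral_congr fun x => ?_
  rw [← lintegral_const_mul _ hk.lintegral_prod_right']
  refine lintegral_congr fun a => ?_
  exact lintegral_const_mul _ (hk.comp measurable_prodMk_left)

theorem lintegral_lintegral_add_rpow_le {q : ℝ} (hq : 1 < q) {G : Tree → ℝ≥0∞}
    (hG : Measurable G) :
    ∫⁻ a, ∫⁻ b, (G a + G b) ^ q ∂treeLaw ν ∂treeLaw ν ≤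
      2 * (∫⁻ u, G u ^ q ∂treeLaw ν + ENNReal.ofReal (crossConst q) *
        ((∫⁻ u, G u ^ (q - 1) ∂treeLaw ν) * ∫⁻ u, G u ∂treeLaw ν)) := by
  have h1 : ∀ r : ℝ, Measurable fun u => G u ^ r := fun r => hG.pow_const r
  have h2 : ∀ a, ∫⁻ b, (G a + G b) ^ q ∂treeLaw ν ≤ G a ^ q + ∫⁻ b, G b ^ q ∂treeLaw ν +
      ENNReal.ofReal (crossConst q) * (G a ^ (q - 1) * ∫⁻ b, G b ∂treeLaw ν +
        (∫⁻ b, G b ^ (q - 1) ∂treeLaw ν) * G a) := fun a => by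
    refine (lintegral_mono fun b => ennreal_add_rpow_le hq _ _).trans_eq ?_
    rw [lintegral_add_left (by fun_prop), lintegral_add_left (by fun_prop),
      lintegral_const_mul _ (by fun_prop), lintegral_add_left (by fun_prop),
      lintegral_const_mul _ (by fun_prop), lintegral_mul_const _ (by fun_prop)]
    simp
  refine (lintegral_mono h2).trans_eq ?_
  rw [lintegral_add_left (by fun_prop), lintegral_add_left (by fun_prop),
      lintegral_const_mul _ (by fun_prop), lintegral_add_left (by fun_prop),
      lintegral_const_mul _ (by fun_prop), lintegral_mul_const _ (by fun_prop)]
  simp only [lintegral_const, measure_univ, mul_one]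
  ring

theorem mul_rpow_of_ne {c : ℝ≥0∞} (h0 : c ≠ 0) (h1 : c ≠ ⊤) (y : ℝ≥0∞) (p : ℝ) :
    (c * y) ^ p = c ^ p * y ^ p := by
  rw [ENNReal.mul_rpow_eq_ite]
  simp [h0, h1]

/-- One recursion for two uses: `p = 1` gives the moments of `genMass`, general `p` those of the
partition functions. -/
theorem lintegral_rpow_branch_le {p q : ℝ} (hq : 1 < q)
    {Z G : Tree → ℝ≥0∞} (hG : Measurable G)
    (hZ : ∀ᵐ u ∂treeLaw ν, Z u = 2 ^ (-p) * u [] ^ p * (G (child false u) + G (child true u))) :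
    ∫⁻ u, Z u ^ q ∂treeLaw ν ≤ rate ν (p * q) * (∫⁻ u, G u ^ q ∂treeLaw ν +
      ENNReal.ofReal (crossConst q) *
        ((∫⁻ u, G u ^ (q - 1) ∂treeLaw ν) * ∫⁻ u, G u ∂treeLaw ν)) := by
  have h1 : ∫⁻ u, Z u ^ q ∂treeLaw ν = ∫⁻ u, (fun x => 2 ^ (-(p * q)) * x ^ (p * q)) (u []) *
      (fun z : Tree × Tree => (G z.1 + G z.2) ^ q) (child false u, child true u) ∂treeLaw ν := by
    refine lintegral_congr_ae ?_
    filter_upwards [hZ] with u hu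
    have hq0 : 0 ≤ q := by linarith
    simp only [hu, ENNReal.mul_rpow_of_nonneg _ _ hq0, ← ENNReal.rpow_mul, neg_mul]
  rw [h1, lintegral_root_mul ν (f := fun x => 2 ^ (-(p * q)) * x ^ (p * q)) (by fun_prop)
    (k := fun z => (G z.1 + G z.2) ^ q) (by fun_prop), lintegral_const_mul _ (by fun_prop)]
  refine (mul_le_mul_right (lintegral_lintegral_add_rpow_le ν hq hG) _).trans_eq ?_
  rw [rate, mom]
  ring

/-- The two terms handle `a ≥ ε⁻¹` and `a ≤ ε⁻¹`. It lets the moment of order `p-1` in the cross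
term be absorbed into a small multiple of the moment of order `p`. -/
theorem rpow_sub_one_le {p : ℝ} (hp : 1 < p) {ε : ℝ} (hε : 0 < ε) (a : ℝ≥0∞) :
    a ^ (p - 1) ≤ ENNReal.ofReal ε * a ^ p + ENNReal.ofReal (ε⁻¹ ^ (p - 1)) := by
  rcases le_total a (ENNReal.ofReal ε⁻¹) with h | h
  · refine le_add_left ?_
    rw [← ENNReal.ofReal_rpow_of_pos (by positivity)]
    exact ENNReal.rpow_le_rpow h (by linarith)
  · refine le_add_right ?_
    by_cases ha : a = ⊤
    · subst ha
      rw [ENNReal.top_rpow_of_pos (by linarith), ENNReal.top_rpow_of_pos (by linarith),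
        ENNReal.mul_top (by simpa using hε)]
    have ha0 : a ≠ 0 := by
      rintro rfl
      simp at h
      linarith
    have e : a ^ p = a * a ^ (p - 1) := by
      conv_rhs => rw [← ENNReal.rpow_one a, ← ENNReal.rpow_mul, ← ENNReal.rpow_add _ _ ha0 ha]
      ring_nf
    rw [e, ← mul_assoc]
    refine le_mul_of_one_le_left' ?_
    calc (1 : ℝ≥0∞) = ENNReal.ofReal ε * ENNReal.ofReal ε⁻¹ := by
          rw [← ENNReal.ofReal_mul hε.le, mul_inv_cancel₀ hε.ne', ENNReal.ofReal_one]
      _ ≤ _ := by gcongr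

theorem exists_lintegral_genMass_rpow_le (hmean : ∫⁻ x, x ∂ν = 1) {p : ℝ} (hp : 1 < p)
    (hmom : mom ν p ≠ ⊤) (hrate : rate ν p < 1) :
    ∃ B : ℝ, ∀ n, ∫⁻ u, genMass n u ^ p ∂treeLaw ν ≤ ENNReal.ofReal B := by
  set r := (rate ν p).toReal with hr
  have hr0 : 0 ≤ r := ENNReal.toReal_nonneg
  have hr1 : r < 1 := by
    rw [hr, ← ENNReal.toReal_one]
    exact (ENNReal.toReal_lt_toReal hrate.ne_top (by simp)).2 hrate
  set C := crossConst p
  have hC : 0 < C := by simp only [C, crossConst]; positivity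
  -- The recursion for the moments is `m ↦ r(m + C(εm + E))`. With `Cε = (1-r)/2` its slope `r(1 +
  -- (1-r)/2)` stays below 1.
  set ε := (1 - r) / (2 * C) with hε
  have hε0 : 0 < ε := div_pos (by linarith) (by positivity)
  have hCε : C * ε = (1 - r) / 2 := by rw [hε]; field_simp
  set E := ε⁻¹ ^ (p - 1)
  have hE : 0 ≤ E := by positivity
  -- The first term covers generation 0. The second gives `CE ≤ (1-r)B/2`, so the recursion sends
  -- `B` to at most `r(2-r)B = (1-(1-r)²)B ≤ B`.
  set B := (mom ν p).toReal + 2 * C * E / (1 - r) with hB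
  have hB0 : 0 ≤ B := by
    have : 0 < 1 - r := by linarith
    positivity
  have hstep : r * (B + C * (ε * B + E)) ≤ B := by
    have h1 : 2 * C * E ≤ (1 - r) * B := by
      have : (1 - r) * (2 * C * E / (1 - r)) = 2 * C * E := by
        field_simp [show 1 - r ≠ 0 by linarith]
      rw [hB, mul_add, this]
      have : 0 ≤ (1 - r) * (mom ν p).toReal := mul_nonneg (by linarith) ENNReal.toReal_nonneg
      linarith
    have h2 : C * (ε * B + E) = (1 - r) / 2 * B + C * E := by rw [mul_add, ← mul_assoc, hCε]
    rw [h2]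
    have h3 : B + ((1 - r) / 2 * B + C * E) ≤ (2 - r) * B := by linarith
    calc _ ≤ r * ((2 - r) * B) := mul_le_mul_of_nonneg_left h3 hr0
      _ ≤ B := by nlinarith [sq_nonneg (1 - r)]
  refine ⟨B, fun n => ?_⟩
  induction n with
  | zero =>
    have : ∫⁻ u, genMass 0 u ^ p ∂treeLaw ν = mom ν p :=
      (measurePreserving_root ν).lintegral_comp (f := fun x => x ^ p) (by fun_prop)
    rw [this, ← ENNReal.ofReal_toReal hmom]
    refine ENNReal.ofReal_le_ofReal ?_
    rw [hB, le_add_iff_nonneg_right]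
    have : 0 < 1 - r := by linarith
    positivity
  | succ n ih =>
    have h1 := lintegral_rpow_branch_le ν (p := 1) (q := p) hp
      (Z := genMass (n + 1)) (G := genMass n) (by fun_prop) (ae_of_all _ fun u => by
        rw [genMass, ENNReal.rpow_one, ENNReal.rpow_neg_one, div_eq_mul_inv]; ring)
    rw [lintegral_genMass ν hmean, mul_one, one_mul] at h1
    have h2 : ∫⁻ u, genMass n u ^ (p - 1) ∂treeLaw ν ≤
        ENNReal.ofReal ε * ENNReal.ofReal B + ENNReal.ofReal E := by
      refine (lintegral_mono fun u => rpow_sub_one_le hp hε0 _).trans ?_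
      rw [lintegral_add_right _ (by fun_prop), lintegral_const_mul _ (by fun_prop)]
      simp only [lintegral_const, measure_univ, mul_one]
      gcongr
    calc _ ≤ _ := h1
      _ ≤ ENNReal.ofReal r * (ENNReal.ofReal B + ENNReal.ofReal C *
          (ENNReal.ofReal ε * ENNReal.ofReal B + ENNReal.ofReal E)) := by
        rw [hr, ENNReal.ofReal_toReal hrate.ne_top]
        gcongr
      _ = ENNReal.ofReal (r * (B + C * (ε * B + E))) := by
        rw [ENNReal.ofReal_mul hr0, ENNReal.ofReal_add hB0 (by positivity),
          ENNReal.ofReal_mul hC.le, ENNReal.ofReal_add (by positivity) hE,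
          ENNReal.ofReal_mul hε0.le]
      _ ≤ _ := ENNReal.ofReal_le_ofReal hstep

theorem lintegral_totalMass_rpow_ne_top (hmean : ∫⁻ x, x ∂ν = 1) {p : ℝ} (hp : 1 < p)
    (hmom : mom ν p ≠ ⊤) (hrate : rate ν p < 1) :
    ∫⁻ u, totalMass u ^ p ∂treeLaw ν ≠ ⊤ := by
  obtain ⟨B, hB⟩ := exists_lintegral_genMass_rpow_le ν hmean hp hmom hrate
  refine ne_top_of_le_ne_top (b := ENNReal.ofReal B) ENNReal.ofReal_ne_top ?_
  calc ∫⁻ u, totalMass u ^ p ∂treeLaw ν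
      = ∫⁻ u, liminf (fun n => genMass n u ^ p) atTop ∂treeLaw ν := by
        refine lintegral_congr_ae ?_
        filter_upwards [ae_tendsto_genMass ν hmean] with u hu
        exact ((ENNReal.continuous_rpow_const.tendsto _).comp hu.1).liminf_eq.symm
    _ ≤ liminf (fun n => ∫⁻ u, genMass n u ^ p ∂treeLaw ν) atTop :=
        lintegral_liminf_le fun n => by fun_prop
    _ ≤ ENNReal.ofReal B := by
        refine (liminf_le_liminf (Eventually.of_forall hB)).trans_eq ?_
        simp

/-- Uniform integrability: `a ≤ K^(1-p) a^p + min a K`. The `L^p` bound makes the first integral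
less than 1 uniformly in `n` for some `K`; if the limit vanished, the second would tend to 0 by
dominated convergence, against the constant mean 1. -/
theorem not_ae_totalMass_eq_zero (hmean : ∫⁻ x, x ∂ν = 1) {p : ℝ} (hp : 1 < p)
    (hmom : mom ν p ≠ ⊤) (hrate : rate ν p < 1) :
    ¬ ∀ᵐ u ∂treeLaw ν, totalMass u = 0 := by
  intro h0
  obtain ⟨B, hB⟩ := exists_lintegral_genMass_rpow_le ν hmean hp hmom hrate
  have hlim : Tendsto (fun K : ℝ => K ^ (1 - p) * B) atTop (𝓝 0) := by
    have := (tendsto_rpow_neg_atTop (show 0 < p - 1 by linarith)).mul_const B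
    simpa using this
  obtain ⟨K, hK, hK0⟩ := ((hlim.eventually (gt_mem_nhds zero_lt_one)).and
    (eventually_gt_atTop 0)).exists
  have hle : ∀ n, 1 ≤ ENNReal.ofReal (K ^ (1 - p) * B) +
      ∫⁻ u, min (genMass n u) (ENNReal.ofReal K) ∂treeLaw ν := fun n => by
    have hpt : ∀ a : ℝ≥0∞, a ≤ ENNReal.ofReal (K ^ (1 - p)) * a ^ p +
        min a (ENNReal.ofReal K) := fun a => by
      rcases le_total a (ENNReal.ofReal K) with h | h
      · rw [min_eq_left h]; exact le_add_self
      · refine le_add_right ?_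
        by_cases ha : a = ⊤
        · subst ha
          rw [ENNReal.top_rpow_of_pos (by linarith), ENNReal.mul_top]
          simp; positivity
        have hKp : 0 < ENNReal.ofReal K := by simpa using hK0
        have ha0 : a ≠ 0 := (hKp.trans_le h).ne'
        calc a = a ^ (1 - p) * a ^ p := by
              rw [← ENNReal.rpow_add _ _ ha0 ha]; simp
          _ ≤ _ := by
            gcongr
            rw [← ENNReal.ofReal_rpow_of_pos hK0]
            exact ennreal_rpow_le_rpow_of_nonpos (by linarith) h
    calc (1 : ℝ≥0∞) = ∫⁻ u, genMass n u ∂treeLaw ν := (lintegral_genMass ν hmean n).symm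
      _ ≤ _ := lintegral_mono fun u => hpt _
      _ ≤ _ := by
        rw [lintegral_add_left (by fun_prop), lintegral_const_mul _ (by fun_prop),
          ENNReal.ofReal_mul (by positivity)]
        gcongr
        exact hB n
  have hconv : Tendsto (fun n => ∫⁻ u, min (genMass n u) (ENNReal.ofReal K) ∂treeLaw ν) atTop
      (𝓝 (∫⁻ _, 0 ∂treeLaw ν)) := by
    refine tendsto_lintegral_of_dominated_convergence (fun _ => ENNReal.ofReal K)
      (fun n => by fun_prop) (fun n => ae_of_all _ fun u => min_le_right _ _) (by simp) ?_
    filter_upwards [ae_tendsto_genMass ν hmean, h0] with u hu hz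
    have := (hu.1.min (tendsto_const_nhds (x := ENNReal.ofReal K)))
    simpa [hz] using this
  have := ge_of_tendsto' (tendsto_const_nhds.add hconv) hle
  simp only [lintegral_zero, add_zero, ENNReal.one_le_ofReal] at this
  linarith

/-- The root weight is nonzero, so the mass vanishes exactly when both independent subtree masses
do. The probability `z` of this solves `z = z²`, and `z ≠ 1`. -/
theorem ae_totalMass_ne_zero (hmean : ∫⁻ x, x ∂ν = 1) (hpos : ∀ᵐ x ∂ν, x ≠ 0 ∧ x ≠ ⊤) {p : ℝ}
    (hp : 1 < p) (hmom : mom ν p ≠ ⊤) (hrate : rate ν p < 1) :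
    ∀ᵐ u ∂treeLaw ν, totalMass u ≠ 0 := by
  have hms : MeasurableSet {u : Tree | totalMass u = 0} :=
    measurable_totalMass (measurableSet_singleton 0)
  set z := treeLaw ν {u | totalMass u = 0} with hz
  have hI : ∫⁻ u, {u : Tree | totalMass u = 0}.indicator 1 u ∂treeLaw ν = z :=
    lintegral_indicator_one hms
  have hind : Measurable ({u : Tree | totalMass u = 0}.indicator (1 : Tree → ℝ≥0∞)) :=
    measurable_one.indicator hms
  have hzz : z = z * z := by
    conv_lhs => rw [← hI]
    have := lintegral_root_mul ν (f := fun _ => 1) measurable_const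
      (k := fun w => {u : Tree | totalMass u = 0}.indicator 1 w.1 *
        {u : Tree | totalMass u = 0}.indicator 1 w.2)
      ((hind.comp measurable_fst).mul (hind.comp measurable_snd))
    simp only [one_mul, lintegral_const, measure_univ] at this
    calc _ = _ := lintegral_congr_ae ?_
      _ = _ := this
      _ = z * z := ?_
    · filter_upwards [ae_totalMass_eq ν hmean hpos,
        (measurePreserving_root ν).quasiMeasurePreserving.ae hpos] with u hu hx
      have : totalMass u = 0 ↔ totalMass (child false u) = 0 ∧ totalMass (child true u) = 0 := by
        rw [hu]; simp [hx.1]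
      by_cases h1 : totalMass (child false u) = 0 <;> by_cases h2 : totalMass (child true u) = 0 <;>
        simp [Set.indicator, this, h1, h2]
    · simp_rw [lintegral_const_mul _ hind, hI]
      rw [lintegral_mul_const _ hind, hI]
  have hz1 : z ≠ 1 := fun h => by
    apply not_ae_totalMass_eq_zero ν hmean hp hmom hrate
    exact (prob_compl_eq_zero_iff hms).2 h
  have : z = 0 := by
    by_contra hne
    have h2 : z * 1 = z * z := by rw [mul_one]; exact hzz
    exact hz1 ((ENNReal.mul_right_inj hne (measure_ne_top _ _)).1 h2).symm
  rw [ae_iff]; simpa using this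

/-- With `A = Z^(-s)`, the branching equation gives `A ≤ 2^s W^(-s) min(A₀, A₁)`, and `min(A₀, A₁) ≤
t + A₀ 1_{A₁ > t}`. By independence `E[A] ≤ D(t + E[A] P(A > t))`, and the last term is absorbed
once `t` is large. -/
theorem lintegral_totalMass_rpow_neg_ne_top (hmean : ∫⁻ x, x ∂ν = 1)
    (hpos : ∀ᵐ x ∂ν, x ≠ 0 ∧ x ≠ ⊤) {s : ℝ} (hs : 0 < s) (hmom : mom ν (-s) ≠ ⊤)
    (hne : ∀ᵐ u ∂treeLaw ν, totalMass u ≠ 0) :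
    ∫⁻ u, totalMass u ^ (-s) ∂treeLaw ν ≠ ⊤ := by
  set A : Tree → ℝ≥0∞ := fun u => totalMass u ^ (-s) with hA
  have hAm : Measurable A := by fun_prop
  -- The added 1 pays for truncation at `M`: `min (c x) M ≤ (1 + c) min x M`.
  set D : ℝ≥0∞ := 1 + 2 ^ s * mom ν (-s) with hD
  have hDtop : D ≠ ⊤ := by
    rw [hD]; finiteness
  have htail : Tendsto (fun n : ℕ => treeLaw ν {u | (n : ℝ≥0∞) < A u}) atTop (𝓝 0) := by
    have hzero : treeLaw ν (⋂ n : ℕ, {u | (n : ℝ≥0∞) < A u}) = 0 := by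
      refine measure_mono_null (fun u hu => ?_) (ae_iff.1 hne)
      simp only [Set.mem_iInter, Set.mem_ofPred_eq, not_not] at hu ⊢
      have hAtop : A u = ⊤ := by
        by_contra h
        obtain ⟨n, hn⟩ := ENNReal.exists_nat_gt h
        exact (hu n).not_gt hn
      have hAu : totalMass u ^ (-s) = ⊤ := hAtop
      rw [ENNReal.rpow_eq_top_iff] at hAu
      rcases hAu with h | h
      · exact h.1
      · linarith [h.2]
    rw [← hzero]
    refine tendsto_measure_iInter_atTop
      (fun n => (measurableSet_lt measurable_const hAm).nullMeasurableSet) (fun m n h u hu => ?_)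
      ⟨0, measure_ne_top _ _⟩
    exact lt_of_le_of_lt (Nat.cast_le.2 h) (show (n : ℝ≥0∞) < A u from hu)
  have htail' : Tendsto (fun n : ℕ => D * treeLaw ν {u | (n : ℝ≥0∞) < A u}) atTop (𝓝 0) := by
    simpa using ENNReal.Tendsto.const_mul htail (Or.inr hDtop)
  obtain ⟨t, ht⟩ := (htail'.eventually (ge_mem_nhds (show (0 : ℝ≥0∞) < 2⁻¹ by simp))).exists
  have hbranch : ∀ᵐ u ∂treeLaw ν, A u ≤ (2 ^ s * u [] ^ (-s)) *
      min (A (child false u)) (A (child true u)) := by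
    filter_upwards [ae_totalMass_eq ν hmean hpos,
      (measurePreserving_root ν).quasiMeasurePreserving.ae hpos] with u hu hx
    have h2 : ∀ y : ℝ≥0∞, (y / 2) ^ (-s) = 2 ^ s * y ^ (-s) := fun y => by
      rw [div_eq_mul_inv, mul_comm, mul_rpow_of_ne (by simp) (by simp), ENNReal.inv_rpow,
        ENNReal.rpow_neg, inv_inv]
    simp only [hA]
    rw [hu, mul_rpow_of_ne hx.1 hx.2, h2, ← mul_assoc, mul_comm (u [] ^ (-s))]
    gcongr
    exact le_min (ennreal_rpow_le_rpow_of_nonpos (by linarith) le_self_add)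
      (ennreal_rpow_le_rpow_of_nonpos (by linarith) le_add_self)
  -- Truncation makes the expectation finite, so that half of it may be subtracted; the resulting
  -- bound does not depend on `M`.
  have hbound : ∀ M : ℕ, ∫⁻ u, min (A u) M ∂treeLaw ν ≤ 2 * (D * t) := by
    intro M
    set y := ∫⁻ u, min (A u) M ∂treeLaw ν with hy
    have hytop : y ≠ ⊤ := by
      refine ne_top_of_le_ne_top (b := (M : ℝ≥0∞)) (by simp) ?_
      refine (lintegral_mono fun u => min_le_right _ _).trans_eq (by simp)
    set S : Set Tree := {u | (t : ℝ≥0∞) < A u}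
    have hS : MeasurableSet S := measurableSet_lt measurable_const hAm
    have hSm : Measurable (S.indicator (1 : Tree → ℝ≥0∞)) := measurable_one.indicator hS
    have h1 : y ≤ D * (t + y * treeLaw ν S) := by
      have := lintegral_root_mul ν (f := fun x => 1 + 2 ^ s * x ^ (-s)) (by fun_prop)
        (k := fun w => (t : ℝ≥0∞) + min (A w.1) M * S.indicator 1 w.2)
        (by exact measurable_const.add (((hAm.comp measurable_fst).min measurable_const).mul
          (hSm.comp measurable_snd)))
      refine (lintegral_mono_ae ?_).trans (this.trans_le ?_)
      · filter_upwards [hbranch] with u hu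
        have hpt : ∀ c a b : ℝ≥0∞, min (c * min a b) M ≤
            (1 + c) * min (min a b) M := fun c a b => by
          rcases le_total (min a b) (M : ℝ≥0∞) with h | h
          · rw [min_eq_left h, add_mul]
            exact (min_le_left _ _).trans le_add_self
          · rw [min_eq_right h, add_mul, one_mul]
            exact (min_le_right _ _).trans le_self_add
        refine (min_le_min_right _ hu).trans ((hpt _ _ _).trans ?_)
        gcongr
        by_cases hb : child true u ∈ S
        · simp only [hb, Set.indicator_of_mem, Pi.one_apply, mul_one]
          exact (min_le_min_right _ (min_le_left _ _)).trans le_add_self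
        · refine le_add_right ((min_le_left _ _).trans ((min_le_right _ _).trans ?_))
          simpa [S] using hb
      · rw [lintegral_add_left (by fun_prop), lintegral_const_mul _ (by fun_prop)]
        simp_rw [lintegral_add_left measurable_const, lintegral_const_mul _ hSm,
          lintegral_indicator_one hS]
        rw [lintegral_mul_const _ (by fun_prop)]
        simp only [lintegral_const, measure_univ, mul_one]
        exact le_rfl
    have h2 : y ≤ D * t + y / 2 := by
      refine h1.trans ?_
      rw [mul_add, mul_left_comm, div_eq_mul_inv]
      gcongr
    have h3 : y / 2 ≤ D * t := by
      have h4 : y / 2 + y / 2 ≤ D * t + y / 2 := by rwa [ENNReal.add_halves]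
      exact (ENNReal.add_le_add_iff_right (ENNReal.div_ne_top hytop (by simp))).1 h4
    calc y = 2 * (y / 2) := (ENNReal.mul_div_cancel (by simp) (by simp)).symm
      _ ≤ _ := by gcongr
  have hsup : ∫⁻ u, A u ∂treeLaw ν = ⨆ M : ℕ, ∫⁻ u, min (A u) M ∂treeLaw ν := by
    rw [← lintegral_iSup (f := fun (M : ℕ) u => min (A u) (M : ℝ≥0∞))
      (fun M => hAm.min measurable_const) fun m n h u => min_le_min_left _ (Nat.cast_le.2 h)]
    refine lintegral_congr fun u => le_antisymm ?_ (iSup_le fun M => min_le_left _ _)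
    refine le_of_forall_lt fun c hc => ?_
    obtain ⟨n, hn⟩ := ENNReal.exists_nat_gt (ne_top_of_lt hc)
    exact lt_iSup_iff.2 ⟨n, lt_min hc hn⟩
  change ∫⁻ u, A u ∂treeLaw ν ≠ ⊤
  rw [hsup]
  exact ne_top_of_le_ne_top (b := 2 * (D * t)) (by finiteness) (iSup_le hbound)

end
end MixedCascade

/-! ### Partition functions: moments, and sums over independent trees. -/

namespace MixedCascade
section
open scoped ENNReal NNReal

/-- The normalized mass of the `k`-th cell of generation `j` when `F` gives the masses of the
subtrees. -/
noncomputable def leaf (F : Tree → ℝ≥0∞) : ℕ → Tree → ℕ → ℝ≥0∞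
  | 0, u, _ => F u
  | j + 1, u, k => u [] / 2 *
      if k < 2 ^ j then leaf F j (child false u) k else leaf F j (child true u) (k - 2 ^ j)

/-- The partition function of exponent `p` at generation `j`. -/
noncomputable def partition (p : ℝ) (j : ℕ) (u : Tree) : ℝ≥0∞ :=
  ∑ k ∈ Finset.range (2 ^ j), leaf totalMass j u k ^ p

theorem sum_range_two_pow_succ {M : Type*} [AddCommMonoid M] (j : ℕ) (f : ℕ → M) :
    ∑ k ∈ Finset.range (2 ^ (j + 1)), f k =
      ∑ k ∈ Finset.range (2 ^ j), f k + ∑ k ∈ Finset.range (2 ^ j), f (2 ^ j + k) := by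
  rw [pow_succ, mul_two, Finset.sum_range_add]

@[fun_prop]
theorem measurable_leaf {F : Tree → ℝ≥0∞} (hF : Measurable F) (j k : ℕ) :
    Measurable fun u => leaf F j u k := by
  induction j generalizing k with
  | zero => exact hF
  | succ j ih =>
    simp only [leaf]
    refine ((measurable_pi_apply []).div_const 2).mul ?_
    split_ifs
    · exact (ih k).comp (measurable_child false)
    · exact (ih _).comp (measurable_child true)

@[fun_prop]
theorem measurable_partition (p : ℝ) (j : ℕ) : Measurable (partition p j) := by
  unfold partition
  exact Finset.measurable_fun_sum _ fun k _ => (measurable_leaf measurable_totalMass j k).pow_const p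

/-- For `p < 0` the power of a product need not split when a factor is `0` or `⊤`, whence the
conditions on the root. -/
theorem partition_succ (p : ℝ) (j : ℕ) {u : Tree} (h0 : u [] ≠ 0) (h1 : u [] ≠ ⊤) :
    partition p (j + 1) u = 2 ^ (-p) * u [] ^ p *
      (partition p j (child false u) + partition p j (child true u)) := by
  have h2 : ∀ y, (u [] / 2 * y) ^ p = 2 ^ (-p) * u [] ^ p * y ^ p := fun y => by
    rw [mul_rpow_of_ne (ENNReal.div_ne_zero.2 ⟨h0, by simp⟩) (ENNReal.div_ne_top h1 (by simp)),
      div_eq_mul_inv, mul_comm (u []), mul_rpow_of_ne (by simp) (by simp), ENNReal.inv_rpow,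
      ENNReal.rpow_neg]
  unfold partition
  rw [sum_range_two_pow_succ, mul_add, Finset.mul_sum, Finset.mul_sum]
  congr 1 <;> refine Finset.sum_congr rfl fun k hk => ?_
  · rw [leaf, if_pos (Finset.mem_range.1 hk), h2]
  · rw [leaf, if_neg (by simp), h2, Nat.add_sub_cancel_left]

variable (ν : Measure ℝ≥0∞) [IsProbabilityMeasure ν]

theorem ae_partition_succ (hpos : ∀ᵐ x ∂ν, x ≠ 0 ∧ x ≠ ⊤) (p : ℝ) (j : ℕ) :
    ∀ᵐ u ∂treeLaw ν, partition p (j + 1) u = 2 ^ (-p) * u [] ^ p *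
      (partition p j (child false u) + partition p j (child true u)) := by
  filter_upwards [(measurePreserving_root ν).quasiMeasurePreserving.ae hpos] with u hx
  exact partition_succ p j hx.1 hx.2

theorem lintegral_partition (hpos : ∀ᵐ x ∂ν, x ≠ 0 ∧ x ≠ ⊤) (p : ℝ) (j : ℕ) :
    ∫⁻ u, partition p j u ∂treeLaw ν = rate ν p ^ j * ∫⁻ u, totalMass u ^ p ∂treeLaw ν := by
  induction j with
  | zero => simp [partition, leaf]
  | succ j ih =>
    have := lintegral_root_mul ν (f := fun x => 2 ^ (-p) * x ^ p) (by fun_prop)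
      (k := fun z => partition p j z.1 + partition p j z.2) (by fun_prop)
    rw [lintegral_congr_ae (ae_partition_succ ν hpos p j), this]
    simp_rw [lintegral_add_left measurable_const]
    rw [lintegral_add_right _ (by fun_prop), lintegral_const_mul _ (by fun_prop), ih]
    simp only [lintegral_const, measure_univ, mul_one, ih, rate, mom]
    ring

theorem lintegral_rpow_le_of_le_one {q : ℝ} (hq0 : 0 < q) (hq1 : q ≤ 1) {G : Tree → ℝ≥0∞}
    (hG : Measurable G) :
    ∫⁻ u, G u ^ q ∂treeLaw ν ≤ (∫⁻ u, G u ∂treeLaw ν) ^ q := by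
  have := eLpNorm'_le_eLpNorm'_of_exponent_le hq0 hq1 (treeLaw ν) hG.aestronglyMeasurable
  simp only [eLpNorm', enorm_eq_self, ENNReal.rpow_one, div_one, one_div] at this
  rwa [ENNReal.rpow_inv_le_iff hq0] at this

/-- As `q - 1 ≤ 1`, Jensen bounds the cross term by the `q`-th power of the mean, of order `r^(qj)`.
The moments thus satisfy `m_{j+1} ≤ r'(m_j + c r^(qj))`, and any `R` above both rates dominates the
solution. -/
theorem exists_lintegral_partition_rpow_le (hpos : ∀ᵐ x ∂ν, x ≠ 0 ∧ x ≠ ⊤) {p q r r' R : ℝ}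
    (hq1 : 1 < q) (hq2 : q ≤ 2) (hr : rate ν p = ENNReal.ofReal r) (hr0 : 0 < r)
    (hr' : rate ν (p * q) = ENNReal.ofReal r') (hr0' : 0 < r')
    (hR : r ^ q < R) (hR' : r' < R)
    (hp : ∫⁻ u, totalMass u ^ p ∂treeLaw ν ≠ ⊤)
    (hpq : ∫⁻ u, totalMass u ^ (p * q) ∂treeLaw ν ≠ ⊤) :
    ∃ C : ℝ, 0 < C ∧ ∀ j, ∫⁻ u, partition p j u ^ q ∂treeLaw ν ≤ ENNReal.ofReal (C * R ^ j) := by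
  set e := (∫⁻ u, totalMass u ^ p ∂treeLaw ν).toReal with he
  have he0 : 0 ≤ e := ENNReal.toReal_nonneg
  have hR0 : 0 < R := hr0'.trans hR'
  set K := r' * (crossConst q * e ^ q) with hK
  have hcc : 0 ≤ crossConst q := by unfold crossConst; positivity
  have hK0 : 0 ≤ K := by positivity
  -- The induction step requires `r'C + K ≤ CR`, that is `C ≥ K/(R - r')`; the first term covers
  -- generation 0.
  set C := (∫⁻ u, totalMass u ^ (p * q) ∂treeLaw ν).toReal + K / (R - r') + 1 with hC
  have hRr : 0 < R - r' := by linarith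
  have hCpos : 0 < C := by
    have := ENNReal.toReal_nonneg (a := ∫⁻ u, totalMass u ^ (p * q) ∂treeLaw ν)
    positivity
  have hKC : K ≤ C * (R - r') := by
    rw [← div_le_iff₀ hRr, hC]
    have := ENNReal.toReal_nonneg (a := ∫⁻ u, totalMass u ^ (p * q) ∂treeLaw ν)
    linarith
  refine ⟨C, hCpos, fun j => ?_⟩
  induction j with
  | zero =>
    have h0 : ∫⁻ u, partition p 0 u ^ q ∂treeLaw ν = ∫⁻ u, totalMass u ^ (p * q) ∂treeLaw ν := by
      simp [partition, leaf, ENNReal.rpow_mul]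
    rw [h0, ← ENNReal.ofReal_toReal hpq]
    refine ENNReal.ofReal_le_ofReal ?_
    rw [hC, pow_zero, mul_one]
    have : 0 ≤ K / (R - r') := by positivity
    linarith
  | succ j ih =>
    have h1 := lintegral_rpow_branch_le ν hq1 (measurable_partition p j)
      (ae_partition_succ ν hpos p j)
    have hE : ∫⁻ u, partition p j u ∂treeLaw ν = ENNReal.ofReal (r ^ j * e) := by
      rw [lintegral_partition ν hpos, hr, ENNReal.ofReal_mul (by positivity),
        ENNReal.ofReal_pow hr0.le, he, ENNReal.ofReal_toReal hp]
    have h2 : (∫⁻ u, partition p j u ^ (q - 1) ∂treeLaw ν) * ∫⁻ u, partition p j u ∂treeLaw ν ≤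
        ENNReal.ofReal (R ^ j * e ^ q) := by
      have h3 := lintegral_rpow_le_of_le_one ν (show 0 < q - 1 by linarith) (by linarith)
        (measurable_partition p j)
      rw [hE] at h3 ⊢
      rw [ENNReal.ofReal_rpow_of_nonneg (by positivity) (by linarith)] at h3
      refine (mul_le_mul_left h3 _).trans ?_
      rw [← ENNReal.ofReal_mul (by positivity)]
      refine ENNReal.ofReal_le_ofReal ?_
      have h4 : (r ^ j * e) ^ (q - 1) * (r ^ j * e) = (r ^ j * e) ^ q := by
        have := Real.rpow_add_one' (x := r ^ j * e) (y := q - 1) (by positivity) (by linarith)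
        rw [sub_add_cancel] at this
        exact this.symm
      rw [h4, Real.mul_rpow (by positivity) he0]
      gcongr
      rw [← Real.rpow_natCast, ← Real.rpow_mul hr0.le, mul_comm, Real.rpow_mul hr0.le,
        Real.rpow_natCast]
      gcongr
    calc _ ≤ _ := h1
      _ ≤ ENNReal.ofReal r' * (ENNReal.ofReal (C * R ^ j) +
          ENNReal.ofReal (crossConst q) * ENNReal.ofReal (R ^ j * e ^ q)) := by
        rw [hr']; gcongr
      _ = ENNReal.ofReal (r' * (C * R ^ j + crossConst q * (R ^ j * e ^ q))) := by
        rw [ENNReal.ofReal_mul hr0'.le, ENNReal.ofReal_add (by positivity) (by positivity),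
          ENNReal.ofReal_mul hcc]
      _ ≤ _ := by
        refine ENNReal.ofReal_le_ofReal ?_
        have : r' * (C * R ^ j + crossConst q * (R ^ j * e ^ q)) = (r' * C + K) * R ^ j := by
          rw [hK]; ring
        rw [this, pow_succ]
        have : r' * C + K ≤ C * R := by linarith
        calc _ ≤ C * R * R ^ j := by gcongr
          _ = _ := by ring

/-- For `x ≤ 1` the quadratic Taylor error is at most `x^q`; for `x ≥ 1` the right side is at least
1. This controls Laplace transforms by a moment of order `q` below 2. -/
theorem exp_neg_le {x q : ℝ} (hx : 0 ≤ x) (hq1 : 1 < q) (hq2 : q ≤ 2) :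
    Real.exp (-x) ≤ 1 - x + x ^ q := by
  rcases le_total x 1 with h | h
  · have h1 := Real.abs_exp_sub_one_sub_id_le (x := -x) (by rwa [abs_neg, abs_of_nonneg hx])
    have h2 : x ^ (2 : ℕ) ≤ x ^ q := by
      rw [← Real.rpow_natCast]
      rcases hx.eq_or_lt with rfl | h0
      · simp [Real.zero_rpow (show q ≠ 0 by linarith)]
      · exact Real.rpow_le_rpow_of_exponent_ge h0 h (by exact_mod_cast hq2)
    have h3 := (abs_le.1 h1).2
    rw [neg_sq] at h3
    linarith
  · have h1 : x ≤ x ^ q := by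
      conv_lhs => rw [← Real.rpow_one x]
      exact Real.rpow_le_rpow_of_exponent_le h hq1.le
    have h2 : Real.exp (-x) ≤ 1 := Real.exp_le_one_iff.2 (by linarith)
    linarith

section Probability

variable {Ω ι : Type*} [MeasurableSpace Ω] (P : Measure Ω)

/-- Chernoff's bound for the lower tail. By the choice of `l`, `E[exp(-lX)] ≤ 1 - lm + lm/4 ≤
exp(-3lm/4)`; the threshold of half the mean costs `exp(lm/2)` per term and leaves `exp(-lm/4)`. -/
theorem measure_sum_le_half_mean [IsProbabilityMeasure P] {X : ι → Ω → ℝ≥0∞} (hX : ∀ i, Measurable (X i))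
    (hind : iIndepFun X P) {m v q l : ℝ} (hm0 : 0 < m) (hv0 : 0 ≤ v)
    (hm : ∀ i, ∫⁻ ω, X i ω ∂P = ENNReal.ofReal m)
    (hq1 : 1 < q) (hq2 : q ≤ 2)
    (hv : ∀ i, ∫⁻ ω, X i ω ^ q ∂P ≤ ENNReal.ofReal v) (hl : 0 < l)
    (hlv : l ^ q * v ≤ l * m / 4) (s : Finset ι) :
    P {ω | ∑ i ∈ s, X i ω ≤ ENNReal.ofReal (s.card * m / 2)} ≤
      ENNReal.ofReal (Real.exp (-(s.card * (l * m / 4)))) := by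
  have hint : ∀ i, Integrable (fun ω => (X i ω).toReal) P := fun i =>
    integrable_toReal_of_lintegral_ne_top (hX i).aemeasurable (by simp [hm])
  have hintq : ∀ i, Integrable (fun ω => (X i ω).toReal ^ q) P := fun i => by
    simp_rw [ENNReal.toReal_rpow]
    exact integrable_toReal_of_lintegral_ne_top ((hX i).pow_const q).aemeasurable
      (ne_top_of_le_ne_top ENNReal.ofReal_ne_top (hv i))
  have hfin : ∀ i, ∀ᵐ ω ∂P, X i ω < ⊤ := fun i => ae_lt_top (hX i) (by simp [hm])
  have hmgf : ∀ i, mgf (fun ω => (X i ω).toReal) P (-l) ≤ Real.exp (-(3 * (l * m / 4))) := by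
    intro i
    have h1 : ∫ ω, (X i ω).toReal ∂P = m := by
      rw [integral_toReal (hX i).aemeasurable (hfin i), hm, ENNReal.toReal_ofReal hm0.le]
    have h2 : ∫ ω, (X i ω).toReal ^ q ∂P ≤ v := by
      simp_rw [ENNReal.toReal_rpow]
      rw [integral_toReal ((hX i).pow_const q).aemeasurable]
      · exact ENNReal.toReal_le_of_le_ofReal hv0 (hv i)
      · filter_upwards [hfin i] with ω h
        exact ENNReal.rpow_lt_top_of_nonneg (by linarith) h.ne
    calc mgf (fun ω => (X i ω).toReal) P (-l)
        = ∫ ω, Real.exp (-(l * (X i ω).toReal)) ∂P := by simp [mgf]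
      _ ≤ ∫ ω, (1 - l * (X i ω).toReal + l ^ q * (X i ω).toReal ^ q) ∂P := by
          refine integral_mono_of_nonneg (ae_of_all _ fun ω => (Real.exp_pos _).le)
            (((integrable_const 1).sub ((hint i).const_mul l)).add ((hintq i).const_mul _))
            (ae_of_all _ fun ω => ?_)
          have := exp_neg_le (x := l * (X i ω).toReal) (by positivity) hq1 hq2
          rwa [Real.mul_rpow hl.le ENNReal.toReal_nonneg] at this
      _ = 1 - l * m + l ^ q * ∫ ω, (X i ω).toReal ^ q ∂P := by
          have hs : Integrable (fun ω => 1 - l * (X i ω).toReal) P :=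
            (integrable_const 1).sub ((hint i).const_mul l)
          rw [integral_add hs ((hintq i).const_mul _),
            integral_sub (integrable_const 1) ((hint i).const_mul l),
            integral_const_mul, integral_const_mul, h1]
          simp
      _ ≤ -(3 * (l * m / 4)) + 1 := by
          have : l ^ q * ∫ ω, (X i ω).toReal ^ q ∂P ≤ l ^ q * v := by gcongr
          linarith
      _ ≤ _ := Real.add_one_le_exp _
  set Y : ι → Ω → ℝ := fun i ω => (X i ω).toReal
  have hYind : iIndepFun Y P := hind.comp (fun _ => ENNReal.toReal) fun _ => ENNReal.measurable_toReal
  have hYm : ∀ i, Measurable (Y i) := fun i => (hX i).ennreal_toReal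
  have hsum : mgf (∑ i ∈ s, Y i) P (-l) ≤ Real.exp (-(s.card * (3 * (l * m / 4)))) := by
    rw [hYind.mgf_sum hYm]
    calc _ ≤ ∏ i ∈ s, Real.exp (-(3 * (l * m / 4))) :=
          Finset.prod_le_prod (fun i _ => mgf_nonneg) fun i _ => hmgf i
      _ = _ := by rw [Finset.prod_const, ← Real.exp_nat_mul]; ring_nf
  have hch := measure_le_le_exp_mul_mgf (μ := P) (X := ∑ i ∈ s, Y i) (t := -l) (s.card * m / 2)
    (by linarith) (by
      refine Integrable.of_bound (C := 1) ?_ (ae_of_all _ fun ω => ?_)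
      · have hm : Measurable (∑ i ∈ s, Y i) := by
          rw [Finset.sum_fn]
          exact Finset.measurable_fun_sum s fun i _ => hYm i
        exact ((hm.const_mul (-l)).exp).aestronglyMeasurable
      · rw [Real.norm_of_nonneg (Real.exp_pos _).le, Real.exp_le_one_iff, Finset.sum_apply]
        have : 0 ≤ ∑ i ∈ s, Y i ω := Finset.sum_nonneg fun i _ => ENNReal.toReal_nonneg
        nlinarith)
  have hsub : P {ω | ∑ i ∈ s, X i ω ≤ ENNReal.ofReal (s.card * m / 2)} ≤
      P {ω | (∑ i ∈ s, Y i) ω ≤ s.card * m / 2} := by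
    refine measure_mono fun ω hω => ?_
    have hω' : ∑ i ∈ s, X i ω ≤ ENNReal.ofReal (s.card * m / 2) := hω
    have htop : ∑ i ∈ s, X i ω ≠ ⊤ := ne_top_of_le_ne_top ENNReal.ofReal_ne_top hω'
    change (∑ i ∈ s, Y i) ω ≤ s.card * m / 2
    rw [Finset.sum_apply, ← ENNReal.toReal_sum fun i hi => (ENNReal.sum_ne_top.1 htop) i hi]
    exact ENNReal.toReal_le_of_le_ofReal (by positivity) hω'
  refine hsub.trans ?_
  rw [← ENNReal.ofReal_toReal (measure_ne_top P {ω | (∑ i ∈ s, Y i) ω ≤ s.card * m / 2})]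
  refine ENNReal.ofReal_le_ofReal (hch.trans ?_)
  calc _ ≤ Real.exp (- -l * (s.card * m / 2)) * Real.exp (-(s.card * (3 * (l * m / 4)))) := by gcongr
    _ = _ := by rw [← Real.exp_add]; ring_nf

theorem ae_tendsto_zero_of_lintegral_le {Z : ℕ → Ω → ℝ≥0∞} (hZ : ∀ j, Measurable (Z j))
    {C r : ℝ≥0∞} (hC : C ≠ ⊤) (hr : r < 1) (h : ∀ j, ∫⁻ ω, Z j ω ∂P ≤ C * r ^ j) :
    ∀ᵐ ω ∂P, Tendsto (fun j => Z j ω) atTop (𝓝 0) := by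
  have h1 : ∫⁻ ω, ∑' j, Z j ω ∂P ≠ ⊤ := by
    rw [lintegral_tsum fun j => (hZ j).aemeasurable]
    refine ne_top_of_le_ne_top (b := ∑' j, C * r ^ j) ?_ (ENNReal.tsum_le_tsum h)
    rw [ENNReal.tsum_mul_left, ENNReal.tsum_geometric]
    exact ENNReal.mul_ne_top hC (ENNReal.inv_ne_top.2 (tsub_pos_of_lt hr).ne')
  filter_upwards [ae_lt_top (Measurable.tsum hZ) h1] with ω hω
  exact ENNReal.tendsto_atTop_zero_of_tsum_ne_top hω.ne

theorem tsum_ofReal_exp_neg_ne_top {c B : ℝ} (hc : 0 < c) (hB : 1 < B) :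
    ∑' j : ℕ, ENNReal.ofReal (Real.exp (-(c * B ^ j))) ≠ ⊤ := by
  have hlog : ∀ j : ℕ, 1 + j * (B - 1) ≤ B ^ j := fun j => by
    have := one_add_mul_le_pow (show (-2 : ℝ) ≤ B - 1 by linarith) j
    simpa using this
  have hr : Real.exp (-(c * (B - 1))) < 1 := by
    rw [Real.exp_lt_one_iff]
    nlinarith [mul_pos hc (sub_pos.2 hB)]
  refine ne_top_of_le_ne_top (b := ∑' j : ℕ, ENNReal.ofReal (Real.exp (-(c * (B - 1)))) ^ j) ?_
    (ENNReal.tsum_le_tsum fun j => ?_)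
  · rw [ENNReal.tsum_geometric]
    exact ENNReal.inv_ne_top.2 (tsub_pos_of_lt (ENNReal.ofReal_lt_one.2 hr)).ne'
  · rw [← ENNReal.ofReal_pow (Real.exp_pos _).le, ← Real.exp_nat_mul]
    refine ENNReal.ofReal_le_ofReal (Real.exp_le_exp.2 ?_)
    nlinarith [hlog j]

variable {ν} {U : ι → Ω → Tree} {I : ℕ → Finset ι} {B : ℝ}

theorem lintegral_comp_tree (hU : ∀ i, Measurable (U i)) (hlaw : ∀ i, P.map (U i) = treeLaw ν)
    {f : Tree → ℝ≥0∞} (hf : Measurable f) (i : ι) :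
    ∫⁻ ω, f (U i ω) ∂P = ∫⁻ u, f u ∂treeLaw ν := by
  rw [← hlaw i, lintegral_map hf (hU i)]

/-- After division by `Q^j` the means decay geometrically with ratio `Br/Q < 1`, so the quotients
tend to 0. Independence plays no role here. -/
theorem ae_eventually_sum_partition_le (hpos : ∀ᵐ x ∂ν, x ≠ 0 ∧ x ≠ ⊤)
    (hU : ∀ i, Measurable (U i)) (hlaw : ∀ i, P.map (U i) = treeLaw ν) {K : ℝ} (hB : 0 < B)
    (hI : ∀ j, ((I j).card : ℝ) ≤ K * B ^ j) {p r Q : ℝ} (hr0 : 0 < r)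
    (hr : rate ν p = ENNReal.ofReal r)
    (hp : ∫⁻ u, totalMass u ^ p ∂treeLaw ν ≠ ⊤) (hQ : B * r < Q) :
    ∀ᵐ ω ∂P, ∀ᶠ j in atTop, ∑ i ∈ I j, partition p j (U i ω) ≤ ENNReal.ofReal (Q ^ j) := by
  have hQ0 : 0 < Q := (mul_pos hB hr0).trans hQ
  have hK : 0 ≤ K := by
    have := hI 0
    rw [pow_zero, mul_one] at this
    exact (Nat.cast_nonneg _).trans this
  have h := ae_tendsto_zero_of_lintegral_le P
    (Z := fun j ω => (∑ i ∈ I j, partition p j (U i ω)) * ENNReal.ofReal (Q⁻¹ ^ j))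
    (fun j => (Finset.measurable_fun_sum _ fun i _ =>
      (measurable_partition p j).comp (hU i)).mul_const _)
    (C := ENNReal.ofReal K * ∫⁻ u, totalMass u ^ p ∂treeLaw ν)
    (r := ENNReal.ofReal (B * r / Q)) (by finiteness)
    (by rw [ENNReal.ofReal_lt_one, div_lt_one hQ0]; exact hQ) fun j => by
      have hmU : ∀ i, Measurable fun ω => partition p j (U i ω) := fun i =>
        (measurable_partition p j).comp (hU i)
      rw [lintegral_mul_const _ (by fun_prop), lintegral_finsetSum _ fun i _ => hmU i]
      simp_rw [lintegral_comp_tree P hU hlaw (measurable_partition p j)]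
      rw [Finset.sum_const, lintegral_partition ν hpos, hr, nsmul_eq_mul]
      have e1 : ((I j).card : ℝ≥0∞) ≤ ENNReal.ofReal (K * B ^ j) := by
        rw [← ENNReal.ofReal_natCast]; exact ENNReal.ofReal_le_ofReal (hI j)
      have e2 : ENNReal.ofReal (B * r / Q) ^ j =
          ENNReal.ofReal (B ^ j) * ENNReal.ofReal r ^ j * ENNReal.ofReal (Q⁻¹ ^ j) := by
        rw [← ENNReal.ofReal_pow hr0.le, ← ENNReal.ofReal_mul (by positivity),
          ← ENNReal.ofReal_mul (by positivity), ← ENNReal.ofReal_pow (by positivity)]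
        congr 1
        rw [div_eq_mul_inv, mul_pow, mul_pow]
      rw [e2]
      calc _ ≤ ENNReal.ofReal (K * B ^ j) * (ENNReal.ofReal r ^ j *
            ∫⁻ u, totalMass u ^ p ∂treeLaw ν) * ENNReal.ofReal (Q⁻¹ ^ j) := by gcongr
        _ = _ := by rw [ENNReal.ofReal_mul hK]; ring
  filter_upwards [h] with ω hω
  filter_upwards [hω.eventually (ge_mem_nhds (show (0 : ℝ≥0∞) < 1 by simp))] with j hj
  have hQj : ENNReal.ofReal (Q⁻¹ ^ j) = (ENNReal.ofReal (Q ^ j))⁻¹ := by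
    rw [← ENNReal.ofReal_inv_of_pos (by positivity), inv_pow]
  rw [hQj, ← div_eq_mul_inv, ENNReal.div_le_iff (by simp; positivity) (by simp), one_mul] at hj
  exact hj

theorem ae_eventually_le_sum_partition [IsProbabilityMeasure P] (hpos : ∀ᵐ x ∂ν, x ≠ 0 ∧ x ≠ ⊤)
    (hU : ∀ i, Measurable (U i)) (hlaw : ∀ i, P.map (U i) = treeLaw ν) (hind : iIndepFun U P)
    (hB : 1 < B) {K : ℝ} (hK : 0 < K) (hI : ∀ j, K * B ^ j ≤ (I j).card)
    {p q r r' e : ℝ} (hr0 : 0 < r) (hr : rate ν p = ENNReal.ofReal r)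
    (he0 : 0 < e) (he : ∫⁻ u, totalMass u ^ p ∂treeLaw ν = ENNReal.ofReal e)
    (hq1 : 1 < q) (hq2 : q ≤ 2) (hr0' : 0 < r') (hr' : rate ν (p * q) = ENNReal.ofReal r')
    (hpq : ∫⁻ u, totalMass u ^ (p * q) ∂treeLaw ν ≠ ⊤)
    (hlt : r' < B ^ (q - 1) * r ^ q) :
    ∀ᵐ ω ∂P, ∀ᶠ j in atTop, ENNReal.ofReal (K * e / 2 * (B * r) ^ j) ≤
      ∑ i ∈ I j, partition p j (U i ω) := by
  have hrq : 0 < r ^ q := by positivity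
  have hBq : 1 < B ^ (q - 1) := Real.one_lt_rpow hB (by linarith)
  -- `R` must exceed both rates in the moment bound and stay below `B^(q-1) r^q`, so that the number
  -- of trees wins.
  obtain ⟨R, hR1, hR2⟩ := exists_between (max_lt (show r ^ q < B ^ (q - 1) * r ^ q by
    exact lt_mul_of_one_lt_left hrq hBq) hlt)
  obtain ⟨C, hC, hCj⟩ := exists_lintegral_partition_rpow_le ν hpos hq1 hq2 hr hr0 hr' hr0'
    ((le_max_left _ _).trans_lt hR1) ((le_max_right _ _).trans_lt hR1) (by simp [he]) hpq
  have hR0 : 0 < R := hrq.trans ((le_max_left _ _).trans_lt hR1)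
  have hq0 : 0 < q - 1 := by linarith
  -- The Chernoff parameter at generation `j` is `l = a ρ^j`, chosen to give equality in `l^q v ≤ l
  -- m / 4` with `v = C R^j` and `m = r^j e`.
  set ρ := (r / R) ^ (q - 1)⁻¹ with hρ
  have hρ0 : 0 < ρ := by positivity
  set a := (e / (4 * C)) ^ (q - 1)⁻¹ with ha
  have ha0 : 0 < a := by positivity
  have hρq : ρ ^ (q - 1) = r / R := Real.rpow_inv_rpow (by positivity) hq0.ne'
  have haq : a ^ (q - 1) = e / (4 * C) := Real.rpow_inv_rpow (by positivity) hq0.ne'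
  -- The Chernoff exponent (number of trees times `l m / 4`) is at least of order `(Brρ)^j`. It
  -- grows because `(Brρ)^(q-1) = B^(q-1) r^q / R > 1`.
  have hBρ : 1 < B * r * ρ := by
    have h1 : 1 < (B * r * ρ) ^ (q - 1) := by
      rw [Real.mul_rpow (by positivity) hρ0.le, hρq, Real.mul_rpow (by positivity) hr0.le]
      have : r ^ q = r ^ (q - 1) * r := by rw [← Real.rpow_add_one hr0.ne']; ring_nf
      rw [this] at hR2
      rw [← mul_div_assoc, one_lt_div hR0]
      linarith
    by_contra hcon
    exact absurd (Real.rpow_le_one (by positivity) (not_lt.1 hcon) hq0.le) (not_le.2 h1)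
  have hkey : ∀ j, P {ω | ∑ i ∈ I j, partition p j (U i ω) ≤
      ENNReal.ofReal ((I j).card * (r ^ j * e) / 2)} ≤
      ENNReal.ofReal (Real.exp (-((K * (a * e / 4)) * (B * r * ρ) ^ j))) := by
    intro j
    refine (measure_sum_le_half_mean P (X := fun i ω => partition p j (U i ω)) (m := r ^ j * e)
      (v := C * R ^ j) (q := q) (l := a * ρ ^ j) (fun i => (measurable_partition p j).comp (hU i))
      (hind.comp (fun _ => partition p j) fun _ => measurable_partition p j) (by positivity)
      (by positivity) (fun i => ?_) hq1 hq2 (fun i => ?_) (by positivity) ?_ (I j)).trans ?_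
    · rw [lintegral_comp_tree P hU hlaw (measurable_partition p j), lintegral_partition ν hpos, hr,
        he, ENNReal.ofReal_mul (by positivity), ENNReal.ofReal_pow hr0.le]
    · rw [lintegral_comp_tree P hU hlaw ((measurable_partition p j).pow_const q)]
      exact hCj j
    · have h1 : (a * ρ ^ j) ^ q = (a * ρ ^ j) * (e / (4 * C) * (r / R) ^ j) := by
        have : (a * ρ ^ j) ^ q = (a * ρ ^ j) ^ (q - 1) * (a * ρ ^ j) := by
          rw [← Real.rpow_add_one (by positivity)]; ring_nf
        rw [this, Real.mul_rpow ha0.le (by positivity), haq, ← Real.rpow_natCast ρ j,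
          ← Real.rpow_mul hρ0.le, mul_comm (j : ℝ), Real.rpow_mul hρ0.le, hρq, Real.rpow_natCast]
        ring
      rw [h1, div_pow]
      apply le_of_eq
      field_simp
    · refine ENNReal.ofReal_le_ofReal (Real.exp_le_exp.2 (neg_le_neg ?_))
      have : K * (a * e / 4) * (B * r * ρ) ^ j =
          K * B ^ j * (a * ρ ^ j * (r ^ j * e) / 4) := by
        rw [mul_pow, mul_pow]; ring
      rw [this]
      exact mul_le_mul_of_nonneg_right (hI j) (by positivity)
  have hBC := ae_eventually_notMem (μ := P) (s := fun j => {ω | ∑ i ∈ I j, partition p j (U i ω) ≤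
      ENNReal.ofReal ((I j).card * (r ^ j * e) / 2)})
    (ne_top_of_le_ne_top (tsum_ofReal_exp_neg_ne_top
      (show 0 < K * (a * e / 4) by positivity) hBρ) (ENNReal.tsum_le_tsum hkey))
  filter_upwards [hBC] with ω hω
  filter_upwards [hω] with j hj
  refine le_trans (ENNReal.ofReal_le_ofReal ?_) (not_le.1 hj).le
  calc K * e / 2 * (B * r) ^ j = K * B ^ j * (r ^ j * e) / 2 := by rw [mul_pow]; ring
    _ ≤ _ := by gcongr; exact hI j

end Probability

end
end MixedCascade

/-! ### Weak convergence from convergence of the dyadic masses. -/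

namespace MixedCascade
section
open scoped ENNReal NNReal

/-- The closed-set half of the portmanteau theorem, applied to the complement, together with
convergence of the total masses. A general filter is allowed because the limits below are taken
along ultrafilters. -/
theorem measure_Ioo_le_of_tendsto {ι : Type*} {L : Filter ι} [L.NeBot] {μs : ι → FiniteMeasure ℝ}
    {μ : FiniteMeasure ℝ} (h : Tendsto μs L (𝓝 μ)) {a b : ℝ} {c : ℝ≥0∞}
    (hc : ∀ᶠ i in L, (μs i : Measure ℝ) (Set.Icc a b) ≤ c) : (μ : Measure ℝ) (Set.Ioo a b) ≤ c := by
  have hmass : Tendsto (fun i => (μs i : Measure ℝ) Set.univ) L (𝓝 ((μ : Measure ℝ) Set.univ)) := by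
    have := (ENNReal.tendsto_coe.2 h.mass)
    simpa using this
  have hcl := FiniteMeasure.limsup_measure_closed_le_of_tendsto h
    (F := (Set.Ioo a b)ᶜ) isOpen_Ioo.isClosed_compl
  have hsub : Tendsto (fun i => (μs i : Measure ℝ) Set.univ - c) L
      (𝓝 ((μ : Measure ℝ) Set.univ - c)) :=
    ENNReal.Tendsto.sub hmass tendsto_const_nhds (Or.inl (measure_ne_top _ _))
  have h1 : (μ : Measure ℝ) Set.univ - c ≤ (μ : Measure ℝ) (Set.Ioo a b)ᶜ := by
    rw [← hsub.limsup_eq]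
    refine (limsup_le_limsup ?_).trans hcl
    filter_upwards [hc] with i hi
    rw [measure_compl measurableSet_Ioo (measure_ne_top _ _)]
    exact tsub_le_tsub_left ((measure_mono Set.Ioo_subset_Icc_self).trans hi) _
  have h2 := measure_compl (μ := (μ : Measure ℝ)) (measurableSet_Ioo (a := a) (b := b)).compl
    (measure_ne_top _ _)
  rw [compl_compl] at h2
  rw [h2]
  exact tsub_le_iff_left.2 ((tsub_le_iff_right.1 h1))

theorem measurableSet_dyadicInterval (T : ℝ) (j k : ℕ) : MeasurableSet (dyadicInterval T j k) :=
  measurableSet_Icc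

theorem exists_floor_dyadic {T : ℝ} (hT : 0 < T) (j : ℕ) {x : ℝ} (hx : 0 ≤ x) :
    ∃ k : ℕ, (k : ℝ) * 2⁻¹ ^ j * T ≤ x ∧ x < ((k : ℝ) + 1) * 2⁻¹ ^ j * T := by
  have hd : 0 < (2 : ℝ)⁻¹ ^ j * T := by positivity
  refine ⟨⌊x / (2⁻¹ ^ j * T)⌋₊, ?_, ?_⟩
  · rw [mul_assoc, ← le_div_iff₀ hd]
    exact Nat.floor_le (by positivity)
  · rw [mul_assoc, ← div_lt_iff₀ hd]
    exact Nat.lt_floor_add_one _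

theorem dyadic_nbhd_subset {T : ℝ} (hT : 0 < T) {j k : ℕ} {x : ℝ}
    (h1 : (k : ℝ) * 2⁻¹ ^ j * T ≤ x) (h2 : x < ((k : ℝ) + 1) * 2⁻¹ ^ j * T) :
    Set.Icc (x - 2⁻¹ ^ j * T) (x + 2⁻¹ ^ j * T) ∩ Set.Icc 0 T ⊆
      dyadicInterval T j (k - 1) ∪ (dyadicInterval T j k ∪ dyadicInterval T j (k + 1)) := by
  rintro y ⟨⟨hy1, hy2⟩, hy0, -⟩
  have hd : 0 < (2 : ℝ)⁻¹ ^ j * T := by positivity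
  simp only [dyadicInterval, Set.mem_union, Set.mem_Icc, mul_assoc, add_mul, Nat.cast_add,
    Nat.cast_one, one_mul] at *
  set d := (2 : ℝ)⁻¹ ^ j * T
  rcases lt_or_ge y (k * d) with h | h
  · left
    -- For `k = 0` the truncated `k - 1` names no left neighbour, but then `y < 0` is excluded by `y
    -- ∈ [0, T]`.
    rcases Nat.eq_zero_or_pos k with rfl | hk
    · simp at h; linarith
    · rw [Nat.cast_sub hk]
      push_cast
      constructor <;> linarith
  · right
    rcases le_or_gt y (k * d + d) with h' | h'
    · left; exact ⟨h, h'⟩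
    · right; constructor <;> linarith

section Limit

variable {T : ℝ} {ℓ : ℕ → ℕ → ℝ≥0∞}

/-- Within `[0, T]`, a neighbourhood of `x` is covered by three neighbouring cells, each of small
mass. -/
theorem limit_no_atoms {ι : Type*} {L : Filter ι} [L.NeBot] {μs : ι → FiniteMeasure ℝ}
    {μ : FiniteMeasure ℝ} (hT : 0 < T) (h : Tendsto μs L (𝓝 μ))
    (hsupp : ∀ n, (μs n : Measure ℝ) (Set.Icc 0 T)ᶜ = 0)
    (hμ : (μ : Measure ℝ) (Set.Icc 0 T)ᶜ = 0)
    (hℓ : ∀ j k, Tendsto (fun n => (μs n : Measure ℝ) (dyadicInterval T j k)) L (𝓝 (ℓ j k)))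
    (hsmall : ∀ ε : ℝ≥0∞, 0 < ε → ∀ᶠ j in atTop, ∀ k, ℓ j k ≤ ε) (x : ℝ) :
    (μ : Measure ℝ) {x} = 0 := by
  by_cases hx : x ∈ Set.Icc 0 T
  swap
  · exact measure_mono_null (Set.singleton_subset_iff.2 hx) hμ
  refine nonpos_iff_eq_zero.1 (ENNReal.le_of_forall_pos_le_add fun ε hε _ => ?_)
  rw [zero_add]
  have hε3 : (0 : ℝ≥0∞) < ε / 3 := ENNReal.div_pos (by simpa using hε.ne') (by simp)
  obtain ⟨c, hc0, hc1⟩ := exists_between hε3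
  obtain ⟨j, hj⟩ := (hsmall c hc0).exists
  obtain ⟨k, hk1, hk2⟩ := exists_floor_dyadic hT j hx.1
  have hd : 0 < (2 : ℝ)⁻¹ ^ j * T := by positivity
  refine (measure_mono (Set.singleton_subset_iff.2 (show x ∈ Set.Ioo (x - 2⁻¹ ^ j * T)
    (x + 2⁻¹ ^ j * T) from ⟨by linarith, by linarith⟩))).trans (measure_Ioo_le_of_tendsto h ?_)
  have hev : ∀ i, ∀ᶠ n in L, (μs n : Measure ℝ) (dyadicInterval T j i) ≤ ε / 3 := fun i =>
    ((hℓ j i).eventually (gt_mem_nhds ((hj i).trans_lt hc1))).mono fun n hn => le_of_lt hn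
  filter_upwards [hev (k - 1), hev k, hev (k + 1)] with n h1 h2 h3
  have h4 : (μs n : Measure ℝ) (Set.Icc (x - 2⁻¹ ^ j * T) (x + 2⁻¹ ^ j * T)) ≤
      (μs n : Measure ℝ) (Set.Icc (x - 2⁻¹ ^ j * T) (x + 2⁻¹ ^ j * T) ∩ Set.Icc 0 T) := by
    have := measure_le_inter_add_sdiff (μs n : Measure ℝ)
      (Set.Icc (x - 2⁻¹ ^ j * T) (x + 2⁻¹ ^ j * T)) (Set.Icc 0 T)
    rwa [measure_mono_null (Set.sdiff_subset_compl _ _) (hsupp n), add_zero] at this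
  refine h4.trans ((measure_mono (dyadic_nbhd_subset hT hk1 hk2)).trans ?_)
  refine (measure_union_le _ _).trans ((add_le_add h1 ((measure_union_le _ _).trans
    (add_le_add h2 h3))).trans_eq ?_)
  rw [← add_assoc, ENNReal.add_thirds]

/-- The portmanteau theorem bounds the open cell above and the closed cell below by `ℓ j k`; without
atoms these have the same mass. -/
theorem limit_dyadicInterval {ι : Type*} {L : Filter ι} [L.NeBot] {μs : ι → FiniteMeasure ℝ}
    {μ : FiniteMeasure ℝ} (h : Tendsto μs L (𝓝 μ)) (hatom : ∀ x, (μ : Measure ℝ) {x} = 0)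
    {j k : ℕ}
    (hℓ : Tendsto (fun n => (μs n : Measure ℝ) (dyadicInterval T j k)) L (𝓝 (ℓ j k))) :
    (μ : Measure ℝ) (dyadicInterval T j k) = ℓ j k := by
  refine le_antisymm ?_ ?_
  · refine le_of_forall_gt_imp_ge_of_dense fun c hc => ?_
    have h1 := measure_Ioo_le_of_tendsto h (a := (k : ℝ) * 2⁻¹ ^ j * T)
      (b := ((k : ℝ) + 1) * 2⁻¹ ^ j * T) ((hℓ.eventually (gt_mem_nhds hc)).mono fun n hn => le_of_lt hn)
    have : NullSingletonClass (μ : Measure ℝ) := ⟨hatom⟩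
    rwa [measure_congr (Ioo_ae_eq_Icc)] at h1
  · have := FiniteMeasure.limsup_measure_closed_le_of_tendsto h
      (F := dyadicInterval T j k) isClosed_Icc
    rwa [hℓ.limsup_eq] at this

theorem measure_Iic_dyadic_succ {μ : Measure ℝ} [IsFiniteMeasure μ] (hT : 0 < T)
    (hatom : ∀ x, μ {x} = 0) (j k : ℕ) :
    μ (Set.Iic (((k : ℝ) + 1) * 2⁻¹ ^ j * T)) =
      μ (Set.Iic ((k : ℝ) * 2⁻¹ ^ j * T)) + μ (dyadicInterval T j k) := by
  have hd : 0 < (2 : ℝ)⁻¹ ^ j * T := by positivity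
  have hle : (k : ℝ) * 2⁻¹ ^ j * T ≤ ((k : ℝ) + 1) * 2⁻¹ ^ j * T := by
    rw [mul_assoc, mul_assoc]; nlinarith
  rw [dyadicInterval, ← measure_union₀ measurableSet_Icc.nullMeasurableSet,
    Set.Iic_union_Icc_eq_Iic hle]
  refine measure_mono_null ?_ (hatom ((k : ℝ) * 2⁻¹ ^ j * T))
  rintro x ⟨h1, h2, -⟩
  exact le_antisymm h1 h2

theorem measure_Iic_dyadic_eq {μ ν : Measure ℝ} [IsFiniteMeasure μ] [IsFiniteMeasure ν] (hT : 0 < T)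
    (hμ : μ (Set.Icc 0 T)ᶜ = 0) (hν : ν (Set.Icc 0 T)ᶜ = 0)
    (hμa : ∀ x, μ {x} = 0) (hνa : ∀ x, ν {x} = 0)
    (hμν : ∀ j k, μ (dyadicInterval T j k) = ν (dyadicInterval T j k)) (j k : ℕ) :
    μ (Set.Iic ((k : ℝ) * 2⁻¹ ^ j * T)) = ν (Set.Iic ((k : ℝ) * 2⁻¹ ^ j * T)) := by
  induction k with
  | zero =>
    have hz : ∀ ρ : Measure ℝ, ρ (Set.Icc 0 T)ᶜ = 0 → (∀ x, ρ {x} = 0) → ρ (Set.Iic 0) = 0 :=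
      fun ρ h1 h2 => by
        refine measure_mono_null (t := (Set.Icc 0 T)ᶜ ∪ {0}) (fun x hx => ?_)
          (measure_union_null h1 (h2 0))
        rcases (show x ≤ 0 from hx).eq_or_lt with h | h
        · right; exact h
        · left; exact fun h' => absurd h'.1 (not_le.2 h)
    simp [hz μ hμ hμa, hz ν hν hνa]
  | succ k ih =>
    rw [Nat.cast_succ, measure_Iic_dyadic_succ hT hμa, measure_Iic_dyadic_succ hT hνa, ih, hμν]

/-- The distribution functions agree at dyadic points, and between two neighbouring ones they vary
by one cell mass, which is arbitrarily small. -/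
theorem measure_ext_of_dyadic {μ ν : Measure ℝ} [IsFiniteMeasure μ] [IsFiniteMeasure ν] (hT : 0 < T)
    (hμ : μ (Set.Icc 0 T)ᶜ = 0) (hν : ν (Set.Icc 0 T)ᶜ = 0)
    (hμa : ∀ x, μ {x} = 0) (hνa : ∀ x, ν {x} = 0)
    (hμℓ : ∀ j k, μ (dyadicInterval T j k) = ℓ j k) (hνℓ : ∀ j k, ν (dyadicInterval T j k) = ℓ j k)
    (hsmall : ∀ ε : ℝ≥0∞, 0 < ε → ∀ᶠ j in atTop, ∀ k, ℓ j k ≤ ε) : μ = ν := by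
  have hle : ∀ (ρ σ : Measure ℝ) [IsFiniteMeasure ρ] [IsFiniteMeasure σ],
      (∀ j k : ℕ, ρ (Set.Iic ((k : ℝ) * 2⁻¹ ^ j * T)) = σ (Set.Iic ((k : ℝ) * 2⁻¹ ^ j * T))) →
      (∀ x, σ {x} = 0) → (∀ j k, σ (dyadicInterval T j k) = ℓ j k) →
      ∀ a, 0 ≤ a → ρ (Set.Iic a) ≤ σ (Set.Iic a) := by
    intro ρ σ _ _ h1 h2 h3 a ha
    refine ENNReal.le_of_forall_pos_le_add fun ε hε _ => ?_
    obtain ⟨j, hj⟩ := (hsmall ε (by simpa using hε)).exists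
    obtain ⟨k, hk1, hk2⟩ := exists_floor_dyadic hT j ha
    have h4 := h1 j (k + 1)
    push_cast at h4
    calc ρ (Set.Iic a) ≤ ρ (Set.Iic (((k : ℝ) + 1) * 2⁻¹ ^ j * T)) :=
          measure_mono (Set.Iic_subset_Iic.2 hk2.le)
      _ = σ (Set.Iic ((k : ℝ) * 2⁻¹ ^ j * T)) + ℓ j k := by
          rw [h4, measure_Iic_dyadic_succ hT h2, h3]
      _ ≤ _ := add_le_add (measure_mono (Set.Iic_subset_Iic.2 hk1)) (hj k)
  have heq := measure_Iic_dyadic_eq hT hμ hν hμa hνa fun j k => by rw [hμℓ, hνℓ]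
  refine Measure.ext_of_Iic μ ν fun a => ?_
  rcases lt_or_ge a 0 with ha | ha
  · have hsub : Set.Iic a ⊆ (Set.Icc 0 T)ᶜ := fun x hx h => by
      have : x ≤ a := hx
      linarith [h.1]
    rw [measure_mono_null hsub hμ, measure_mono_null hsub hν]
  · exact le_antisymm (hle μ ν heq hνa hνℓ a ha) (hle ν μ (fun j k => (heq j k).symm) hμa hμℓ a ha)

theorem dyadicInterval_zero (T : ℝ) : dyadicInterval T 0 0 = Set.Icc 0 T := by
  simp [dyadicInterval]

/-- Measures of bounded mass on `[0, T]` form a weakly compact set. Every cluster point there is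
atomless with cell masses `ℓ`, so the cluster point is unique and the sequence converges to it. -/
theorem exists_tendsto_of_dyadic {μs : ℕ → FiniteMeasure ℝ} (hT : 0 < T)
    (hsupp : ∀ n, (μs n : Measure ℝ) (Set.Icc 0 T)ᶜ = 0)
    (hℓ : ∀ j k, Tendsto (fun n => (μs n : Measure ℝ) (dyadicInterval T j k)) atTop (𝓝 (ℓ j k)))
    (hfin : ℓ 0 0 ≠ ⊤)
    (hsmall : ∀ ε : ℝ≥0∞, 0 < ε → ∀ᶠ j in atTop, ∀ k, ℓ j k ≤ ε) :
    ∃ μ : FiniteMeasure ℝ, Tendsto μs atTop (𝓝 μ) ∧ (μ : Measure ℝ) (Set.Icc 0 T)ᶜ = 0 ∧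
      (∀ x, (μ : Measure ℝ) {x} = 0) ∧ ∀ j k, (μ : Measure ℝ) (dyadicInterval T j k) = ℓ j k := by
  set K : Set (FiniteMeasure ℝ) := {μ | μ.mass ≤ (ℓ 0 0 + 1).toNNReal ∧ μ (Set.Icc 0 T)ᶜ = 0} with hK
  have hKc : IsCompact K := isCompact_setOfPred_finiteMeasure_le_of_isCompact _ isCompact_Icc
  have hKsupp : ∀ μ ∈ K, (μ : Measure ℝ) (Set.Icc 0 T)ᶜ = 0 := fun μ hμ => by
    rw [← FiniteMeasure.ennreal_coeFn_eq_coeFn_toMeasure, hμ.2, ENNReal.coe_zero]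
  have hmem : ∀ᶠ n in atTop, μs n ∈ K := by
    have hlt : ℓ 0 0 < ℓ 0 0 + 1 := ENNReal.lt_add_right hfin one_ne_zero
    filter_upwards [(hℓ 0 0).eventually (gt_mem_nhds hlt)] with n hn
    refine ⟨?_, ?_⟩
    · have h1 : (μs n : Measure ℝ) Set.univ ≤ ℓ 0 0 + 1 := by
        rw [← measure_add_measure_compl (measurableSet_Icc (a := (0 : ℝ)) (b := T)), hsupp, add_zero,
          ← dyadicInterval_zero]
        exact le_of_lt hn
      rw [← ENNReal.coe_le_coe, ENNReal.coe_toNNReal (by simp [hfin]), FiniteMeasure.ennreal_mass]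
      exact h1
    · rw [← ENNReal.coe_inj, FiniteMeasure.ennreal_coeFn_eq_coeFn_toMeasure, hsupp, ENNReal.coe_zero]
  have hprop : ∀ μ ∈ K, ClusterPt μ (map μs atTop) → (∀ x, (μ : Measure ℝ) {x} = 0) ∧
      ∀ j k, (μ : Measure ℝ) (dyadicInterval T j k) = ℓ j k := by
    intro μ hμ hcl
    obtain ⟨g, hg, hlim⟩ := mapClusterPt_iff_ultrafilter.1 hcl
    have hatom := limit_no_atoms (L := (g : Filter ℕ)) hT hlim hsupp (hKsupp μ hμ)
      (fun j k => (hℓ j k).mono_left hg) hsmall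
    exact ⟨hatom, fun j k => limit_dyadicInterval hlim hatom ((hℓ j k).mono_left hg)⟩
  obtain ⟨μ, hμK, hμc⟩ := hKc (f := map μs atTop) (le_principal_iff.2 hmem)
  obtain ⟨ha, hd⟩ := hprop μ hμK hμc
  refine ⟨μ, ?_, hKsupp μ hμK, ha, hd⟩
  refine hKc.le_nhds_of_unique_clusterPt hmem fun ρ hρ hρc => ?_
  obtain ⟨ha', hd'⟩ := hprop ρ hρ hρc
  have := measure_ext_of_dyadic hT (hKsupp ρ hρ) (hKsupp μ hμK) ha' ha hd' hd hsmall
  exact Subtype.ext this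

end Limit

end
end MixedCascade

/-! ### The cascade measure and the masses of its cells. -/

namespace MixedCascade
section
open scoped ENNReal NNReal

/-- The measure of generation `n` on `[0, T]` associated with the weights `u`, root included. -/
noncomputable def treeMeasure : ℕ → ℝ → Tree → Measure ℝ
  | 0, T, u => u [] • volume.restrict (Set.Icc 0 T)
  | n + 1, T, u => u [] • (treeMeasure n (T / 2) (child false u) +
      (treeMeasure n (T / 2) (child true u)).map (· + T / 2))

theorem treeMeasure_compl (n : ℕ) {T : ℝ} (hT : 0 ≤ T) (u : Tree) :
    treeMeasure n T u (Set.Icc 0 T)ᶜ = 0 := by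
  induction n generalizing T u with
  | zero => simp [treeMeasure, Measure.restrict_apply measurableSet_Icc.compl]
  | succ n ih =>
    have h2 : 0 ≤ T / 2 := by linarith
    rw [treeMeasure, Measure.smul_apply, Measure.add_apply,
      Measure.map_apply (by fun_prop) measurableSet_Icc.compl]
    rw [measure_mono_null (t := (Set.Icc 0 (T / 2))ᶜ) _ (ih h2 _),
      measure_mono_null (t := (Set.Icc 0 (T / 2))ᶜ) _ (ih h2 _)]
    · simp
    · intro x hx h
      exact hx ⟨by linarith [h.1], by linarith [h.2]⟩
    · intro x hx h
      exact hx ⟨h.1, by linarith [h.2]⟩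

theorem treeMeasure_singleton (n : ℕ) (T : ℝ) (u : Tree) (x : ℝ) : treeMeasure n T u {x} = 0 := by
  induction n generalizing T u x with
  | zero =>
    rw [treeMeasure, Measure.smul_apply, measure_mono_null (t := {x}) subset_rfl]
    · simp
    · simp
  | succ n ih =>
    rw [treeMeasure, Measure.smul_apply, Measure.add_apply,
      Measure.map_apply (by fun_prop) (measurableSet_singleton x)]
    have : (fun y : ℝ => y + T / 2) ⁻¹' {x} = {x - T / 2} := by
      ext y; simp only [Set.mem_preimage, Set.mem_singleton_iff, eq_sub_iff_add_eq]
    rw [this, ih, ih]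
    simp

theorem ofReal_half_mul {T : ℝ} (hT : 0 ≤ T) (x y : ℝ≥0∞) :
    x * (ENNReal.ofReal (T / 2) * y) = ENNReal.ofReal T * (x / 2 * y) := by
  rw [div_eq_mul_inv, ENNReal.ofReal_mul hT, ENNReal.ofReal_inv_of_pos (by norm_num),
    ENNReal.ofReal_ofNat, div_eq_mul_inv]
  ring

theorem treeMeasure_univ (n : ℕ) {T : ℝ} (hT : 0 ≤ T) (u : Tree) :
    treeMeasure n T u Set.univ = ENNReal.ofReal T * genMass n u := by
  induction n generalizing T u with
  | zero => simp [treeMeasure, genMass, mul_comm]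
  | succ n ih =>
    rw [treeMeasure, Measure.smul_apply, Measure.add_apply,
      Measure.map_apply (by fun_prop) MeasurableSet.univ, Set.preimage_univ, ih (by linarith),
      ih (by linarith), ← mul_add, smul_eq_mul, ofReal_half_mul hT, genMass]
    simp only [div_eq_mul_inv]
    ring

theorem treeMeasure_eq_zero_of_inter {n : ℕ} {T : ℝ} (hT : 0 ≤ T) {u : Tree} {s : Set ℝ} {x : ℝ}
    (h : s ∩ Set.Icc 0 T ⊆ {x}) : treeMeasure n T u s = 0 := by
  refine measure_mono_null (t := (Set.Icc 0 T)ᶜ ∪ {x}) (fun y hy => ?_)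
    (measure_union_null (treeMeasure_compl n hT u) (treeMeasure_singleton n T u x))
  by_cases hy' : y ∈ Set.Icc 0 T
  · right; exact h ⟨hy, hy'⟩
  · left; exact hy'

theorem dyadicInterval_succ (T : ℝ) (j k : ℕ) :
    dyadicInterval T (j + 1) k = dyadicInterval (T / 2) j k := by
  simp only [dyadicInterval, pow_succ]
  congr 1 <;> ring

theorem preimage_dyadicInterval_succ (T : ℝ) (j k : ℕ) :
    (fun x : ℝ => x + T / 2) ⁻¹' dyadicInterval T (j + 1) (2 ^ j + k) =
      dyadicInterval (T / 2) j k := by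
  have h : (2 : ℝ) ^ j * 2⁻¹ ^ j = 1 := by rw [← mul_pow]; norm_num
  ext x
  have e1 : ((2 ^ j + k : ℕ) : ℝ) * 2⁻¹ ^ (j + 1) * T = k * 2⁻¹ ^ j * (T / 2) + T / 2 := by
    push_cast
    rw [pow_succ]
    linear_combination (T / 2) * h
  have e2 : (((2 ^ j + k : ℕ) : ℝ) + 1) * 2⁻¹ ^ (j + 1) * T =
      ((k : ℝ) + 1) * 2⁻¹ ^ j * (T / 2) + T / 2 := by
    push_cast
    rw [pow_succ]
    linear_combination (T / 2) * h
  simp only [dyadicInterval, Set.mem_preimage, Set.mem_Icc, e1, e2, add_le_add_iff_right]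

theorem dyadicInterval_subset {T : ℝ} (hT : 0 ≤ T) {j k : ℕ} (hk : k < 2 ^ j) :
    dyadicInterval T j k ⊆ Set.Icc 0 T := by
  refine Set.Icc_subset_Icc (by positivity) ?_
  have h1 : ((k : ℝ) + 1) ≤ 2 ^ j := by exact_mod_cast hk
  have h2 : (2 : ℝ) ^ j * 2⁻¹ ^ j = 1 := by rw [← mul_pow]; norm_num
  calc ((k : ℝ) + 1) * 2⁻¹ ^ j * T ≤ 2 ^ j * 2⁻¹ ^ j * T := by gcongr
    _ = T := by rw [h2, one_mul]

theorem dyadicInterval_inter_subset {T : ℝ} (hT : 0 ≤ T) {j k : ℕ} (hk : 2 ^ j ≤ k) :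
    dyadicInterval T j k ∩ Set.Icc 0 T ⊆ {T} := by
  rintro x ⟨⟨h1, -⟩, -, h2⟩
  have h3 : (2 : ℝ) ^ j ≤ k := by exact_mod_cast hk
  have h4 : (2 : ℝ) ^ j * 2⁻¹ ^ j = 1 := by rw [← mul_pow]; norm_num
  have : T ≤ (k : ℝ) * 2⁻¹ ^ j * T := by
    calc T = 2 ^ j * 2⁻¹ ^ j * T := by rw [h4, one_mul]
      _ ≤ _ := by gcongr
  exact le_antisymm h2 (this.trans h1)

/-- Descending `j` generations leaves the whole mass of a subtree after `n` generations. At each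
level the half not containing the cell meets it in at most one point, which has no mass. -/
theorem treeMeasure_dyadicInterval (n j : ℕ) {T : ℝ} (hT : 0 ≤ T) (u : Tree) {k : ℕ}
    (hk : k < 2 ^ j) :
    treeMeasure (n + j) T u (dyadicInterval T j k) = ENNReal.ofReal T * leaf (genMass n) j u k := by
  induction j generalizing T u k with
  | zero =>
    obtain rfl : k = 0 := by simpa using hk
    rw [dyadicInterval_zero, leaf, add_zero, ← treeMeasure_univ n hT,
      ← measure_add_measure_compl (measurableSet_Icc (a := (0 : ℝ)) (b := T)),
      treeMeasure_compl n hT, add_zero]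
  | succ j ih =>
    have h2 : 0 ≤ T / 2 := by linarith
    rw [← add_assoc, treeMeasure, Measure.smul_apply, Measure.add_apply, smul_eq_mul,
      Measure.map_apply (by fun_prop) (measurableSet_dyadicInterval _ _ _), leaf]
    split_ifs with h
    · have hz : treeMeasure (n + j) (T / 2) (child true u)
          ((fun x : ℝ => x + T / 2) ⁻¹' dyadicInterval T (j + 1) k) = 0 := by
        refine treeMeasure_eq_zero_of_inter h2 (x := 0) ?_
        rintro x ⟨hx1, hx2, -⟩
        rw [dyadicInterval_succ] at hx1
        have := (dyadicInterval_subset h2 h hx1).2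
        exact le_antisymm (by linarith) hx2
      rw [hz, add_zero, dyadicInterval_succ, ih h2 _ h, ofReal_half_mul hT]
    · obtain ⟨k, rfl⟩ := Nat.exists_eq_add_of_le (not_lt.1 h)
      have hk' : k < 2 ^ j := by rw [pow_succ] at hk; omega
      have hz : treeMeasure (n + j) (T / 2) (child false u)
          (dyadicInterval T (j + 1) (2 ^ j + k)) = 0 := by
        rw [dyadicInterval_succ]
        exact treeMeasure_eq_zero_of_inter h2 (dyadicInterval_inter_subset h2 (by omega))
      rw [hz, zero_add, preimage_dyadicInterval_succ, ih h2 _ hk', ofReal_half_mul hT,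
        Nat.add_sub_cancel_left]

theorem wordIndex_cons {n : ℕ} (b : Bool) (r : Fin n → Bool) :
    wordIndex (Fin.cons b r : Fin (n + 1) → Bool) = b.toNat * 2 ^ n + wordIndex r := by
  unfold wordIndex
  rw [Fin.sum_univ_succ]
  simp only [Fin.cons_zero, Fin.cons_succ, Fin.val_zero, Fin.val_succ, add_tsub_cancel_right,
    Nat.sub_zero]
  congr 1
  refine Finset.sum_congr rfl fun i _ => ?_
  congr 2
  omega

theorem map_restrict_dyadicInterval (T : ℝ) (n k : ℕ) :
    (volume.restrict (dyadicInterval (T / 2) n k)).map (· + T / 2) =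
      volume.restrict (dyadicInterval T (n + 1) (2 ^ n + k)) := by
  rw [← preimage_dyadicInterval_succ]
  exact ((measurePreserving_add_right volume (T / 2)).restrict_preimage
    (measurableSet_dyadicInterval _ _ _)).map_eq

theorem treeMeasure_eq_sum (n : ℕ) (T : ℝ) (u : Tree) :
    treeMeasure n T u = ∑ r : Fin n → Bool,
      (∏ i ∈ Finset.range (n + 1), u ((List.ofFn r).take i)) •
        volume.restrict (dyadicInterval T n (wordIndex r)) := by
  induction n generalizing T u with
  | zero => simp [treeMeasure, wordIndex, dyadicInterval_zero]
  | succ n ih =>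
    rw [treeMeasure, ih, ih, ← (Fin.consEquiv fun _ => Bool).sum_comp, Fintype.sum_prod_type,
      Fintype.sum_bool, add_comm, smul_add, Finset.smul_sum,
      ← Measure.mapₗ_apply_of_measurable (f := fun x : ℝ => x + T / 2) (by fun_prop), map_sum,
      Finset.smul_sum]
    have hprod : ∀ (b : Bool) (r : Fin n → Bool),
        ∏ i ∈ Finset.range (n + 1 + 1), u ((List.ofFn (Fin.cons b r : Fin (n + 1) → Bool)).take i) =
        u [] * ∏ i ∈ Finset.range (n + 1), child b u ((List.ofFn r).take i) := by
      intro b r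
      rw [Finset.prod_range_succ', List.take_zero, mul_comm]
      congr 1
      refine Finset.prod_congr rfl fun i _ => ?_
      rw [List.ofFn_succ]
      simp [child]
    have hc : ∀ (b : Bool) (r : Fin n → Bool),
        (Fin.consEquiv fun _ => Bool) (b, r) = Fin.cons b r := fun _ _ => rfl
    congr 1 <;> refine Finset.sum_congr rfl fun r _ => ?_
    · rw [Measure.mapₗ_apply_of_measurable (by fun_prop), Measure.map_smul,
        map_restrict_dyadicInterval, smul_smul]
      simp only [hc, hprod, wordIndex_cons, Bool.toNat_true, one_mul]
    · rw [smul_smul]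
      simp only [hc, hprod, wordIndex_cons, Bool.toNat_false, zero_mul, zero_add,
        dyadicInterval_succ]

/-- The tree with root weight `1` and the weights `w` elsewhere. -/
noncomputable def weightTree (w : List Bool → ℝ) : Tree :=
  graft 1 (fun s => ENNReal.ofReal (w (false :: s))) fun s => ENNReal.ofReal (w (true :: s))

theorem weightTree_of_ne_nil (w : List Bool → ℝ) {s : List Bool} (hs : s ≠ []) :
    weightTree w s = ENNReal.ofReal (w s) := by
  match s with
  | [] => exact absurd rfl hs
  | false :: s => rfl
  | true :: s => rfl

theorem cascadeStep_eq_treeMeasure (T : ℝ) {w : List Bool → ℝ} (hw : ∀ s, s ≠ [] → 0 ≤ w s)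
    (n : ℕ) : (cascadeStep T w n : Measure ℝ) = treeMeasure n T (weightTree w) := by
  rw [treeMeasure_eq_sum, cascadeStep, FiniteMeasure.toMeasure_sum]
  refine Finset.sum_congr rfl fun r _ => ?_
  -- The path product starts at the first letter, so it never reads the weight at the empty word; in
  -- `weightTree` the root contributes a factor 1.
  have hne : ∀ i ∈ Finset.Icc 1 n, (List.ofFn r).take i ≠ [] := fun i hi => by
    rw [Finset.mem_Icc] at hi
    rw [Ne, List.take_eq_nil_iff]
    rintro (h | h)
    · omega
    · rw [List.ofFn_eq_nil_iff] at h; omega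
  have h1 : ((pathProduct w r).toNNReal : ℝ≥0∞) =
      ∏ i ∈ Finset.range (n + 1), weightTree w ((List.ofFn r).take i) := by
    have h0 : weightTree w [] = 1 := rfl
    rw [Finset.prod_range_succ', List.take_zero, h0, mul_one]
    change ENNReal.ofReal (pathProduct w r) = _
    rw [pathProduct, ENNReal.ofReal_prod_of_nonneg fun i hi => hw _ (hne i hi),
      ← Finset.Ico_add_one_right_eq_Icc, Finset.prod_Ico_eq_prod_range, Nat.add_sub_cancel]
    refine Finset.prod_congr rfl fun i hi => ?_
    rw [add_comm 1 i, weightTree_of_ne_nil]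
    exact hne _ (Finset.mem_Icc.2 ⟨by omega, by simpa using hi⟩)
  rw [← h1]
  rfl

/-- The masses of the subtrees converge, with positive and finite limits. -/
structure HasLimits (u : Tree) : Prop where
  weight : ∀ s, u s ≠ 0 ∧ u s ≠ ⊤
  tendsto : ∀ s, Tendsto (fun n => genMass n (subtree s u)) atTop (𝓝 (totalMass (subtree s u)))
  totalMass_ne : ∀ s, totalMass (subtree s u) ≠ 0 ∧ totalMass (subtree s u) ≠ ⊤

/-- The largest cell of generation `j` has a mass tending to `0`. -/
def HasSmallLeaves (u : Tree) : Prop :=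
  ∀ ε : ℝ≥0∞, 0 < ε → ∀ᶠ j in atTop, ∀ k < 2 ^ j, leaf totalMass j u k ≤ ε

theorem HasLimits.child {u : Tree} (h : HasLimits u) (b : Bool) : HasLimits (child b u) :=
  ⟨fun s => h.weight (b :: s), fun s => h.tendsto (b :: s), fun s => h.totalMass_ne (b :: s)⟩

/-- A cascade carries no random weight at the root. Only its two first-generation subtrees have the
tree law, and regularity is transferred from them. -/
theorem HasLimits.graft_one {a b : Tree} (ha : HasLimits a) (hb : HasLimits b) :
    HasLimits (graft 1 a b) := by
  have ht : Tendsto (fun n => genMass n (graft 1 a b)) atTop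
      (𝓝 ((totalMass a + totalMass b) / 2)) := by
    refine (tendsto_add_atTop_iff_nat 1).1 ?_
    simp only [genMass, graft_nil, one_mul, child_false_graft, child_true_graft]
    exact ENNReal.Tendsto.div_const ((ha.tendsto []).add (hb.tendsto [])) (Or.inr (by simp))
  have hl : totalMass (graft 1 a b) = (totalMass a + totalMass b) / 2 := ht.liminf_eq
  have ha0 : totalMass a ≠ 0 ∧ totalMass a ≠ ⊤ := ha.totalMass_ne []
  have hb0 : totalMass b ≠ 0 ∧ totalMass b ≠ ⊤ := hb.totalMass_ne []
  refine ⟨fun s => ?_, fun s => ?_, fun s => ?_⟩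
  · match s with
    | [] => simp
    | false :: s => exact ha.weight s
    | true :: s => exact hb.weight s
  · match s with
    | [] => exact hl ▸ ht
    | false :: s => exact ha.tendsto s
    | true :: s => exact hb.tendsto s
  · match s with
    | [] =>
      change totalMass (graft 1 a b) ≠ 0 ∧ totalMass (graft 1 a b) ≠ ⊤
      rw [hl]
      exact ⟨by simp [ha0.1], ENNReal.div_ne_top (ENNReal.add_ne_top.2 ⟨ha0.2, hb0.2⟩) (by simp)⟩
    | false :: s => exact ha.totalMass_ne s
    | true :: s => exact hb.totalMass_ne s

theorem HasSmallLeaves.graft_one {a b : Tree} (ha : HasSmallLeaves a) (hb : HasSmallLeaves b) :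
    HasSmallLeaves (graft 1 a b) := by
  intro ε hε
  rw [← Filter.eventually_map (m := fun j => j) (P := fun j => ∀ k < 2 ^ j, _ ≤ ε), Filter.map_id',
    ← Filter.map_add_atTop_eq_nat 1, Filter.eventually_map]
  filter_upwards [ha ε hε, hb ε hε] with j h1 h2 k hk
  have h3 : (1 / 2 : ℝ≥0∞) ≤ 1 := by simp
  simp only [leaf, graft_nil, child_false_graft, child_true_graft]
  split_ifs with h
  · exact (mul_le_of_le_one_left' h3).trans (h1 k h)
  · exact (mul_le_of_le_one_left' h3).trans (h2 _ (by rw [pow_succ] at hk; omega))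

theorem HasLimits.tendsto_leaf {u : Tree} (h : HasLimits u) (j k : ℕ) :
    Tendsto (fun n => leaf (genMass n) j u k) atTop (𝓝 (leaf totalMass j u k)) := by
  induction j generalizing u k with
  | zero => exact h.tendsto []
  | succ j ih =>
    simp only [leaf]
    refine ENNReal.Tendsto.const_mul ?_ (Or.inr (ENNReal.div_ne_top (h.weight []).2 (by simp)))
    split_ifs
    · exact ih (h.child false) k
    · exact ih (h.child true) _

theorem HasLimits.leaf_ne {u : Tree} (h : HasLimits u) (j k : ℕ) :
    leaf totalMass j u k ≠ 0 ∧ leaf totalMass j u k ≠ ⊤ := by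
  induction j generalizing u k with
  | zero => exact h.totalMass_ne []
  | succ j ih =>
    simp only [leaf]
    have h0 : u [] / 2 ≠ 0 ∧ u [] / 2 ≠ ⊤ := ⟨ENNReal.div_ne_zero.2 ⟨(h.weight []).1, by simp⟩,
      ENNReal.div_ne_top (h.weight []).2 (by simp)⟩
    split_ifs
    · exact ⟨mul_ne_zero h0.1 (ih (h.child false) k).1, ENNReal.mul_ne_top h0.2 (ih (h.child false) k).2⟩
    · exact ⟨mul_ne_zero h0.1 (ih (h.child true) _).1, ENNReal.mul_ne_top h0.2 (ih (h.child true) _).2⟩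

theorem cascadeMeasure_spec {T : ℝ} (hT : 0 < T) {w : List Bool → ℝ} (hw : ∀ s, s ≠ [] → 0 ≤ w s)
    (h : HasLimits (weightTree w)) (hs : HasSmallLeaves (weightTree w)) :
    (cascadeMeasure T w : Measure ℝ) (Set.Icc 0 T)ᶜ = 0 ∧
      (∀ x, (cascadeMeasure T w : Measure ℝ) {x} = 0) ∧
      ∀ j k, k < 2 ^ j → (cascadeMeasure T w : Measure ℝ) (dyadicInterval T j k) =
        ENNReal.ofReal T * leaf totalMass j (weightTree w) k := by
  have hT0 : ENNReal.ofReal T ≠ 0 := by simpa using hT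
  -- Cells with `k ≥ 2^j` meet `[0, T]` at most in the point `T`, hence the limit mass 0. Actual
  -- convergence is what gives the `limUnder` in `cascadeMeasure` its intended value.
  obtain ⟨μ, hlim, h1, h2, h3⟩ := exists_tendsto_of_dyadic (μs := cascadeStep T w)
    (ℓ := fun j k => if k < 2 ^ j then ENNReal.ofReal T * leaf totalMass j (weightTree w) k else 0) hT
    (fun n => by rw [cascadeStep_eq_treeMeasure T hw, treeMeasure_compl n hT.le])
    (fun j k => by
      simp only [cascadeStep_eq_treeMeasure T hw]
      split_ifs with hk
      · refine (tendsto_add_atTop_iff_nat j).1 ?_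
        simp only [treeMeasure_dyadicInterval _ j hT.le _ hk]
        exact ENNReal.Tendsto.const_mul (h.tendsto_leaf j k) (Or.inr (by simp))
      · refine tendsto_const_nhds.congr fun n => ?_
        exact (treeMeasure_eq_zero_of_inter hT.le
          (dyadicInterval_inter_subset hT.le (not_lt.1 hk))).symm)
    (by
      simp only [pow_zero, zero_lt_one, if_true]
      exact ENNReal.mul_ne_top (by simp) (h.leaf_ne 0 0).2)
    (fun ε hε => by
      have hε' : 0 < ε / ENNReal.ofReal T := ENNReal.div_pos hε.ne' (by simp)
      filter_upwards [hs _ hε'] with j hj k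
      split_ifs with hk
      · calc _ ≤ ENNReal.ofReal T * (ε / ENNReal.ofReal T) := by gcongr; exact hj k hk
          _ = ε := ENNReal.mul_div_cancel hT0 (by simp)
      · exact zero_le)
  have hμ : cascadeMeasure T w = μ := hlim.limUnder_eq
  rw [hμ]
  refine ⟨h1, h2, fun j k hk => ?_⟩
  rw [h3, if_pos hk]

theorem cellMass_eq {T : ℝ} (hT : 0 < T) {w : ℕ → List Bool → ℝ}
    (hw : ∀ m s, s ≠ [] → 0 ≤ w m s) (h : ∀ m, HasLimits (weightTree (w m)))
    (hs : ∀ m, HasSmallLeaves (weightTree (w m))) (j m : ℕ) {k : ℕ} (hk : k < 2 ^ j) :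
    cellMass T w j (m * 2 ^ j + k) = T * (leaf totalMass j (weightTree (w m)) k).toReal := by
  have h4 : (2 : ℝ) ^ j * 2⁻¹ ^ j = 1 := by rw [← mul_pow]; norm_num
  have hd : 0 < (2 : ℝ)⁻¹ ^ j * T := by positivity
  have hI : ∀ m' : ℕ, Set.Icc (((m * 2 ^ j + k : ℕ) : ℝ) * 2⁻¹ ^ j * T - m' * T)
      ((((m * 2 ^ j + k : ℕ) : ℝ) + 1) * 2⁻¹ ^ j * T - m' * T) =
      Set.Icc ((k : ℝ) * 2⁻¹ ^ j * T + ((m : ℝ) - m') * T)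
        (((k : ℝ) + 1) * 2⁻¹ ^ j * T + ((m : ℝ) - m') * T) := fun m' => by
    push_cast
    congr 1 <;> linear_combination (m : ℝ) * T * h4
  have hsub := dyadicInterval_subset hT.le hk
  rw [dyadicInterval, Set.Icc_subset_Icc_iff (by rw [mul_assoc, mul_assoc]; nlinarith)] at hsub
  have hmain : concatMeasure T w (dyadicInterval T j (m * 2 ^ j + k)) =
      ENNReal.ofReal T * leaf totalMass j (weightTree (w m)) k := by
    rw [dyadicInterval, concatMeasure_Icc]
    simp_rw [hI]
    rw [tsum_eq_single m]
    · rw [sub_self, zero_mul, add_zero, add_zero]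
      exact (cascadeMeasure_spec hT (hw m) (h m) (hs m)).2.2 j k hk
    · intro m' hm'
      obtain ⟨hc1, hc2, -⟩ := cascadeMeasure_spec hT (hw m') (h m') (hs m')
      refine measure_mono_null (t := (Set.Icc 0 T)ᶜ ∪ ({0} ∪ {T})) (fun x hx => ?_)
        (measure_union_null hc1 (measure_union_null (hc2 0) (hc2 T)))
      by_cases hxT : x ∈ Set.Icc 0 T
      · right
        -- The cell of block `m` can touch another block only at an endpoint: at `T` for an earlier
        -- block, at `0` for a later one.
        rcases lt_or_gt_of_ne hm' with hlt | hlt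
        · right
          have : (m' : ℝ) + 1 ≤ m := by exact_mod_cast hlt
          have h5 : T ≤ ((m : ℝ) - m') * T := by nlinarith
          exact le_antisymm hxT.2 (by linarith [hx.1])
        · left
          have : (m : ℝ) + 1 ≤ m' := by exact_mod_cast hlt
          have h5 : ((m : ℝ) - m') * T ≤ -T := by nlinarith
          exact le_antisymm (by linarith [hx.2]) hxT.1
      · left; exact hxT
  rw [cellMass, Measure.real, hmain, ENNReal.toReal_mul, ENNReal.toReal_ofReal hT.le]

end
end MixedCascade

/-! ### Analytic properties of τ and of the critical exponents. -/

namespace MixedCascade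
section
open scoped ENNReal NNReal

section Tau

variable {ν : Measure ℝ}

theorem ae_rpow_eq_exp (hpos : ∀ᵐ x ∂ν, 0 < x) (p : ℝ) :
    (fun x : ℝ => x ^ p) =ᵐ[ν] fun x => Real.exp (p * Real.log x) := by
  filter_upwards [hpos] with x hx
  rw [Real.rpow_def_of_pos hx, mul_comm]

theorem integrableExpSet_log (hpos : ∀ᵐ x ∂ν, 0 < x)
    (hmom : ∀ p : ℝ, Integrable (fun x : ℝ => x ^ p) ν) : integrableExpSet Real.log ν = Set.univ :=
  Set.eq_univ_of_forall fun p => (hmom p).congr (ae_rpow_eq_exp hpos p)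

theorem integral_rpow_eq_mgf (hpos : ∀ᵐ x ∂ν, 0 < x) (p : ℝ) :
    ∫ x, x ^ p ∂ν = mgf Real.log ν p := integral_congr_ae (ae_rpow_eq_exp hpos p)

/-- Since `W^p = exp(p log W)`, analyticity, concavity and the derivative of `τ` are all read off
the cumulant generating function of `log W`. -/
theorem tau_eq_cgf (hpos : ∀ᵐ x ∂ν, 0 < x) :
    tau ν = fun p => p - cgf Real.log ν p / Real.log 2 - 1 := by
  funext p
  rw [tau, integral_rpow_eq_mgf hpos, Real.logb, cgf]

theorem analyticAt_tau (hpos : ∀ᵐ x ∂ν, 0 < x)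
    (hmom : ∀ p : ℝ, Integrable (fun x : ℝ => x ^ p) ν) (p : ℝ) : AnalyticAt ℝ (tau ν) p := by
  have h : AnalyticAt ℝ (cgf Real.log ν) p :=
    analyticAt_cgf (by rw [integrableExpSet_log hpos hmom, interior_univ]; trivial)
  rw [tau_eq_cgf hpos]
  exact (analyticAt_id.sub (h.div_const)).sub analyticAt_const

theorem differentiable_tau (hpos : ∀ᵐ x ∂ν, 0 < x)
    (hmom : ∀ p : ℝ, Integrable (fun x : ℝ => x ^ p) ν) : Differentiable ℝ (tau ν) :=
  fun p => (analyticAt_tau hpos hmom p).differentiableAt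

theorem continuous_deriv_tau (hpos : ∀ᵐ x ∂ν, 0 < x)
    (hmom : ∀ p : ℝ, Integrable (fun x : ℝ => x ^ p) ν) : Continuous (deriv (tau ν)) :=
  continuous_iff_continuousAt.2 fun p => (analyticAt_tau hpos hmom p).deriv.continuousAt

theorem continuous_tangent (hpos : ∀ᵐ x ∂ν, 0 < x)
    (hmom : ∀ p : ℝ, Integrable (fun x : ℝ => x ^ p) ν) :
    Continuous fun p => p * deriv (tau ν) p - tau ν p :=
  (continuous_id.mul (continuous_deriv_tau hpos hmom)).sub (differentiable_tau hpos hmom).continuous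

theorem convexOn_cgf_log (hpos : ∀ᵐ x ∂ν, 0 < x)
    (hmom : ∀ p : ℝ, Integrable (fun x : ℝ => x ^ p) ν) : ConvexOn ℝ Set.univ (cgf Real.log ν) := by
  have hint : ∀ p, p ∈ interior (integrableExpSet Real.log ν) := fun p => by
    rw [integrableExpSet_log hpos hmom, interior_univ]; trivial
  have han : ∀ p, AnalyticAt ℝ (cgf Real.log ν) p := fun p => analyticAt_cgf (hint p)
  refine convexOn_univ_of_deriv2_nonneg (fun p => (han p).differentiableAt)
    (fun p => (han p).deriv.differentiableAt) fun p => ?_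
  rw [← iteratedDeriv_eq_iterate, iteratedDeriv_two_cgf_eq_integral (hint p)]
  exact div_nonneg (integral_nonneg fun x => by positivity) mgf_nonneg

theorem concaveOn_tau (hpos : ∀ᵐ x ∂ν, 0 < x)
    (hmom : ∀ p : ℝ, Integrable (fun x : ℝ => x ^ p) ν) : ConcaveOn ℝ Set.univ (tau ν) := by
  rw [tau_eq_cgf hpos]
  have h1 : ConvexOn ℝ Set.univ fun p => (Real.log 2)⁻¹ • cgf Real.log ν p :=
    (convexOn_cgf_log hpos hmom).smul (by positivity)
  have h2 := ((concaveOn_id (𝕜 := ℝ) (convex_univ (E := ℝ))).sub h1).add_const (-1)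
  have e : (fun p => p - cgf Real.log ν p / Real.log 2 - 1) =
      (id - fun p => (Real.log 2)⁻¹ • cgf Real.log ν p) + fun _ => -1 := by
    funext p
    change p - _ / _ - 1 = p - (Real.log 2)⁻¹ * cgf Real.log ν p + -1
    ring
  rw [e]
  exact h2

theorem tau_zero [IsProbabilityMeasure ν] : tau ν 0 = -1 := by simp [tau]

theorem tau_one (hmean : ∫ x, x ∂ν = 1) : tau ν 1 = 0 := by simp [tau, hmean]

/-- `τ'(1) = 1 - E[W log₂ W]`. -/
theorem deriv_tau_one_pos [IsProbabilityMeasure ν] (hmean : ∫ x, x ∂ν = 1) (hentropy : ∫ x, x * Real.logb 2 x ∂ν < 1)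
    (hpos : ∀ᵐ x ∂ν, 0 < x) (hmom : ∀ p : ℝ, Integrable (fun x : ℝ => x ^ p) ν) :
    0 < deriv (tau ν) 1 := by
  have hint : (1 : ℝ) ∈ interior (integrableExpSet Real.log ν) := by
    rw [integrableExpSet_log hpos hmom, interior_univ]; trivial
  have hm : mgf Real.log ν 1 = 1 := by
    rw [← integral_rpow_eq_mgf hpos]; simpa using hmean
  have hd : HasDerivAt (cgf Real.log ν) (∫ x, x * Real.log x ∂ν) 1 := by
    have h1 := (analyticAt_cgf hint).differentiableAt.hasDerivAt
    rw [deriv_cgf hint, hm, div_one] at h1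
    have h2 : ∫ x, x * Real.log x ∂ν = ∫ x, Real.log x * Real.exp (1 * Real.log x) ∂ν := by
      refine integral_congr_ae ?_
      filter_upwards [hpos] with x hx
      rw [one_mul, Real.exp_log hx, mul_comm]
    rwa [h2]
  have h2 : HasDerivAt (tau ν) (1 - (∫ x, x * Real.log x ∂ν) / Real.log 2) 1 := by
    rw [tau_eq_cgf hpos]
    exact ((hasDerivAt_id 1).sub (hd.div_const _)).sub_const 1
  rw [h2.deriv, ← integral_div (Real.log 2)]
  have h3 : ∫ x, x * Real.log x / Real.log 2 ∂ν = ∫ x, x * Real.logb 2 x ∂ν := by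
    simp only [Real.logb, mul_div_assoc]
  rw [h3]
  linarith

/-- At a finite `p_χ^+`, the tangent to `τ` meets the vertical axis at `χ`. -/
theorem pPlus_spec [IsProbabilityMeasure ν] {χ : ℝ} (hmean : ∫ x, x ∂ν = 1) (hentropy : ∫ x, x * Real.logb 2 x ∂ν < 1)
    (hpos : ∀ᵐ x ∂ν, 0 < x) (hmom : ∀ p : ℝ, Integrable (fun x : ℝ => x ^ p) ν) (hχ : 0 < χ)
    (h : pPlus ν χ < ⊤) :
    1 < (pPlus ν χ).toReal ∧
      (pPlus ν χ).toReal * deriv (tau ν) (pPlus ν χ).toReal - tau ν (pPlus ν χ).toReal = -χ ∧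
      ∀ p, 1 ≤ p → p < (pPlus ν χ).toReal → -χ < p * deriv (tau ν) p - tau ν p := by
  set g : ℝ → ℝ := fun p => p * deriv (tau ν) p - tau ν p with hg
  have hgc : Continuous g := continuous_tangent hpos hmom
  set A : Set ℝ := {p | 1 ≤ p ∧ g p ≤ -χ} with hA
  have hAne : A.Nonempty := by
    by_contra hcon
    rw [Set.not_nonempty_iff_eq_empty] at hcon
    have : pPlus ν χ = ⊤ := by
      change sInf ((fun p : ℝ => (p : EReal)) '' A) = ⊤
      rw [hcon, Set.image_empty, sInf_empty]
    exact h.ne this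
  have hAcl : IsClosed A := isClosed_Ici.inter (isClosed_le hgc continuous_const)
  have hAbdd : BddBelow A := ⟨1, fun p hp => hp.1⟩
  have hmem := hAcl.csInf_mem hAne hAbdd
  have hleast : IsLeast ((fun p : ℝ => (p : EReal)) '' A) ((sInf A : ℝ) : EReal) :=
    ⟨⟨_, hmem, rfl⟩, by
      rintro _ ⟨p, hp, rfl⟩
      exact EReal.coe_le_coe_iff.2 (csInf_le hAbdd hp)⟩
  have heq : (pPlus ν χ).toReal = sInf A := by
    have : pPlus ν χ = ((sInf A : ℝ) : EReal) := hleast.isGLB.csInf_eq hleast.nonempty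
    rw [this, EReal.toReal_coe]
  rw [heq]
  set a := sInf A
  have hbelow : ∀ p, 1 ≤ p → p < a → -χ < g p := fun p hp1 hpa => by
    by_contra hcon
    exact absurd (csInf_le hAbdd ⟨hp1, not_lt.1 hcon⟩) (not_le.2 hpa)
  -- Here `g 1 = τ'(1) > 0`, so the infimum, attained because `A` is closed, exceeds 1. Equality
  -- there follows by continuity from the left.
  have hg1 : -χ < g 1 := by
    have := deriv_tau_one_pos hmean hentropy hpos hmom
    simp only [hg, tau_one hmean]
    linarith
  have ha1 : 1 < a := lt_of_le_of_ne hmem.1 fun h => by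
    have := hmem.2
    rw [← h] at this
    linarith
  refine ⟨ha1, le_antisymm hmem.2 ?_, hbelow⟩
  refine ge_of_tendsto (x := 𝓝[<] a) (hgc.continuousAt.tendsto.mono_left nhdsWithin_le_nhds) ?_
  filter_upwards [Ioo_mem_nhdsLT ha1] with p hp
  exact (hbelow p hp.1.le hp.2).le

/-- At a finite `p_χ^-`, the tangent to `τ` meets the vertical axis at `χ`. -/
theorem pMinus_spec [IsProbabilityMeasure ν] {χ : ℝ}
    (hpos : ∀ᵐ x ∂ν, 0 < x) (hmom : ∀ p : ℝ, Integrable (fun x : ℝ => x ^ p) ν) (hχ : 0 < χ)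
    (h : ⊥ < pMinus ν χ) :
    (pMinus ν χ).toReal < 0 ∧
      (pMinus ν χ).toReal * deriv (tau ν) (pMinus ν χ).toReal - tau ν (pMinus ν χ).toReal = -χ ∧
      ∀ p, p ≤ 0 → (pMinus ν χ).toReal < p → -χ < p * deriv (tau ν) p - tau ν p := by
  set g : ℝ → ℝ := fun p => p * deriv (tau ν) p - tau ν p with hg
  have hgc : Continuous g := continuous_tangent hpos hmom
  set A : Set ℝ := {p | p ≤ 0 ∧ g p ≤ -χ} with hA
  have hAne : A.Nonempty := by
    by_contra hcon
    rw [Set.not_nonempty_iff_eq_empty] at hcon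
    have : pMinus ν χ = ⊥ := by
      change sSup ((fun p : ℝ => (p : EReal)) '' A) = ⊥
      rw [hcon, Set.image_empty, sSup_empty]
    exact h.ne' this
  have hAcl : IsClosed A := isClosed_Iic.inter (isClosed_le hgc continuous_const)
  have hAbdd : BddAbove A := ⟨0, fun p hp => hp.1⟩
  have hmem := hAcl.csSup_mem hAne hAbdd
  have hgreatest : IsGreatest ((fun p : ℝ => (p : EReal)) '' A) ((sSup A : ℝ) : EReal) :=
    ⟨⟨_, hmem, rfl⟩, by
      rintro _ ⟨p, hp, rfl⟩
      exact EReal.coe_le_coe_iff.2 (le_csSup hAbdd hp)⟩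
  have heq : (pMinus ν χ).toReal = sSup A := by
    have : pMinus ν χ = ((sSup A : ℝ) : EReal) := hgreatest.isLUB.csSup_eq hgreatest.nonempty
    rw [this, EReal.toReal_coe]
  rw [heq]
  set a := sSup A
  have habove : ∀ p, p ≤ 0 → a < p → -χ < g p := fun p hp1 hpa => by
    by_contra hcon
    exact absurd (le_csSup hAbdd ⟨hp1, not_lt.1 hcon⟩) (not_le.2 hpa)
  -- Here `g 0 = -τ(0) = 1`.
  have hg0 : -χ < g 0 := by
    simp only [hg, tau_zero]
    linarith
  have ha0 : a < 0 := lt_of_le_of_ne hmem.1 fun h => by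
    have := hmem.2
    rw [h] at this
    linarith
  refine ⟨ha0, le_antisymm hmem.2 ?_, habove⟩
  refine ge_of_tendsto (x := 𝓝[>] a) (hgc.continuousAt.tendsto.mono_left nhdsWithin_le_nhds) ?_
  filter_upwards [Ioo_mem_nhdsGT ha0] with p hp
  exact (habove p hp.2.le hp.1).le

theorem tau_pos_near_one [IsProbabilityMeasure ν] (hmean : ∫ x, x ∂ν = 1) (hentropy : ∫ x, x * Real.logb 2 x ∂ν < 1)
    (hpos : ∀ᵐ x ∂ν, 0 < x) (hmom : ∀ p : ℝ, Integrable (fun x : ℝ => x ^ p) ν) {b : ℝ}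
    (hb : 1 < b) : ∃ p, 1 < p ∧ p < b ∧ 0 < tau ν p := by
  have hd := deriv_tau_one_pos hmean hentropy hpos hmom
  have h1 := (differentiable_tau hpos hmom 1).hasDerivAt.tendsto_slope
  have h2 : ∀ᶠ p in 𝓝[>] (1 : ℝ), 0 < slope (tau ν) 1 p :=
    (h1.mono_left (nhdsWithin_mono _ fun p hp => (ne_of_gt hp))).eventually (lt_mem_nhds hd)
  obtain ⟨p, hp1, hp2, hp3⟩ := (h2.and (Ioo_mem_nhdsGT hb)).exists
  refine ⟨p, hp2, hp3, ?_⟩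
  rw [slope_def_field, tau_one hmean, sub_zero] at hp1
  exact (div_pos_iff_of_pos_right (by linarith)).1 hp1

/-- Concavity between a point near 1, where `τ > 0`, and `b`, where `τ ≥ 0`. This is where the
condition `τ(p_χ^+) ≥ 0` enters: it makes the positive moments finite. -/
theorem tau_pos [IsProbabilityMeasure ν] (hmean : ∫ x, x ∂ν = 1) (hentropy : ∫ x, x * Real.logb 2 x ∂ν < 1)
    (hpos : ∀ᵐ x ∂ν, 0 < x) (hmom : ∀ p : ℝ, Integrable (fun x : ℝ => x ^ p) ν) {b p : ℝ}
    (hb : 0 ≤ tau ν b) (hp : 1 < p) (hpb : p < b) : 0 < tau ν p := by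
  obtain ⟨c, hc1, hcp, hc⟩ := tau_pos_near_one hmean hentropy hpos hmom hp
  have hcb : 0 < b - c := by linarith
  have h := (concaveOn_tau hpos hmom).2 (Set.mem_univ c) (Set.mem_univ b)
    (show 0 ≤ (b - p) / (b - c) from div_nonneg (by linarith) hcb.le)
    (show 0 ≤ (p - c) / (b - c) from div_nonneg (by linarith) hcb.le) (by field_simp; ring)
  have e : ((b - p) / (b - c)) • c + ((p - c) / (b - c)) • b = p := by
    simp only [smul_eq_mul]; field_simp; ring
  rw [e] at h
  refine lt_of_lt_of_le ?_ h
  simp only [smul_eq_mul]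
  have h1 : 0 < (b - p) / (b - c) * tau ν c := mul_pos (div_pos (by linarith) hcb) hc
  have h2 : 0 ≤ (p - c) / (b - c) * tau ν b := mul_nonneg (div_nonneg (by linarith) hcb.le) hb
  linarith

/-- The exponent of the large deviations of the moments of order close to one. -/
theorem eventually_moment_gap {χ p : ℝ} (hpos : ∀ᵐ x ∂ν, 0 < x)
    (hmom : ∀ p : ℝ, Integrable (fun x : ℝ => x ^ p) ν)
    (hp : -χ < p * deriv (tau ν) p - tau ν p) :
    ∀ᶠ q in 𝓝[>] (1 : ℝ), -tau ν (p * q) < χ * (q - 1) - q * tau ν p := by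
  -- The function vanishes at `q = 1` and has derivative `χ - τ(p) + pτ'(p) > 0` there. The
  -- inequality obtained is the exponent form of `r' < B^(q-1) r^q` in
  -- `ae_eventually_le_sum_partition`.
  have hd : HasDerivAt (fun q => χ * (q - 1) - q * tau ν p + tau ν (p * q))
      (χ * 1 - 1 * tau ν p + deriv (tau ν) (p * 1) * (p * 1)) 1 := by
    refine ((((hasDerivAt_id (1 : ℝ)).sub_const 1).const_mul χ).sub
      ((hasDerivAt_id (1 : ℝ)).mul_const _)).add ?_
    exact HasDerivAt.comp (1 : ℝ) (differentiable_tau hpos hmom (p * 1)).hasDerivAt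
      ((hasDerivAt_id (1 : ℝ)).const_mul p)
  have h1 := hd.tendsto_slope
  have h2 : ∀ᶠ q in 𝓝[>] (1 : ℝ),
      0 < slope (fun q => χ * (q - 1) - q * tau ν p + tau ν (p * q)) 1 q :=
    (h1.mono_left (nhdsWithin_mono _ fun p hp => (ne_of_gt hp))).eventually
      (lt_mem_nhds (by rw [mul_one p]; linarith))
  filter_upwards [h2, self_mem_nhdsWithin] with q hq1 hq2
  rw [slope_def_field] at hq1
  have hq2' : 1 < q := hq2
  have := (div_pos_iff_of_pos_right (by linarith)).1 hq1
  simp only [mul_one] at this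
  linarith

end Tau

section Law

variable {ν : Measure ℝ}

theorem mom_map_ofReal (hpos : ∀ᵐ x ∂ν, 0 < x)
    (hmom : ∀ p : ℝ, Integrable (fun x : ℝ => x ^ p) ν) (p : ℝ) :
    mom (ν.map ENNReal.ofReal) p = ENNReal.ofReal (∫ x, x ^ p ∂ν) := by
  rw [mom, lintegral_map (by fun_prop) (by fun_prop),
    ofReal_integral_eq_lintegral_ofReal (hmom p) (hpos.mono fun x hx => by positivity)]
  refine lintegral_congr_ae (hpos.mono fun x hx => ?_)
  exact ENNReal.ofReal_rpow_of_pos hx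

theorem integral_rpow_pos [IsProbabilityMeasure ν] (hpos : ∀ᵐ x ∂ν, 0 < x)
    (hmom : ∀ p : ℝ, Integrable (fun x : ℝ => x ^ p) ν) (p : ℝ) : 0 < ∫ x, x ^ p ∂ν := by
  rw [integral_rpow_eq_mgf hpos]
  exact mgf_pos ((hmom p).congr (ae_rpow_eq_exp hpos p))

theorem rate_map_ofReal [IsProbabilityMeasure ν] (hpos : ∀ᵐ x ∂ν, 0 < x)
    (hmom : ∀ p : ℝ, Integrable (fun x : ℝ => x ^ p) ν) (p : ℝ) :
    rate (ν.map ENNReal.ofReal) p = ENNReal.ofReal (2 ^ (-tau ν p)) := by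
  have h0 := integral_rpow_pos hpos hmom p
  have h1 : (2 : ℝ) ^ (-tau ν p) = 2 * (2 ^ (-p) * ∫ x, x ^ p ∂ν) := by
    have : -tau ν p = 1 + (-p + Real.logb 2 (∫ x, x ^ p ∂ν)) := by rw [tau]; ring
    rw [this, Real.rpow_add (by norm_num), Real.rpow_add (by norm_num), Real.rpow_one,
      Real.rpow_logb (by norm_num) (by norm_num) h0]
  rw [rate, mom_map_ofReal hpos hmom, h1, ENNReal.ofReal_mul (by norm_num),
    ENNReal.ofReal_mul (by positivity), ← ENNReal.ofReal_rpow_of_pos (by norm_num)]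
  simp

theorem mean_map_ofReal (hmean : ∫ x, x ∂ν = 1) (hpos : ∀ᵐ x ∂ν, 0 < x)
    (hmom : ∀ p : ℝ, Integrable (fun x : ℝ => x ^ p) ν) :
    ∫⁻ x, x ∂(ν.map ENNReal.ofReal) = 1 := by
  have := mom_map_ofReal hpos hmom 1
  simpa [mom, hmean] using this

theorem pos_map_ofReal (hpos : ∀ᵐ x ∂ν, 0 < x) :
    ∀ᵐ x ∂(ν.map ENNReal.ofReal), x ≠ 0 ∧ x ≠ ⊤ := by
  rw [ae_map_iff (by fun_prop)]
  · exact hpos.mono fun x hx => ⟨by simpa using hx, by simp⟩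
  · exact (measurableSet_singleton 0).compl.inter (measurableSet_singleton ⊤).compl

end Law

end
end MixedCascade

/-! ### From sums of powers to the maximum. -/

namespace MixedCascade
section
open scoped ENNReal NNReal

theorem exists_rat_of_eventually_nhdsLT {a : ℝ} {p : ℝ → Prop} (h : ∀ᶠ x in 𝓝[<] a, p x) :
    ∃ q : ℚ, (q : ℝ) < a ∧ p q := by
  obtain ⟨l, hl, hsub⟩ := (mem_nhdsLT_iff_exists_Ioo_subset' (sub_one_lt a)).1 h
  obtain ⟨q, hq1, hq2⟩ := exists_rat_btwn (show l < a from hl)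
  exact ⟨q, hq2, hsub ⟨hq1, hq2⟩⟩

theorem eventually_add_div_lt (a b : ℝ) {c d : ℝ} (h : c < d) (hb : 0 < b) :
    ∀ᶠ j : ℕ in atTop, (a + j * (c * b)) / b / j < d := by
  have h1 : Tendsto (fun j : ℕ => a / b / j + c) atTop (𝓝 (0 + c)) :=
    (tendsto_const_div_atTop_nhds_zero_nat (a / b)).add_const c
  rw [zero_add] at h1
  filter_upwards [h1.eventually (gt_mem_nhds h), eventually_gt_atTop 0] with j hj hj0
  have hj0' : (0 : ℝ) < j := by exact_mod_cast hj0
  have e : (a + j * (c * b)) / b / j = a / b / j + c := by field_simp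
  rw [e]
  exact hj

/-- The exponential rate of a maximum is the slope of the exponents of the sums of powers. -/
theorem tendsto_logb_sup_div {N : ℕ → ℕ} (hN : ∀ j, 0 < N j) {A : ∀ j, Fin (N j) → ℝ}
    (hA : ∀ j k, 0 < A j k) {f : ℝ → ℝ} {q₀ q₁ d : ℝ} (hq₀ : 0 ≤ q₀) (hq : q₀ < q₁)
    (hf : HasDerivAt f d q₁) (hfd : q₁ * d = f q₁)
    (hup : ∀ q : ℚ, (q : ℝ) ∈ Set.Ioo q₀ q₁ → ∀ n : ℕ, ∃ C : ℝ, 0 < C ∧ ∀ᶠ j in atTop,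
      ∑ k, A j k ^ (q : ℝ) ≤ C * ((2 : ℝ) ^ (f q + 1 / ((n : ℝ) + 1))) ^ j)
    (hlow : ∀ q : ℚ, (q : ℝ) ∈ Set.Ioo q₀ q₁ → ∃ c : ℝ, 0 < c ∧ ∀ᶠ j in atTop,
      c * ((2 : ℝ) ^ f q) ^ j ≤ ∑ k, A j k ^ (q : ℝ)) :
    Tendsto (fun j : ℕ => Real.logb 2 (⨆ k, A j k) / j) atTop (𝓝 d) := by
  have hbdd : ∀ j, BddAbove (Set.range (A j)) := fun j => (Set.finite_range _).bddAbove
  have hle : ∀ j k, A j k ≤ ⨆ k, A j k := fun j k => le_ciSup (hbdd j) k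
  have hS0 : ∀ j, 0 < ⨆ k, A j k := fun j => (hA j ⟨0, hN j⟩).trans_le (hle j _)
  have hlogpow : ∀ (x : ℝ) (j : ℕ), Real.logb 2 (((2 : ℝ) ^ x) ^ j) = j * x := fun x j => by
    rw [Real.logb_pow, Real.logb_rpow (by norm_num) (by norm_num)]
  have hlogle : ∀ {x y : ℝ}, 0 < x → x ≤ y → Real.logb 2 x ≤ Real.logb 2 y := fun hx h =>
    Real.logb_le_logb_of_le (by norm_num) hx h
  have hq₁ : 0 < q₁ := by linarith
  refine tendsto_order.2 ⟨fun a ha => ?_, fun a ha => ?_⟩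
  -- Lower bound: `∑ A^q ≤ s^(q-q') ∑ A^q'` gives the rate `(f q - f q') / (q - q')`. The point `q'`
  -- is chosen first, so that the chord to `q₁` has slope above `a`.
  · have hslope : Tendsto (slope f q₁) (𝓝[<] q₁) (𝓝 d) :=
      hf.tendsto_slope.mono_left (nhdsWithin_mono _ fun x hx => ne_of_lt hx)
    obtain ⟨q', hq'1, hq'2, hq'3⟩ := exists_rat_of_eventually_nhdsLT
      ((hslope.eventually (lt_mem_nhds ha)).and (Ioo_mem_nhdsLT hq))
    rw [slope_comm, slope_def_field] at hq'2
    have hq'0 : q₀ < (q' : ℝ) := hq'3.1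
    have hcont : Tendsto (fun q => (f q - f q') / (q - q')) (𝓝[<] q₁)
        (𝓝 ((f q₁ - f q') / (q₁ - q'))) :=
      (((hf.continuousAt.tendsto.mono_left nhdsWithin_le_nhds).sub_const _)).div
        ((tendsto_id.mono_left nhdsWithin_le_nhds).sub_const _) (by linarith)
    -- The sums are controlled only strictly below `q₁`, so the right end of the chord is moved
    -- slightly to the left.
    obtain ⟨q, hq1, hq2, hq3⟩ := exists_rat_of_eventually_nhdsLT
      ((hcont.eventually (lt_mem_nhds hq'2)).and (Ioo_mem_nhdsLT hq'1))
    have hqq : (0 : ℝ) < q - q' := by linarith [hq3.1]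
    rw [lt_div_iff₀ hqq] at hq2
    obtain ⟨n, hn⟩ := exists_nat_one_div_lt (show 0 < f q - f q' - a * (q - q') by linarith)
    obtain ⟨C, hC, hCj⟩ := hup q' ⟨hq'0, hq'1⟩ n
    obtain ⟨c, hc, hcj⟩ := hlow q ⟨hq'0.trans hq3.1, hq1⟩
    set e := f q - (f q' + 1 / ((n : ℝ) + 1)) with he
    have hev := eventually_add_div_lt (-(Real.logb 2 c - Real.logb 2 C)) (q - q')
      (c := -(e / (q - q'))) (d := -a)
      (neg_lt_neg (by rw [lt_div_iff₀ hqq]; linarith)) hqq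
    filter_upwards [hCj, hcj, hev, eventually_gt_atTop 0] with j h1 h2 h3 hj0
    have hj0' : (0 : ℝ) < j := by exact_mod_cast hj0
    set s := ⨆ k, A j k
    have h4 : ∑ k, A j k ^ (q : ℝ) ≤ s ^ ((q : ℝ) - q') * ∑ k, A j k ^ (q' : ℝ) := by
      rw [Finset.mul_sum]
      refine Finset.sum_le_sum fun k _ => ?_
      calc A j k ^ (q : ℝ) = A j k ^ ((q : ℝ) - q') * A j k ^ (q' : ℝ) := by
            rw [← Real.rpow_add (hA j k)]; ring_nf
        _ ≤ _ := mul_le_mul_of_nonneg_right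
            (Real.rpow_le_rpow (hA j k).le (hle j k) hqq.le) (Real.rpow_nonneg (hA j k).le _)
    have h5 : c * ((2 : ℝ) ^ f q) ^ j ≤
        s ^ ((q : ℝ) - q') * (C * ((2 : ℝ) ^ (f q' + 1 / ((n : ℝ) + 1))) ^ j) :=
      h2.trans (h4.trans (mul_le_mul_of_nonneg_left h1 (Real.rpow_nonneg (hS0 j).le _)))
    have h6 := hlogle (by positivity) h5
    have hs : s ^ ((q : ℝ) - q') ≠ 0 := (Real.rpow_pos_of_pos (hS0 j) _).ne'
    rw [Real.logb_mul hc.ne' (by positivity), Real.logb_mul hs (by positivity),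
      Real.logb_mul hC.ne' (by positivity), hlogpow, hlogpow,
      Real.logb_rpow_eq_mul_logb_of_pos (hS0 j)] at h6
    have h7 : (-(Real.logb 2 c - Real.logb 2 C) + j * (-(e / (q - q')) * (q - q'))) / (q - q') / j =
        -((Real.logb 2 c - Real.logb 2 C + j * e) / (q - q') / j) := by
      field_simp
      ring
    rw [h7] at h3
    refine (lt_of_neg_lt_neg h3).trans_le ?_
    refine div_le_div_of_nonneg_right ?_ hj0'.le
    rw [div_le_iff₀ hqq, he]
    linarith
  -- Upper bound: `s^q ≤ ∑ A^q` gives the rate `f q / q`, whose limit at `q₁` is `d` by the tangency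
  -- `q₁ d = f q₁`.
  · have hcont : Tendsto (fun q => f q / q) (𝓝[<] q₁) (𝓝 (f q₁ / q₁)) :=
      (hf.continuousAt.tendsto.mono_left nhdsWithin_le_nhds).div
        (tendsto_id.mono_left nhdsWithin_le_nhds) hq₁.ne'
    have hd : f q₁ / q₁ = d := by rw [← hfd]; field_simp
    rw [hd] at hcont
    obtain ⟨q, hq1, hq2, hq3⟩ := exists_rat_of_eventually_nhdsLT
      ((hcont.eventually (gt_mem_nhds ha)).and (Ioo_mem_nhdsLT hq))
    have hq0 : (0 : ℝ) < q := hq₀.trans_lt hq3.1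
    rw [div_lt_iff₀ hq0] at hq2
    obtain ⟨n, hn⟩ := exists_nat_one_div_lt (show 0 < a * q - f q by linarith)
    obtain ⟨C, hC, hCj⟩ := hup q ⟨hq3.1, hq1⟩ n
    set e := f q + 1 / ((n : ℝ) + 1) with he
    have hev := eventually_add_div_lt (Real.logb 2 C) q (c := e / q) (d := a)
      (by rw [div_lt_iff₀ hq0]; linarith) hq0
    filter_upwards [hCj, hev, eventually_gt_atTop 0] with j h1 h3 hj0
    have hj0' : (0 : ℝ) < j := by exact_mod_cast hj0
    set s := ⨆ k, A j k with hs
    have h4 : s ^ (q : ℝ) ≤ ∑ k, A j k ^ (q : ℝ) := by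
      have : Nonempty (Fin (N j)) := ⟨⟨0, hN j⟩⟩
      obtain ⟨k, hk⟩ := exists_eq_ciSup_of_finite (f := A j)
      rw [hs, ← hk]
      exact Finset.single_le_sum (f := fun k => A j k ^ (q : ℝ))
        (fun k _ => Real.rpow_nonneg (hA j k).le _) (Finset.mem_univ k)
    have h6 := hlogle (Real.rpow_pos_of_pos (hS0 j) _) (h4.trans h1)
    rw [Real.logb_mul hC.ne' (by positivity), hlogpow,
      Real.logb_rpow_eq_mul_logb_of_pos (hS0 j)] at h6
    refine lt_of_le_of_lt ?_ h3
    refine div_le_div_of_nonneg_right ?_ hj0'.le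
    rw [le_div_iff₀ hq0, div_mul_cancel₀ _ hq0.ne']
    linarith

end
end MixedCascade

/-! ### Independent subtrees and the sums of powers of the cell masses. -/

namespace MixedCascade
section
open scoped ENNReal NNReal

section Independence

variable {Ω ι κ E : Type*} [MeasurableSpace Ω] [MeasurableSpace E] {P : Measure Ω}
  {μ : Measure E} [IsProbabilityMeasure μ] {X : ι → κ → Ω → E}

theorem map_curry_eq_infinitePi (hX : ∀ i k, Measurable (X i k)) (hlaw : ∀ i k, P.map (X i k) = μ)
    (h : iIndepFun (fun p : ι × κ => X p.1 p.2) P) :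
    P.map (fun ω i k => X i k ω) =
      Measure.infinitePi fun _ : ι => Measure.infinitePi fun _ : κ => μ := by
  have h1 := h.map_fun_eq_infinitePi_map fun p : ι × κ => hX p.1 p.2
  simp_rw [hlaw] at h1
  rw [← Measure.infinitePi_map_curry, ← h1, Measure.map_map (by fun_prop) (by fun_prop)]
  rfl

theorem map_family_eq_infinitePi (hX : ∀ i k, Measurable (X i k))
    (hlaw : ∀ i k, P.map (X i k) = μ) (h : iIndepFun (fun p : ι × κ => X p.1 p.2) P) (i : ι) :
    P.map (fun ω k => X i k ω) = Measure.infinitePi fun _ : κ => μ := by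
  rw [← Measure.infinitePi_map_eval (fun _ : ι => Measure.infinitePi fun _ : κ => μ) i,
    ← map_curry_eq_infinitePi hX hlaw h, Measure.map_map (by fun_prop) (by fun_prop)]
  rfl

theorem iIndepFun_family [IsProbabilityMeasure P] (hX : ∀ i k, Measurable (X i k))
    (hlaw : ∀ i k, P.map (X i k) = μ) (h : iIndepFun (fun p : ι × κ => X p.1 p.2) P) :
    iIndepFun (fun i ω k => X i k ω) P := by
  rw [iIndepFun_iff_map_fun_eq_infinitePi_map (by fun_prop), map_curry_eq_infinitePi hX hlaw h]
  simp_rw [map_family_eq_infinitePi hX hlaw h]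

end Independence

section TreeLaw

variable {ν : Measure ℝ≥0∞} [IsProbabilityMeasure ν]

theorem ae_hasLimits (hmean : ∫⁻ x, x ∂ν = 1) (hpos : ∀ᵐ x ∂ν, x ≠ 0 ∧ x ≠ ⊤)
    (hne : ∀ᵐ u ∂treeLaw ν, totalMass u ≠ 0) : ∀ᵐ u ∂treeLaw ν, HasLimits u := by
  have h1 : ∀ᵐ u ∂treeLaw ν, (u [] ≠ 0 ∧ u [] ≠ ⊤) ∧
      (Tendsto (fun n => genMass n u) atTop (𝓝 (totalMass u)) ∧ totalMass u ≠ ⊤) ∧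
      totalMass u ≠ 0 := by
    filter_upwards [(measurePreserving_root ν).quasiMeasurePreserving.ae hpos,
      ae_tendsto_genMass ν hmean, hne] with u h1 h2 h3 using ⟨h1, h2, h3⟩
  have h2 := ae_all_iff.2 fun s => (measurePreserving_subtree ν s).quasiMeasurePreserving.ae h1
  filter_upwards [h2] with u hu
  refine ⟨fun s => ?_, fun s => (hu s).2.1.1, fun s => ⟨(hu s).2.2, (hu s).2.1.2⟩⟩
  simpa [subtree] using (hu s).1

/-- The largest leaf to the power `p` is at most the partition function, whose mean decays like
`rate ν p ^ j`. -/
theorem ae_hasSmallLeaves (hpos : ∀ᵐ x ∂ν, x ≠ 0 ∧ x ≠ ⊤) {p : ℝ} (hp : 0 < p)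
    (hrate : rate ν p < 1) (hfin : ∫⁻ u, totalMass u ^ p ∂treeLaw ν ≠ ⊤) :
    ∀ᵐ u ∂treeLaw ν, HasSmallLeaves u := by
  have h := ae_tendsto_zero_of_lintegral_le (treeLaw ν) (Z := fun j u => partition p j u)
    (measurable_partition p) hfin hrate fun j => by
      rw [lintegral_partition ν hpos, mul_comm]
  filter_upwards [h] with u hu ε hε
  filter_upwards [hu.eventually (ge_mem_nhds (ENNReal.rpow_pos_of_nonneg hε hp.le))] with j hj k hk
  refine (ENNReal.rpow_le_rpow_iff hp).1 (le_trans ?_ hj)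
  exact Finset.single_le_sum (f := fun k => leaf totalMass j u k ^ p) (fun _ _ => zero_le)
    (Finset.mem_range.2 hk)

end TreeLaw

section Cells

theorem sum_range_mul {M : Type*} [AddCommMonoid M] (n m : ℕ) (f : ℕ → M) :
    ∑ k ∈ Finset.range (n * m), f k =
      ∑ i ∈ Finset.range n, ∑ k ∈ Finset.range m, f (i * m + k) := by
  induction n with
  | zero => simp
  | succ n ih => rw [Nat.succ_mul, Finset.sum_range_add, ih, Finset.sum_range_succ]

theorem partition_graft_one (p : ℝ) (j : ℕ) (a b : Tree) :
    partition p (j + 1) (graft 1 a b) = 2 ^ (-p) * (partition p j a + partition p j b) := by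
  rw [partition_succ p j (by simp) (by simp), graft_nil, ENNReal.one_rpow, mul_one,
    child_false_graft, child_true_graft]

theorem HasLimits.partition_ne_top {u : Tree} (h : HasLimits u) (p : ℝ) (j : ℕ) :
    partition p j u ≠ ⊤ :=
  ENNReal.sum_ne_top.2 fun k _ =>
    ENNReal.rpow_ne_top_of_ne_zero (h.leaf_ne j k).1 (h.leaf_ne j k).2

/-- The subtree at the child `i.2` of the root in the `i.1`-th tree. -/
noncomputable def forest (w : ℕ → List Bool → ℝ) (i : ℕ × Bool) : Tree :=
  fun s => ENNReal.ofReal (w i.1 (i.2 :: s))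

theorem weightTree_eq_graft (w : ℕ → List Bool → ℝ) (m : ℕ) :
    weightTree (w m) = graft 1 (forest w (m, false)) (forest w (m, true)) := rfl

/-- The roots of the subtrees of generation one observed at generation `j + 1`. -/
noncomputable def observed (χ : ℝ) (j : ℕ) : Finset (ℕ × Bool) :=
  Finset.range ⌊((2 : ℝ) ^ (j + 1)) ^ χ⌋₊ ×ˢ Finset.univ

variable {T χ : ℝ} {w : ℕ → List Bool → ℝ}

theorem cellMass_pos (hT : 0 < T) (hw : ∀ m s, s ≠ [] → 0 ≤ w m s)
    (h : ∀ i, HasLimits (forest w i)) (hs : ∀ i, HasSmallLeaves (forest w i)) (j k : ℕ) :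
    0 < cellMass T w j k := by
  have hl : ∀ m, HasLimits (weightTree (w m)) := fun m => (h (m, false)).graft_one (h (m, true))
  have e := cellMass_eq hT hw hl (fun m => (hs (m, false)).graft_one (hs (m, true))) j (k / 2 ^ j)
    (Nat.mod_lt k (by positivity))
  rw [mul_comm, Nat.div_add_mod] at e
  rw [e]
  have := (hl (k / 2 ^ j)).leaf_ne j (k % 2 ^ j)
  exact mul_pos hT (ENNReal.toReal_pos this.1 this.2)

/-- Generation `j + 1` of each cascade is generation `j` of its two subtrees, the unit root giving
only the factor `2^(-p)`. The sum thus runs over i.i.d. trees, at the cost of an index shift. -/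
theorem sum_cellMass_rpow (hT : 0 < T) (hw : ∀ m s, s ≠ [] → 0 ≤ w m s)
    (h : ∀ i, HasLimits (forest w i)) (hs : ∀ i, HasSmallLeaves (forest w i)) (p : ℝ) (j : ℕ) :
    ∑ k : Fin (sampleSize χ (j + 1)), cellMass T w (j + 1) k ^ p =
      T ^ p * 2 ^ (-p) * (∑ i ∈ observed χ j, partition p j (forest w i)).toReal := by
  have hl : ∀ m, HasLimits (weightTree (w m)) := fun m => (h (m, false)).graft_one (h (m, true))
  have hsl : ∀ m, HasSmallLeaves (weightTree (w m)) := fun m => (hs (m, false)).graft_one (hs (m, true))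
  rw [Fin.sum_univ_eq_sum_range (fun k => cellMass T w (j + 1) k ^ p), sampleSize, sum_range_mul, observed, Finset.sum_product,
    ENNReal.toReal_sum, Finset.mul_sum]
  swap
  · exact fun m _ => ENNReal.sum_ne_top.2 fun b _ => (h _).partition_ne_top p j
  refine Finset.sum_congr rfl fun m _ => ?_
  have h1 : ∀ k ∈ Finset.range (2 ^ (j + 1)), cellMass T w (j + 1) (m * 2 ^ (j + 1) + k) ^ p =
      T ^ p * (leaf totalMass (j + 1) (weightTree (w m)) k ^ p).toReal := fun k hk => by
    rw [cellMass_eq hT hw hl hsl _ _ (Finset.mem_range.1 hk),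
      Real.mul_rpow hT.le ENNReal.toReal_nonneg, ENNReal.toReal_rpow]
  rw [Finset.sum_congr rfl h1, ← Finset.mul_sum, ← ENNReal.toReal_sum]
  swap
  · exact fun k _ => ENNReal.rpow_ne_top_of_ne_zero ((hl m).leaf_ne _ k).1 ((hl m).leaf_ne _ k).2
  change T ^ p * (partition p (j + 1) (weightTree (w m))).toReal = _
  rw [weightTree_eq_graft, partition_graft_one, ENNReal.toReal_mul, Fintype.sum_bool, mul_assoc,
    add_comm, ← ENNReal.toReal_rpow, ENNReal.toReal_ofNat]

theorem sampleSize_pos (hχ : 0 < χ) (j : ℕ) : 0 < sampleSize χ j := by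
  refine Nat.mul_pos (Nat.floor_pos.2 ?_) (by positivity)
  exact Real.one_le_rpow (one_le_pow₀ (by norm_num)) hχ.le

theorem two_pow_rpow (χ : ℝ) (j : ℕ) : ((2 : ℝ) ^ (j + 1)) ^ χ = 2 ^ χ * ((2 : ℝ) ^ χ) ^ j := by
  rw [← Real.rpow_natCast, ← Real.rpow_mul (by norm_num), mul_comm, Real.rpow_mul (by norm_num),
    Real.rpow_natCast, pow_succ']

theorem card_observed_le (j : ℕ) :
    ((observed χ j).card : ℝ) ≤ 2 * 2 ^ χ * ((2 : ℝ) ^ χ) ^ j := by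
  rw [observed, Finset.card_product, Finset.card_range, Finset.card_univ, Fintype.card_bool,
    mul_assoc, ← two_pow_rpow]
  push_cast
  rw [mul_comm]
  exact mul_le_mul_of_nonneg_left (Nat.floor_le (by positivity)) (by norm_num)

/-- The two subtrees per cascade compensate the integer part: `x ≤ 2⌊x⌋` for `x ≥ 1`. -/
theorem le_card_observed (hχ : 0 < χ) (j : ℕ) :
    2 ^ χ * ((2 : ℝ) ^ χ) ^ j ≤ (observed χ j).card := by
  rw [observed, Finset.card_product, Finset.card_range, Finset.card_univ, Fintype.card_bool,
    ← two_pow_rpow]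
  have h1 : (1 : ℝ) ≤ ((2 : ℝ) ^ (j + 1)) ^ χ :=
    Real.one_le_rpow (one_le_pow₀ (by norm_num)) hχ.le
  have h2 := Nat.lt_floor_add_one (((2 : ℝ) ^ (j + 1)) ^ χ)
  have h3 : (1 : ℝ) ≤ ⌊((2 : ℝ) ^ (j + 1)) ^ χ⌋₊ := by exact_mod_cast Nat.floor_pos.2 h1
  push_cast
  linarith

end Cells

end
end MixedCascade

/-! ### Almost sure growth of the sums of powers. -/

namespace MixedCascade
section
open scoped ENNReal NNReal

section Growth

variable {Ω : Type*} [MeasurableSpace Ω] {P : Measure Ω}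
  {ν : Measure ℝ} [IsProbabilityMeasure ν] {U : ℕ × Bool → Ω → Tree} {χ p : ℝ}

instance : IsProbabilityMeasure (ν.map ENNReal.ofReal) :=
  Measure.isProbabilityMeasure_map ENNReal.measurable_ofReal.aemeasurable

theorem ae_sum_observed_le (hpos : ∀ᵐ x ∂ν, 0 < x)
    (hmom : ∀ p : ℝ, Integrable (fun x : ℝ => x ^ p) ν) (hU : ∀ i, Measurable (U i))
    (hlaw : ∀ i, P.map (U i) = treeLaw (ν.map ENNReal.ofReal))
    (hfin : ∫⁻ u, totalMass u ^ p ∂treeLaw (ν.map ENNReal.ofReal) ≠ ⊤) {ε : ℝ} (hε : 0 < ε) :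
    ∀ᵐ ω ∂P, ∀ᶠ j in atTop, ∑ i ∈ observed χ j, partition p j (U i ω) ≤
      ENNReal.ofReal (((2 : ℝ) ^ (χ - tau ν p + ε)) ^ j) := by
  refine ae_eventually_sum_partition_le P (pos_map_ofReal hpos) hU hlaw
    (Real.rpow_pos_of_pos two_pos χ) card_observed_le (Real.rpow_pos_of_pos two_pos (-tau ν p))
    (rate_map_ofReal hpos hmom p) hfin ?_
  rw [← Real.rpow_add two_pos]
  exact Real.rpow_lt_rpow_of_exponent_lt one_lt_two (by linarith)

theorem ae_le_sum_observed [IsProbabilityMeasure P] (hχ : 0 < χ) (hpos : ∀ᵐ x ∂ν, 0 < x)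
    (hmom : ∀ p : ℝ, Integrable (fun x : ℝ => x ^ p) ν) (hU : ∀ i, Measurable (U i))
    (hlaw : ∀ i, P.map (U i) = treeLaw (ν.map ENNReal.ofReal)) (hind : iIndepFun U P)
    (hne : ∀ᵐ u ∂treeLaw (ν.map ENNReal.ofReal), totalMass u ≠ 0 ∧ totalMass u ≠ ⊤)
    (hgap : -χ < p * deriv (tau ν) p - tau ν p)
    (hfin₁ : ∫⁻ u, totalMass u ^ p ∂treeLaw (ν.map ENNReal.ofReal) ≠ ⊤)
    (hfin : ∀ᶠ q in 𝓝[>] (1 : ℝ),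
      ∫⁻ u, totalMass u ^ (p * q) ∂treeLaw (ν.map ENNReal.ofReal) ≠ ⊤) :
    ∃ c : ℝ, 0 < c ∧ ∀ᵐ ω ∂P, ∀ᶠ j in atTop,
      ENNReal.ofReal (c * ((2 : ℝ) ^ (χ - tau ν p)) ^ j) ≤
        ∑ i ∈ observed χ j, partition p j (U i ω) := by
  -- All three requirements on `q` (moment gap, finite moment of order `pq`, `q ≤ 2`) hold just
  -- above 1.
  obtain ⟨q, ⟨hq1, hq2⟩, hq3, hq4⟩ := ((eventually_moment_gap hpos hmom hgap).and hfin).and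
    (Ioc_mem_nhdsGT one_lt_two) |>.exists
  have hm : ∫⁻ u, totalMass u ^ p ∂treeLaw (ν.map ENNReal.ofReal) ≠ 0 := fun h0 => by
    rw [lintegral_eq_zero_iff (by fun_prop)] at h0
    obtain ⟨u, h1, h2⟩ := (h0.and hne).exists
    rcases ENNReal.rpow_eq_zero_iff.1 h1 with h | h
    · exact h2.1 h.1
    · exact h2.2 h.1
  have he := ENNReal.toReal_pos hm hfin₁
  refine ⟨2 ^ χ * (∫⁻ u, totalMass u ^ p ∂treeLaw (ν.map ENNReal.ofReal)).toReal / 2,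
    by positivity, ?_⟩
  have h := ae_eventually_le_sum_partition P (pos_map_ofReal hpos) hU hlaw hind
    (Real.one_lt_rpow one_lt_two hχ) (Real.rpow_pos_of_pos two_pos χ) (le_card_observed hχ)
    (Real.rpow_pos_of_pos two_pos (-tau ν p)) (rate_map_ofReal hpos hmom p) he
    (ENNReal.ofReal_toReal hfin₁).symm hq3 hq4 (Real.rpow_pos_of_pos two_pos (-tau ν (p * q)))
    (rate_map_ofReal hpos hmom (p * q)) hq2 (by
      rw [← Real.rpow_mul zero_le_two, ← Real.rpow_mul zero_le_two, ← Real.rpow_add two_pos]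
      exact Real.rpow_lt_rpow_of_exponent_lt one_lt_two (by linarith))
  rw [← Real.rpow_add two_pos, ← sub_eq_add_neg] at h
  exact h

end Growth

/-- The sums of powers of order `p` of the masses of the cells grow with exponent `χ - τ(p)`. -/
structure HasGrowth (ν : Measure ℝ) (T χ : ℝ) (w : ℕ → List Bool → ℝ) (p : ℝ) : Prop where
  upper : ∀ n : ℕ, ∃ C : ℝ, 0 < C ∧ ∀ᶠ j in atTop,
    ∑ k : Fin (sampleSize χ j), cellMass T w j k ^ p ≤
      C * ((2 : ℝ) ^ (χ - tau ν p + 1 / ((n : ℝ) + 1))) ^ j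
  lower : ∃ c : ℝ, 0 < c ∧ ∀ᶠ j in atTop, c * ((2 : ℝ) ^ (χ - tau ν p)) ^ j ≤
    ∑ k : Fin (sampleSize χ j), cellMass T w j k ^ p

section Shift

variable {S Z : ℕ → ℝ} {a b x : ℝ}

theorem exists_le_of_eventually_succ_le (ha : 0 < a) (hb : 0 < b) (hx : 0 < x)
    (hS : ∀ j, S (j + 1) = a * Z j) (h : ∀ᶠ j in atTop, Z j ≤ b * x ^ j) :
    ∃ C : ℝ, 0 < C ∧ ∀ᶠ j in atTop, S j ≤ C * x ^ j := by
  refine ⟨a * b / x, by positivity, ?_⟩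
  rw [← Filter.map_add_atTop_eq_nat 1, Filter.eventually_map]
  filter_upwards [h] with j hj
  calc S (j + 1) ≤ a * (b * x ^ j) := by rw [hS]; gcongr
    _ = a * b / x * x ^ (j + 1) := by rw [pow_succ]; field_simp

theorem exists_ge_of_eventually_le_succ (ha : 0 < a) (hb : 0 < b) (hx : 0 < x)
    (hS : ∀ j, S (j + 1) = a * Z j) (h : ∀ᶠ j in atTop, b * x ^ j ≤ Z j) :
    ∃ c : ℝ, 0 < c ∧ ∀ᶠ j in atTop, c * x ^ j ≤ S j := by
  refine ⟨a * b / x, by positivity, ?_⟩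
  rw [← Filter.map_add_atTop_eq_nat 1, Filter.eventually_map]
  filter_upwards [h] with j hj
  calc a * b / x * x ^ (j + 1) = a * (b * x ^ j) := by rw [pow_succ]; field_simp
    _ ≤ S (j + 1) := by rw [hS]; gcongr

end Shift

section Main

variable {Ω : Type*} [MeasurableSpace Ω] {P : Measure Ω} [IsProbabilityMeasure P]
  {ν : Measure ℝ} [IsProbabilityMeasure ν] {W : ℕ → List Bool → Ω → ℝ} {T χ p : ℝ}

theorem measurable_forest (hmeas : ∀ m r, r ≠ [] → Measurable (W m r)) (i : ℕ × Bool) :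
    Measurable fun ω => forest (fun m r => W m r ω) i :=
  measurable_pi_iff.2 fun s => (hmeas i.1 (i.2 :: s) (List.cons_ne_nil _ _)).ennreal_ofReal

theorem forest_spec (hmeas : ∀ m r, r ≠ [] → Measurable (W m r))
    (hlaw : ∀ m r, r ≠ [] → P.map (W m r) = ν)
    (hindep : iIndepFun (fun a : ℕ × {r : List Bool // r ≠ []} => W a.1 a.2.1) P) :
    (∀ i, P.map (fun ω => forest (fun m r => W m r ω) i) = treeLaw (ν.map ENNReal.ofReal)) ∧
      iIndepFun (fun i ω => forest (fun m r => W m r ω) i) P := by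
  let X : ℕ × Bool → List Bool → Ω → ℝ≥0∞ := fun i s ω => ENNReal.ofReal (W i.1 (i.2 :: s) ω)
  have hX : ∀ i s, Measurable (X i s) := fun i s =>
    (hmeas i.1 (i.2 :: s) (List.cons_ne_nil _ _)).ennreal_ofReal
  have hl : ∀ i s, P.map (X i s) = ν.map ENNReal.ofReal := fun i s => by
    rw [← hlaw i.1 (i.2 :: s) (List.cons_ne_nil _ _),
      Measure.map_map ENNReal.measurable_ofReal (hmeas _ _ (List.cons_ne_nil _ _))]
    rfl
  -- Distinct subtrees use distinct nonempty words, so the independent weights can be reindexed by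
  -- tree and by word within the tree.
  have hinj : Function.Injective fun a : (ℕ × Bool) × List Bool =>
      ((a.1.1, ⟨a.1.2 :: a.2, List.cons_ne_nil _ _⟩) : ℕ × {r : List Bool // r ≠ []}) := by
    rintro ⟨⟨m, b⟩, s⟩ ⟨⟨m', b'⟩, s'⟩ h
    simp only [Prod.mk.injEq, Subtype.mk.injEq, List.cons.injEq] at h
    simp only [Prod.mk.injEq]
    tauto
  have hi : iIndepFun (fun a : (ℕ × Bool) × List Bool => X a.1 a.2) P :=
    (hindep.precomp hinj).comp (fun _ => ENNReal.ofReal) fun _ => ENNReal.measurable_ofReal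
  exact ⟨map_family_eq_infinitePi hX hl hi, iIndepFun_family hX hl hi⟩

theorem rate_map_lt_one (hpos : ∀ᵐ x ∂ν, 0 < x)
    (hmom : ∀ p : ℝ, Integrable (fun x : ℝ => x ^ p) ν) (hτ : 0 < tau ν p) :
    rate (ν.map ENNReal.ofReal) p < 1 := by
  rw [rate_map_ofReal hpos hmom, ENNReal.ofReal_lt_one]
  exact Real.rpow_lt_one_of_one_lt_of_neg one_lt_two (by linarith)

theorem ae_totalMass_ne (hmean : ∫ x, x ∂ν = 1) (hentropy : ∫ x, x * Real.logb 2 x ∂ν < 1)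
    (hpos : ∀ᵐ x ∂ν, 0 < x) (hmom : ∀ p : ℝ, Integrable (fun x : ℝ => x ^ p) ν) :
    ∀ᵐ u ∂treeLaw (ν.map ENNReal.ofReal), totalMass u ≠ 0 ∧ totalMass u ≠ ⊤ := by
  obtain ⟨p, hp, -, hτ⟩ := tau_pos_near_one hmean hentropy hpos hmom one_lt_two
  have hm := mean_map_ofReal hmean hpos hmom
  filter_upwards [ae_tendsto_genMass _ hm, ae_totalMass_ne_zero _ hm (pos_map_ofReal hpos) hp
    (by rw [mom_map_ofReal hpos hmom]; simp) (rate_map_lt_one hpos hmom hτ)] with u h1 h2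
    using ⟨h2, h1.2⟩

theorem lintegral_totalMass_rpow_ne_top_of_tau_pos (hmean : ∫ x, x ∂ν = 1)
    (hpos : ∀ᵐ x ∂ν, 0 < x) (hmom : ∀ p : ℝ, Integrable (fun x : ℝ => x ^ p) ν) (hp : 1 < p)
    (hτ : 0 < tau ν p) : ∫⁻ u, totalMass u ^ p ∂treeLaw (ν.map ENNReal.ofReal) ≠ ⊤ :=
  lintegral_totalMass_rpow_ne_top _ (mean_map_ofReal hmean hpos hmom) hp
    (by rw [mom_map_ofReal hpos hmom]; simp) (rate_map_lt_one hpos hmom hτ)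

theorem lintegral_totalMass_rpow_ne_top_of_neg (hmean : ∫ x, x ∂ν = 1)
    (hentropy : ∫ x, x * Real.logb 2 x ∂ν < 1) (hpos : ∀ᵐ x ∂ν, 0 < x)
    (hmom : ∀ p : ℝ, Integrable (fun x : ℝ => x ^ p) ν) (hp : p < 0) :
    ∫⁻ u, totalMass u ^ p ∂treeLaw (ν.map ENNReal.ofReal) ≠ ⊤ := by
  have h := lintegral_totalMass_rpow_neg_ne_top _ (mean_map_ofReal hmean hpos hmom)
    (pos_map_ofReal hpos) (neg_pos.2 hp) (by rw [mom_map_ofReal hpos hmom]; simp)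
    ((ae_totalMass_ne hmean hentropy hpos hmom).mono fun u hu => hu.1)
  rwa [neg_neg] at h

theorem ae_regular (hmean : ∫ x, x ∂ν = 1) (hentropy : ∫ x, x * Real.logb 2 x ∂ν < 1)
    (hpos : ∀ᵐ x ∂ν, 0 < x) (hmom : ∀ p : ℝ, Integrable (fun x : ℝ => x ^ p) ν)
    (hmeas : ∀ m r, r ≠ [] → Measurable (W m r)) (hlaw : ∀ m r, r ≠ [] → P.map (W m r) = ν)
    (hindep : iIndepFun (fun a : ℕ × {r : List Bool // r ≠ []} => W a.1 a.2.1) P) :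
    ∀ᵐ ω ∂P, (∀ m s, s ≠ [] → 0 ≤ W m s ω) ∧ (∀ i, HasLimits (forest (fun m r => W m r ω) i)) ∧
      ∀ i, HasSmallLeaves (forest (fun m r => W m r ω) i) := by
  obtain ⟨p, hp, -, hτ⟩ := tau_pos_near_one hmean hentropy hpos hmom one_lt_two
  have hm := mean_map_ofReal hmean hpos hmom
  have h1 : ∀ᵐ ω ∂P, ∀ m s, s ≠ [] → 0 ≤ W m s ω := by
    refine ae_all_iff.2 fun m => ae_all_iff.2 fun s => ?_
    by_cases hs : s = []
    · exact Eventually.of_forall fun ω h => absurd hs h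
    · rw [← hlaw m s hs] at hpos
      filter_upwards [ae_of_ae_map (hmeas m s hs).aemeasurable hpos] with ω h _ using h.le
  have h2 : ∀ᵐ u ∂treeLaw (ν.map ENNReal.ofReal), HasLimits u ∧ HasSmallLeaves u :=
    (ae_hasLimits hm (pos_map_ofReal hpos)
      ((ae_totalMass_ne hmean hentropy hpos hmom).mono fun u hu => hu.1)).and
    (ae_hasSmallLeaves (pos_map_ofReal hpos) (zero_lt_one.trans hp) (rate_map_lt_one hpos hmom hτ)
      (lintegral_totalMass_rpow_ne_top_of_tau_pos hmean hpos hmom hp hτ))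
  have h3 : ∀ᵐ ω ∂P, ∀ i, HasLimits (forest (fun m r => W m r ω) i) ∧
      HasSmallLeaves (forest (fun m r => W m r ω) i) := ae_all_iff.2 fun i => by
    rw [← (forest_spec hmeas hlaw hindep).1 i] at h2
    exact ae_of_ae_map (measurable_forest hmeas i).aemeasurable h2
  filter_upwards [h1, h3] with ω h1 h3
  exact ⟨h1, fun i => (h3 i).1, fun i => (h3 i).2⟩

theorem ae_hasGrowth (hT : 0 < T) (hχ : 0 < χ) (hmean : ∫ x, x ∂ν = 1)
    (hentropy : ∫ x, x * Real.logb 2 x ∂ν < 1)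
    (hpos : ∀ᵐ x ∂ν, 0 < x) (hmom : ∀ p : ℝ, Integrable (fun x : ℝ => x ^ p) ν)
    (hmeas : ∀ m r, r ≠ [] → Measurable (W m r)) (hlaw : ∀ m r, r ≠ [] → P.map (W m r) = ν)
    (hindep : iIndepFun (fun a : ℕ × {r : List Bool // r ≠ []} => W a.1 a.2.1) P)
    (hgap : -χ < p * deriv (tau ν) p - tau ν p)
    (hfin₁ : ∫⁻ u, totalMass u ^ p ∂treeLaw (ν.map ENNReal.ofReal) ≠ ⊤)
    (hfin : ∀ᶠ q in 𝓝[>] (1 : ℝ),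
      ∫⁻ u, totalMass u ^ (p * q) ∂treeLaw (ν.map ENNReal.ofReal) ≠ ⊤) :
    ∀ᵐ ω ∂P, HasGrowth ν T χ (fun m r => W m r ω) p := by
  obtain ⟨hl, hi⟩ := forest_spec hmeas hlaw hindep
  have hU := measurable_forest hmeas
  obtain ⟨c, hc, hlow⟩ := ae_le_sum_observed hχ hpos hmom hU hl hi
    (ae_totalMass_ne hmean hentropy hpos hmom) hgap hfin₁ hfin
  have hup : ∀ᵐ ω ∂P, ∀ n : ℕ, _ := ae_all_iff.2 fun n : ℕ =>
    ae_sum_observed_le (χ := χ) hpos hmom hU hl hfin₁ (Nat.one_div_pos_of_nat (α := ℝ) (n := n))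
  have ha : 0 < T ^ p * 2 ^ (-p) := by positivity
  filter_upwards [ae_regular hmean hentropy hpos hmom hmeas hlaw hindep, hlow, hup]
    with ω ⟨hw, hL, hs⟩ h1 h2
  have hne : ∀ j, ∑ i ∈ observed χ j, partition p j (forest (fun m r => W m r ω) i) ≠ ⊤ :=
    fun j => ENNReal.sum_ne_top.2 fun i _ => (hL i).partition_ne_top p j
  refine ⟨fun n => ?_, ?_⟩
  · refine exists_le_of_eventually_succ_le ha one_pos (by positivity)
      (fun j => sum_cellMass_rpow hT hw hL hs p j) ?_
    filter_upwards [h2 n] with j hj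
    rw [one_mul]
    exact ENNReal.toReal_le_of_le_ofReal (by positivity) hj
  · refine exists_ge_of_eventually_le_succ ha hc (by positivity)
      (fun j => sum_cellMass_rpow hT hw hL hs p j) ?_
    filter_upwards [h1] with j hj
    exact (ENNReal.ofReal_le_iff_le_toReal (hne j)).1 hj

end Main

end
end MixedCascade

/-! ### The supremum and the infimum. -/

namespace MixedCascade
section
open scoped ENNReal NNReal

variable {Ω : Type*} [MeasurableSpace Ω] {P : Measure Ω} [IsProbabilityMeasure P]
  {ν : Measure ℝ} [IsProbabilityMeasure ν] {W : ℕ → List Bool → Ω → ℝ} {T χ : ℝ}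

theorem ae_tendsto_logb_sup_cellMass (hmean : ∫ x, x ∂ν = 1)
    (hentropy : ∫ x, x * Real.logb 2 x ∂ν < 1) (hpos : ∀ᵐ x ∂ν, 0 < x)
    (hmom : ∀ p : ℝ, Integrable (fun x : ℝ => x ^ p) ν)
    (hmeas : ∀ m r, r ≠ [] → Measurable (W m r)) (hlaw : ∀ m r, r ≠ [] → P.map (W m r) = ν)
    (hindep : iIndepFun (fun a : ℕ × {r : List Bool // r ≠ []} => W a.1 a.2.1) P)
    (hT : 0 < T) (hχ : 0 < χ) (hp : pPlus ν χ < ⊤) (hτ : 0 ≤ tau ν (pPlus ν χ).toReal) :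
    ∀ᵐ ω ∂P, Tendsto (fun j : ℕ => Real.logb 2 (⨆ k : Fin (sampleSize χ j),
      cellMass T (fun m r => W m r ω) j k) / (-(j : ℝ))) atTop (𝓝 (hPlus ν χ)) := by
  obtain ⟨hp1, heq, hlt⟩ := pPlus_spec hmean hentropy hpos hmom hχ hp
  have hfin : ∀ p : ℝ, 1 < p → p < (pPlus ν χ).toReal →
      ∫⁻ u, totalMass u ^ p ∂treeLaw (ν.map ENNReal.ofReal) ≠ ⊤ := fun p h1 h2 =>
    lintegral_totalMass_rpow_ne_top_of_tau_pos hmean hpos hmom h1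
      (tau_pos hmean hentropy hpos hmom hτ h1 h2)
  -- Rational exponents allow a single null set for all of them.
  have hgrow : ∀ᵐ ω ∂P, ∀ q : ℚ, (q : ℝ) ∈ Set.Ioo 1 (pPlus ν χ).toReal →
      HasGrowth ν T χ (fun m r => W m r ω) q := by
    refine ae_all_iff.2 fun q => ?_
    by_cases hq : (q : ℝ) ∈ Set.Ioo 1 (pPlus ν χ).toReal
    swap
    · exact Eventually.of_forall fun ω h => absurd h hq
    have hq0 : (0 : ℝ) < q := zero_lt_one.trans hq.1
    have := ae_hasGrowth hT hχ hmean hentropy hpos hmom hmeas hlaw hindep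
      (hlt q hq.1.le hq.2) (hfin q hq.1 hq.2) (by
        -- For `1 < r < p_χ^+ / q` the order `q r` stays in the range of finite moments.
        filter_upwards [Ioo_mem_nhdsGT ((one_lt_div hq0).2 hq.2)] with r hr
        rw [Set.mem_Ioo, lt_div_iff₀ hq0] at hr
        exact hfin _ (by nlinarith [hr.1, hq.1]) (by linarith [hr.2]))
    exact this.mono fun ω h _ => h
  filter_upwards [hgrow, ae_regular hmean hentropy hpos hmom hmeas hlaw hindep]
    with ω hg ⟨hw, hL, hs⟩
  have h := tendsto_logb_sup_div (N := sampleSize χ) (sampleSize_pos hχ)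
    (A := fun j k => cellMass T (fun m r => W m r ω) j k)
    (fun j k => cellMass_pos hT hw hL hs j k) (f := fun q => χ - tau ν q) zero_le_one hp1
    ((differentiable_tau hpos hmom _).hasDerivAt.const_sub χ) (by linarith)
    (fun q hq => (hg q hq).upper) fun q hq => (hg q hq).lower
  have h2 := h.neg
  simp only [neg_neg, ← div_neg] at h2
  exact h2

theorem ae_tendsto_logb_inf_cellMass (hmean : ∫ x, x ∂ν = 1)
    (hentropy : ∫ x, x * Real.logb 2 x ∂ν < 1) (hpos : ∀ᵐ x ∂ν, 0 < x)
    (hmom : ∀ p : ℝ, Integrable (fun x : ℝ => x ^ p) ν)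
    (hmeas : ∀ m r, r ≠ [] → Measurable (W m r)) (hlaw : ∀ m r, r ≠ [] → P.map (W m r) = ν)
    (hindep : iIndepFun (fun a : ℕ × {r : List Bool // r ≠ []} => W a.1 a.2.1) P)
    (hT : 0 < T) (hχ : 0 < χ) (hp : ⊥ < pMinus ν χ) :
    ∀ᵐ ω ∂P, Tendsto (fun j : ℕ => Real.logb 2 (⨅ k : Fin (sampleSize χ j),
      cellMass T (fun m r => W m r ω) j k) / (-(j : ℝ))) atTop (𝓝 (hMinus ν χ)) := by
  obtain ⟨hp1, heq, hlt⟩ := pMinus_spec hpos hmom hχ hp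
  have hfin : ∀ p : ℝ, p < 0 → ∫⁻ u, totalMass u ^ p ∂treeLaw (ν.map ENNReal.ofReal) ≠ ⊤ :=
    fun p h => lintegral_totalMass_rpow_ne_top_of_neg hmean hentropy hpos hmom h
  have hgrow : ∀ᵐ ω ∂P, ∀ q : ℚ, (q : ℝ) ∈ Set.Ioo 0 (-(pMinus ν χ).toReal) →
      HasGrowth ν T χ (fun m r => W m r ω) (-q) := by
    refine ae_all_iff.2 fun q => ?_
    by_cases hq : (q : ℝ) ∈ Set.Ioo 0 (-(pMinus ν χ).toReal)
    swap
    · exact Eventually.of_forall fun ω h => absurd h hq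
    have hq0 : -(q : ℝ) < 0 := neg_neg_of_pos hq.1
    have := ae_hasGrowth hT hχ hmean hentropy hpos hmom hmeas hlaw hindep
      (hlt (-q) hq0.le (by linarith [hq.2])) (hfin _ hq0) (by
        filter_upwards [self_mem_nhdsWithin] with r hr
        exact hfin _ (mul_neg_of_neg_of_pos hq0 (zero_lt_one.trans hr)))
    exact this.mono fun ω h _ => h
  filter_upwards [hgrow, ae_regular hmean hentropy hpos hmom hmeas hlaw hindep]
    with ω hg ⟨hw, hL, hs⟩
  set A : ∀ j, Fin (sampleSize χ j) → ℝ := fun j k => cellMass T (fun m r => W m r ω) j k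
  have hA : ∀ j k, 0 < A j k := fun j k => cellMass_pos hT hw hL hs j k
  have hpow : ∀ (q : ℝ) j k, (A j k)⁻¹ ^ q = A j k ^ (-q) := fun q j k => by
    rw [Real.inv_rpow (hA j k).le, Real.rpow_neg (hA j k).le]
  have hd : HasDerivAt (fun q => χ - tau ν (-q)) (deriv (tau ν) (pMinus ν χ).toReal)
      (-(pMinus ν χ).toReal) := by
    have h1 : HasDerivAt (tau ν) (deriv (tau ν) (pMinus ν χ).toReal)
        (- -(pMinus ν χ).toReal) := by
      rw [neg_neg]; exact (differentiable_tau hpos hmom _).hasDerivAt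
    simpa using (h1.comp _ (hasDerivAt_neg _)).const_sub χ
  -- The maximum of the inverse masses, with `f q = χ - τ(-q)` on `(0, -p_χ^-)`. All negative
  -- moments are finite, so no sign condition on `τ` is needed.
  have h := tendsto_logb_sup_div (N := sampleSize χ) (sampleSize_pos hχ)
    (A := fun j k => (A j k)⁻¹) (fun j k => inv_pos.2 (hA j k)) le_rfl (neg_pos.2 hp1) hd
    (by rw [neg_neg]; linarith)
    (fun q hq => by simp_rw [hpow]; exact (hg q hq).upper)
    (fun q hq => by simp_rw [hpow]; exact (hg q hq).lower)
  refine h.congr fun j => ?_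
  have : Nonempty (Fin (sampleSize χ j)) := ⟨⟨0, sampleSize_pos hχ j⟩⟩
  obtain ⟨k, hk⟩ := exists_eq_ciInf_of_finite (f := A j)
  have hinv : ⨆ k, (A j k)⁻¹ = (⨅ k, A j k)⁻¹ := by
    refine le_antisymm (ciSup_le fun i => ?_) ?_
    · rw [← hk]
      refine inv_anti₀ (hA j k) ?_
      rw [hk]
      exact ciInf_le (Set.finite_range _).bddBelow i
    · rw [← hk]
      exact le_ciSup (f := fun k => (A j k)⁻¹) (Set.finite_range _).bddAbove k
  rw [hinv, Real.logb_inv, neg_div, div_neg]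

end
end MixedCascade

theorem mainTheorem3
    {Ω : Type*} [MeasurableSpace Ω] (P : Measure Ω) [IsProbabilityMeasure P]
    -- the law of the generator `W`
    (ν : Measure ℝ) [IsProbabilityMeasure ν]
    (hmean : ∫ x, x ∂ν = 1)
    (hentropy : ∫ x, x * Real.logb 2 x ∂ν < 1)
    (hne_one : ν {1} < 1)
    (hpos : ∀ᵐ x ∂ν, 0 < x)
    (hmoments : ∀ p : ℝ, Integrable (fun x : ℝ => x ^ p) ν)
    -- the i.i.d. weights `W m r` of the `m`-th cascade, for `r` a nonempty finite word
    (W : ℕ → List Bool → Ω → ℝ)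
    (hmeas : ∀ m r, r ≠ [] → Measurable (W m r))
    (hlaw : ∀ m r, r ≠ [] → P.map (W m r) = ν)
    (hindep : iIndepFun (fun a : ℕ × {r : List Bool // r ≠ []} => W a.1 a.2.1) P)
    (T χ : ℝ) (hT : 0 < T) (hχ : 0 < χ) :
    (MixedCascade.pPlus ν χ < ⊤ →
      0 ≤ MixedCascade.tau ν (MixedCascade.pPlus ν χ).toReal →
      ∀ᵐ ω ∂P, Tendsto
        (fun j : ℕ =>
          Real.logb 2 (⨆ k : Fin (MixedCascade.sampleSize χ j),
            MixedCascade.cellMass T (fun m r => W m r ω) j k) / (-(j : ℝ)))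
        atTop (𝓝 (MixedCascade.hPlus ν χ))) ∧
    (⊥ < MixedCascade.pMinus ν χ →
      ∀ᵐ ω ∂P, Tendsto
        (fun j : ℕ =>
          Real.logb 2 (⨅ k : Fin (MixedCascade.sampleSize χ j),
            MixedCascade.cellMass T (fun m r => W m r ω) j k) / (-(j : ℝ)))
        atTop (𝓝 (MixedCascade.hMinus ν χ))) := by
  exact ⟨MixedCascade.ae_tendsto_logb_sup_cellMass hmean hentropy hpos hmoments hmeas hlaw hindep hT hχ,
    MixedCascade.ae_tendsto_logb_inf_cellMass hmean hentropy hpos hmoments hmeas hlaw hindep hT hχ⟩
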